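/- **Theorem ($k$-cosymplectic Darboux theorem).** Let $M$ be a smooth manifold of dimension $n(k+1)+k$, and let $(\eta^1,\dots,\eta^k,\omega^1,\dots,\omega^k,V)$ be a $k$-cosymplectic structure on $M$. That is, $\eta^1,\dots,\eta^k$ are closed smooth one-forms, $\omega^1,\dots,\omega^k$ are closed smooth two-forms, and $V$ is an integrable (equivalently, involutive) smooth regular distribution of rank $nk$ on $M$ such that, at every point and for all $\alpha$, 1. $\eta^1\wedge\dots\wedge\eta^k\neq 0$, $\eta^\alpha|_V=0$ and $\omega^\alpha|_{V\times V}=0$; 2. $\bigcap_{\alpha=1}^k(\ker\eta^\alpha\cap\ker\omega^\alpha)=\{0\}$ and $\operatorname{rk}\bigcap_{\alpha=1}^k\ker\omega^\alpha=k$, where $\ker\omega^\alpha=\{v:\iota_v\omega^\alpha=0\}$. Let $R_1,\dots,R_k$ be the Reeb vector fields, i.e. the unique vector fields with $\iota_{R_\alpha}\eta^\beta=\delta^\beta_\alpha$ and $\iota_{R_\alpha}\omega^\beta=0$ for all $\alpha,\beta$. Then every point $x\in M$ has a neighbourhood with smooth local coordinates $\{x^\alpha,y^i,y^\alpha_i\}$,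 $1\le\alpha\le k$, $1\le i\le n$, such that on this neighbourhood, for all $\alpha$, $$\eta^\alpha=\mathrm{d}x^\alpha,\qquad \omega^\alpha=\sum_{i=1}^n\mathrm{d}y^i\wedge\mathrm{d}y^\alpha_i,\qquad R_\alpha=\frac{\partial}{\partial x^\alpha},$$ and such that moreover - if $k\neq 1$, then $V=\left\langle\dfrac{\partial}{\partial y^\alpha_i}\right\rangle_{1\le\alpha\le k,\ 1\le i\le n}$; - if $k=1$ and $[\ker\omega,V]\subset\ker\omega\oplus V$ with $\omega=\omega^1$ (the Lie bracket of a local section of $\ker\omega$ and a local section of $V$ takes values in $\ker\omega\oplus V$), then also $V=\left\langle\dfrac{\partial}{\partial y^1_i}\right\rangle_{1\le i\le n}$. -/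

import Mathlib

open Set Module
open scoped Manifold ContDiff

noncomputable section

/-- The wedge product `θ₁ ∧ ⋯ ∧ θ_m` of a finite family of linear forms, that is
`(θ₁ ∧ ⋯ ∧ θ_m)(v₁, …, v_m) = det (θ_j (v_i))`. -/
def wedgeForms {T : Type*} [AddCommGroup T] [Module ℝ T] {m : ℕ} (θ : Fin m → T →ₗ[ℝ] ℝ) :
    T [⋀^Fin m]→ₗ[ℝ] ℝ :=
  Matrix.detRowAlternating.compLinearMap (LinearMap.pi θ)

/-- The kernel `{v | ι_v w = 0}` of an alternating two-form `w`. -/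
def kerTwoForm {T : Type*} [AddCommGroup T] [Module ℝ T] (w : T [⋀^Fin 2]→ₗ[ℝ] ℝ) :
    Submodule ℝ T :=
  LinearMap.ker w.curryLeft

section Manifold

variable {E : Type*} [NormedAddCommGroup E] [NormedSpace ℝ E]
  {M : Type*} [TopologicalSpace M] [ChartedSpace E M]

/-- The expression of a differential `m`-form `w` on `M` in the chart `φ`, that is the pullback of
`w` by `φ⁻¹`. It is meaningful on the target of `φ`. -/
def formInChart {m : ℕ} (φ : OpenPartialHomeomorph M E)
    (w : ∀ x : M, TangentSpace 𝓘(ℝ, E) x [⋀^Fin m]→L[ℝ] ℝ) (z : E) : E [⋀^Fin m]→L[ℝ] ℝ :=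
  (w (φ.symm z)).compContinuousLinearMap
    ((mfderiv 𝓘(ℝ, E) 𝓘(ℝ, E) φ.symm z).comp
      (NormedSpace.fromTangentSpace (𝕜 := ℝ) z).symm.toContinuousLinearMap)

/-- Smooth differential forms: smooth in every chart of the atlas. -/
def IsSmoothForm {m : ℕ} (w : ∀ x : M, TangentSpace 𝓘(ℝ, E) x [⋀^Fin m]→L[ℝ] ℝ) : Prop :=
  ∀ φ ∈ atlas E M, ContDiffOn ℝ ∞ (formInChart φ w) φ.target

/-- Closed differential forms: `dw = 0` in every chart of the atlas. -/
def IsClosedForm {m : ℕ} (w : ∀ x : M, TangentSpace 𝓘(ℝ, E) x [⋀^Fin m]→L[ℝ] ℝ) : Prop :=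
  ∀ φ ∈ atlas E M, ∀ z ∈ φ.target, extDeriv (formInChart φ w) z = 0

/-- A field of covectors, seen as a differential form of degree one. -/
def oneForm (θ : ∀ x : M, TangentSpace 𝓘(ℝ, E) x →L[ℝ] ℝ) (x : M) :
    TangentSpace 𝓘(ℝ, E) x [⋀^Fin 1]→L[ℝ] ℝ :=
  ContinuousAlternatingMap.ofSubsingleton ℝ (TangentSpace 𝓘(ℝ, E) x) ℝ 0 (θ x)

/-- Indices of the coordinates `x^α`, `y^i` and `y^α_i`, in this order. -/
abbrev DarbouxIndex (n k : ℕ) : Type := Fin k ⊕ Fin n ⊕ (Fin k × Fin n)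

/-- Local coordinates on `M` indexed by `ι`: a homeomorphism from an open subset of `M` onto an
open subset of `ℝ^ι` which is smooth with smooth inverse. -/
structure IsSmoothCoordinates {ι : Type*} [Fintype ι] (φ : OpenPartialHomeomorph M (ι → ℝ)) :
    Prop where
  contMDiffOn : ContMDiffOn 𝓘(ℝ, E) 𝓘(ℝ, ι → ℝ) ∞ φ φ.source
  contMDiffOn_symm : ContMDiffOn 𝓘(ℝ, ι → ℝ) 𝓘(ℝ, E) ∞ φ.symm φ.target

/-- The differential `dc^j` of the `j`-th coordinate function, at the point `x`. -/
def coordDiff {ι : Type*} [Fintype ι] (φ : OpenPartialHomeomorph M (ι → ℝ)) (j : ι) (x : M) :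
    TangentSpace 𝓘(ℝ, E) x →L[ℝ] ℝ :=
  mvfderiv 𝓘(ℝ, E) (fun q => φ q j) x

/-- The coordinate vector `∂/∂c^j` at the point with coordinates `z`. -/
def coordVector {ι : Type*} [Fintype ι] [DecidableEq ι] (φ : OpenPartialHomeomorph M (ι → ℝ))
    (j : ι) (z : ι → ℝ) : TangentSpace 𝓘(ℝ, E) (φ.symm z) :=
  mfderiv 𝓘(ℝ, ι → ℝ) 𝓘(ℝ, E) φ.symm z
    ((NormedSpace.fromTangentSpace (𝕜 := ℝ) z).symm (Pi.single j 1))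

variable [IsManifold 𝓘(ℝ, E) ∞ M]

/-- `X` is a smooth vector field on the set `U`. -/
def IsSmoothFieldOn (X : ∀ x : M, TangentSpace 𝓘(ℝ, E) x) (U : Set M) : Prop :=
  ContMDiffOn 𝓘(ℝ, E) (𝓘(ℝ, E)).tangent ∞ (fun x => (⟨x, X x⟩ : TangentBundle 𝓘(ℝ, E) M)) U

/-- `D` is a smooth (regular) distribution of rank `r`: near each point it is spanned by `r`
pointwise linearly independent smooth vector fields. -/
def IsSmoothDistribution (r : ℕ) (D : ∀ x : M, Submodule ℝ (TangentSpace 𝓘(ℝ, E) x)) : Prop :=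
  ∀ x₀ : M, ∃ U : Set M, IsOpen U ∧ x₀ ∈ U ∧
    ∃ X : Fin r → ∀ x : M, TangentSpace 𝓘(ℝ, E) x,
      (∀ i, IsSmoothFieldOn (X i) U) ∧
      ∀ x ∈ U, LinearIndependent ℝ (fun i => X i x) ∧ Submodule.span ℝ (range fun i => X i x) = D x

/-- `[D₁, D₂] ⊆ D₃`: the Lie bracket of local smooth vector fields with values in `D₁` and in `D₂`
takes values in `D₃`. -/
def BracketSubset (D₁ D₂ D₃ : ∀ x : M, Submodule ℝ (TangentSpace 𝓘(ℝ, E) x)) : Prop :=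
  ∀ (U : Set M) (X Y : ∀ x : M, TangentSpace 𝓘(ℝ, E) x), IsOpen U →
    IsSmoothFieldOn X U → IsSmoothFieldOn Y U →
    (∀ x ∈ U, X x ∈ D₁ x) → (∀ x ∈ U, Y x ∈ D₂ x) →
    ∀ x ∈ U, VectorField.mlieBracket 𝓘(ℝ, E) X Y x ∈ D₃ x

variable (E M) in
/-- A `k`-cosymplectic structure on a manifold `M` of dimension `n (k + 1) + k`. Integrability of
the regular distribution `V` is expressed as involutivity. The two-forms `ω^α` are called `Ω α`. -/
structure KCosymplecticStructure (n k : ℕ) where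
  dim_eq : finrank ℝ E = n * (k + 1) + k
  η : Fin k → ∀ x : M, TangentSpace 𝓘(ℝ, E) x →L[ℝ] ℝ
  Ω : Fin k → ∀ x : M, TangentSpace 𝓘(ℝ, E) x [⋀^Fin 2]→L[ℝ] ℝ
  V : ∀ x : M, Submodule ℝ (TangentSpace 𝓘(ℝ, E) x)
  smooth_η : ∀ α, IsSmoothForm (oneForm (η α))
  closed_η : ∀ α, IsClosedForm (oneForm (η α))
  smooth_Ω : ∀ α, IsSmoothForm (Ω α)
  closed_Ω : ∀ α, IsClosedForm (Ω α)
  distribution_V : IsSmoothDistribution (n * k) V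
  integrable_V : BracketSubset V V V
  wedge_η_ne_zero : ∀ x, wedgeForms (fun α => (η α x).toLinearMap) ≠ 0
  η_V : ∀ α x, ∀ v ∈ V x, η α x v = 0
  Ω_V : ∀ α x, ∀ v ∈ V x, ∀ w ∈ V x, Ω α x ![v, w] = 0
  iInf_ker_eq_bot : ∀ x, (⨅ α, LinearMap.ker (η α x).toLinearMap ⊓
    kerTwoForm (Ω α x).toAlternatingMap) = ⊥
  rank_iInf_ker : ∀ x,
    finrank ℝ (⨅ α, kerTwoForm (Ω α x).toAlternatingMap : Submodule ℝ (TangentSpace 𝓘(ℝ, E) x)) = k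

namespace KCosymplecticStructure

variable [FiniteDimensional ℝ E] {n k : ℕ}

/-- At each point there are unique tangent vectors with `η^β(R_α) = δ^β_α` and
`ι_{R_α} Ω_β = 0`. -/
theorem existsUnique_reeb (S : KCosymplecticStructure E M n k) (α : Fin k) (x : M) :
    ∃! v : TangentSpace 𝓘(ℝ, E) x, (∀ β, S.η β x v = if β = α then 1 else 0) ∧
      ∀ β, v ∈ kerTwoForm (S.Ω β x).toAlternatingMap := by
  let K : Submodule ℝ (TangentSpace 𝓘(ℝ, E) x) := ⨅ β, kerTwoForm (S.Ω β x).toAlternatingMap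
  have : FiniteDimensional ℝ (TangentSpace 𝓘(ℝ, E) x) := inferInstanceAs (FiniteDimensional ℝ E)
  let L : K →ₗ[ℝ] (Fin k → ℝ) := (LinearMap.pi fun β => (S.η β x).toLinearMap).comp K.subtype
  have hinj : Function.Injective L := by
    rw [injective_iff_map_eq_zero]
    intro v hv
    have hmem : (v : TangentSpace 𝓘(ℝ, E) x) ∈ ⨅ β, (LinearMap.ker (S.η β x).toLinearMap ⊓
        kerTwoForm (S.Ω β x).toAlternatingMap) := by
      rw [Submodule.mem_iInf]
      intro β
      exact ⟨congrFun hv β, (Submodule.mem_iInf _).1 v.2 β⟩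
    rw [S.iInf_ker_eq_bot x, Submodule.mem_bot] at hmem
    exact Subtype.ext hmem
  have hsurj : Function.Surjective L := by
    refine (LinearMap.injective_iff_surjective_of_finrank_eq_finrank ?_).1 hinj
    rw [finrank_fin_fun]
    exact S.rank_iInf_ker x
  obtain ⟨v, hv⟩ := hsurj (fun β => if β = α then 1 else 0)
  refine ⟨v, ⟨fun β => congrFun hv β, fun β => (Submodule.mem_iInf _).1 v.2 β⟩, ?_⟩
  rintro w ⟨hw, hw'⟩
  have hwK : w ∈ K := (Submodule.mem_iInf _).2 hw'
  have : (⟨w, hwK⟩ : K) = v := by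
    apply hinj
    rw [hv]
    funext β
    exact hw β
  exact congrArg Subtype.val this

/-- The Reeb vector fields `R_α` of a `k`-cosymplectic structure. -/
def reeb (S : KCosymplecticStructure E M n k) (α : Fin k) (x : M) : TangentSpace 𝓘(ℝ, E) x :=
  (S.existsUnique_reeb α x).choose

theorem reeb_spec (S : KCosymplecticStructure E M n k) (α : Fin k) (x : M) :
    (∀ β, S.η β x (S.reeb α x) = if β = α then 1 else 0) ∧
      ∀ β, S.reeb α x ∈ kerTwoForm (S.Ω β x).toAlternatingMap :=
  (S.existsUnique_reeb α x).choose_spec.1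

end KCosymplecticStructure

end Manifold

end

/-!
The kernel common to the two-forms has rank `k` and is complementary to the common kernel of the
one-forms, so the Reeb fields form a smooth frame `Y` dual to the `η^α`
(`exists_smooth_reeb_frame`). By closedness of the forms, all `η^α` and all `ω^α` vanish on the
brackets of the Reeb fields, hence these commute, and near each point there are coordinates
`(ξ^α, z)`, with `dξ^α = η^α`, in which they are the `∂/∂ξ^α`. In these coordinates closedness
makes each `ω^α` the pullback of a two-form on the slice `ξ = 0`
(`eventually_twoForm_eq_of_basic`). The fields with values in `V` are killed by the `η^α`, so
they are tangent to this slice, and there they span an involutive distribution of rank `n k`,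
isotropic for all the restricted forms, in dimension `n (k + 1)`.

On the slice the problem is the Darboux theorem for closed two-forms with a common isotropic
foliation of codimension `n` (`exists_darboux_functions_of_isotropic_frame`): if `y^1, …, y^n` are
first integrals defining the foliation, the relative Poincaré lemma (`exists_relative_primitive`)
gives each two-form a primitive `-∑ p^α_i dy^i`. This is done in `exists_darboux_functions`; the
functions `ξ`, `y`, `p` are coordinates because the forms have no common kernel. So far `V` has
entered only through its restriction to the slice, and nothing is known about the `dy^i` on `V` at
the other points.

For `k ≠ 1` this is a matter of linear algebra (`coord_y_eq_zero_of_isotropic`): a subspace of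
dimension `n k` in the common kernel of the `dx^α`, isotropic for all the forms `∑ dy^i ∧ dp^α_i`,
is contained in the common kernel of the `dy^i`. For `k = 1` there are other Lagrangian subspaces,
and the bracket hypothesis is needed. The bracket of a Reeb field and of a section of `V` is killed
by the `η^α`, so the hypothesis places it in `V`. Thus `V` is invariant under the flows of the Reeb
fields, that is, under translations in `ξ`, and the `dy^i`, which vanish on `V` along the slice, do
so everywhere (`eventually_apply_snd_eq_zero_of_invariant`).

Frobenius' theorem, which provides first integrals (`exists_first_integral`), is proved by
integrating the total differential equation `dF = A(u, F) du` along rays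
(`exists_totalDifferential_solution`). The smooth dependence of the solution on `u` and on the
initial value follows from the implicit function theorem in the Banach space of curves on `[0, 1]`,
on which postcomposition with a smooth map is a smooth operation (`ContDiff.postcomp`).

All maps on vector spaces are globally defined and smooth, and the identities hold near a base
point; `exists_contDiff_eventuallyEq` reduces to this case.
-/

noncomputable section

open Filter Topology

/-! ### Smooth maps on spaces of curves -/

section Calculus

/-- A function which is smooth near a point agrees near that point with a globally smooth one. -/
theorem exists_contDiff_eventuallyEq {E F : Type*} [NormedAddCommGroup E] [NormedSpace ℝ E]
    [FiniteDimensional ℝ E] [NormedAddCommGroup F] [NormedSpace ℝ F] {f : E → F} {x₀ : E}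
    (h : ∀ᶠ x in 𝓝 x₀, ContDiffAt ℝ ∞ f x) : ∃ g : E → F, ContDiff ℝ ∞ g ∧ g =ᶠ[𝓝 x₀] f := by
  obtain ⟨r, hr, hball⟩ := Metric.eventually_nhds_iff_ball.1 h
  let χ : ContDiffBump x₀ := ⟨r / 4, r / 2, by positivity, by linarith⟩
  refine ⟨fun x => χ x • f x, ?_, ?_⟩
  · rw [contDiff_iff_contDiffAt]
    intro x
    by_cases hx : x ∈ Metric.ball x₀ r
    · exact χ.contDiff.contDiffAt.smul (hball x hx)
    · have hx' : x ∉ tsupport χ := by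
        rw [χ.tsupport_eq]
        intro hmem
        simp only [χ, Metric.mem_closedBall, Metric.mem_ball] at hmem hx
        linarith
      have h0 : (fun x => χ x • f x) =ᶠ[𝓝 x] fun _ => 0 := by
        filter_upwards [notMem_tsupport_iff_eventuallyEq.1 hx'] with y hy
        simp [hy]
      exact contDiffAt_const.congr_of_eventuallyEq h0
  · filter_upwards [χ.eventuallyEq_one] with x hx
    simp [hx]

/-- Pointwise evaluation `(A, γ) ↦ (s ↦ A s (γ s))` of operator-valued continuous maps, as a
bounded bilinear map. -/
def ContinuousMap.pointwiseApplyL (K F G : Type*) [TopologicalSpace K] [CompactSpace K]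
    [NormedAddCommGroup F] [NormedSpace ℝ F] [NormedAddCommGroup G] [NormedSpace ℝ G] :
    C(K, F →L[ℝ] G) →L[ℝ] C(K, F) →L[ℝ] C(K, G) :=
  LinearMap.mkContinuous₂
    (LinearMap.mk₂ ℝ (fun (A : C(K, F →L[ℝ] G)) (γ : C(K, F)) =>
        (⟨fun s => A s (γ s), by fun_prop⟩ : C(K, G)))
      (fun _ _ _ => by ext; simp) (fun _ _ _ => by ext; simp)
      (fun _ _ _ => by ext; simp) (fun _ _ _ => by ext; simp)) 1 (by
    intro A γ
    rw [one_mul, ContinuousMap.norm_le _ (by positivity)]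
    intro s
    exact (A s).le_of_opNorm_le_of_le (A.norm_coe_le_norm s) (γ.norm_coe_le_norm s))

@[simp]
theorem ContinuousMap.pointwiseApplyL_apply {K F G : Type*} [TopologicalSpace K] [CompactSpace K]
    [NormedAddCommGroup F] [NormedSpace ℝ F] [NormedAddCommGroup G] [NormedSpace ℝ G]
    (A : C(K, F →L[ℝ] G)) (γ : C(K, F)) (s : K) :
    ContinuousMap.pointwiseApplyL K F G A γ s = A s (γ s) := rfl

/-- Postcomposition with a `C¹` map is differentiable on spaces of continuous maps. -/
theorem ContDiff.hasFDerivAt_postcomp {K F G : Type*} [TopologicalSpace K] [CompactSpace K]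
    [NormedAddCommGroup F] [NormedSpace ℝ F] [NormedAddCommGroup G] [NormedSpace ℝ G]
    {g : F → G} (hg : ContDiff ℝ 1 g) (γ : C(K, F)) :
    HasFDerivAt (fun γ : C(K, F) => (⟨g, hg.continuous⟩ : C(F, G)).comp γ)
      (ContinuousMap.pointwiseApplyL K F G
        ((⟨fderiv ℝ g, hg.continuous_fderiv one_ne_zero⟩ : C(F, F →L[ℝ] G)).comp γ)) γ := by
  refine .of_isLittleO (Asymptotics.isLittleO_iff.2 fun c hc => ?_)
  have hcont := ContinuousMap.continuous_postcomp (X := K)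
    (⟨fderiv ℝ g, hg.continuous_fderiv one_ne_zero⟩ : C(F, F →L[ℝ] G))
  obtain ⟨δ, hδ, hball⟩ := 
    (Metric.continuous_iff (α := C(K, F)) (β := C(K, F →L[ℝ] G))).1 hcont γ c hc
  -- continuity of postcomposition with `fderiv g` makes `fderiv g` uniformly continuous along `γ`
  have key : ∀ s : K, ∀ y ∈ Metric.ball (γ s) δ, ‖fderiv ℝ g y - fderiv ℝ g (γ s)‖ ≤ c := by
    intro s y hy
    have h1 : Dist.dist (γ + ContinuousMap.const K (y - γ s)) γ < δ := by
      rw [dist_eq_norm, add_sub_cancel_left]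
      refine lt_of_le_of_lt ?_ (mem_ball_iff_norm.1 hy)
      rw [ContinuousMap.norm_le _ (norm_nonneg _)]
      intro t
      simp
    have h2 := (ContinuousMap.dist_apply_le_dist s).trans (hball _ h1).le
    simpa [dist_eq_norm] using h2
  filter_upwards [Metric.ball_mem_nhds γ hδ] with γ' hγ'
  rw [ContinuousMap.norm_le _ (by positivity)]
  intro s
  have hs : γ' s ∈ Metric.ball (γ s) δ := lt_of_le_of_lt (ContinuousMap.dist_apply_le_dist s) hγ'
  have := (convex_ball (γ s) δ).norm_image_sub_le_of_norm_hasFDerivWithin_le'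
    (f := g) (f' := fderiv ℝ g) (φ := fderiv ℝ g (γ s)) (C := c)
    (fun x _ => (hg.differentiable one_ne_zero x).hasFDerivAt.hasFDerivWithinAt)
    (fun x hx => key s x hx) (Metric.mem_ball_self hδ) hs
  refine this.trans (mul_le_mul_of_nonneg_left ?_ hc.le)
  exact (γ' - γ).norm_coe_le_norm s

universe u w

/-- The derivative of `γ ↦ g ∘ γ` at `γ`, being pointwise application of the postcomposition of `γ`
with `fderiv g`, is `C^m` by induction on `m`, for all `g` and all target spaces at once. -/
theorem ContDiff.postcomp_nat {K : Type*} [TopologicalSpace K] [CompactSpace K]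
    {F : Type u} [NormedAddCommGroup F] [NormedSpace ℝ F] (m : ℕ) :
    ∀ {G : Type max u w} [NormedAddCommGroup G] [NormedSpace ℝ G] {g : F → G}
      (hg : ContDiff ℝ ∞ g),
      ContDiff ℝ m (fun γ : C(K, F) => (⟨g, hg.continuous⟩ : C(F, G)).comp γ) := by
  induction m with
  | zero =>
    intro G _ _ g hg
    exact contDiff_zero.2 (ContinuousMap.continuous_postcomp _)
  | succ m ih =>
    intro G _ _ g hg
    have hg' : ContDiff ℝ ∞ (fderiv ℝ g) := hg.fderiv_right (by simp)
    rw [Nat.cast_add, Nat.cast_one, contDiff_succ_iff_hasFDerivAt]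
    exact ⟨fun γ => ContinuousMap.pointwiseApplyL K F G
        ((⟨fderiv ℝ g, hg'.continuous⟩ : C(F, F →L[ℝ] G)).comp γ),
      ContDiff.comp (g := ContinuousMap.pointwiseApplyL K F G)
        (ContinuousLinearMap.contDiff _) (ih hg'),
      fun γ => (hg.of_le (by simp)).hasFDerivAt_postcomp γ⟩

/-- Postcomposition with a smooth map is smooth on spaces of continuous maps. -/
theorem ContDiff.postcomp {K : Type*} [TopologicalSpace K] [CompactSpace K]
    {F : Type u} [NormedAddCommGroup F] [NormedSpace ℝ F]
    {G : Type w} [NormedAddCommGroup G] [NormedSpace ℝ G] {g : F → G} (hg : ContDiff ℝ ∞ g) :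
    ContDiff ℝ ∞ (fun γ : C(K, F) => (⟨g, hg.continuous⟩ : C(F, G)).comp γ) := by
  -- the induction runs over target spaces in a universe which contains the spaces `F →L[ℝ] G`
  let e : ULift.{u} G ≃L[ℝ] G := ContinuousLinearEquiv.ulift
  have h1 : ContDiff ℝ ∞ (fun x => e.symm (g x)) := e.symm.contDiff.comp hg
  have h2 := contDiff_infty.2 fun m => ContDiff.postcomp_nat.{u, w} (K := K) m h1
  exact ((e : ULift.{u} G →L[ℝ] G).compLeftContinuous ℝ K).contDiff.comp h2

/-- A continuous linear map into a space of continuous maps on a compact space, built from a jointly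
continuous family of linear maps with a uniform bound. -/
def ContinuousMap.familyL {K E F : Type*} [TopologicalSpace K] [CompactSpace K]
    [NormedAddCommGroup E] [NormedSpace ℝ E] [NormedAddCommGroup F] [NormedSpace ℝ F]
    (A : C(K, E →L[ℝ] F)) : E →L[ℝ] C(K, F) :=
  LinearMap.mkContinuous
    { toFun := fun x => (⟨fun s => A s x, by fun_prop⟩ : C(K, F))
      map_add' := fun _ _ => by ext; simp
      map_smul' := fun _ _ => by ext; simp } ‖A‖ (by
    intro x
    rw [ContinuousMap.norm_le _ (by positivity)]
    intro s
    exact (A s).le_of_opNorm_le (A.norm_coe_le_norm s) x)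

@[simp]
theorem ContinuousMap.familyL_apply {K E F : Type*} [TopologicalSpace K] [CompactSpace K]
    [NormedAddCommGroup E] [NormedSpace ℝ E] [NormedAddCommGroup F] [NormedSpace ℝ F]
    (A : C(K, E →L[ℝ] F)) (x : E) (s : K) : ContinuousMap.familyL A x s = A s x := rfl

/-- The antiderivative `γ ↦ (t ↦ ∫₀ᵗ γ)` as a bounded operator on curves parametrised by
`[0, 1]`. -/
def antiderivL (F : Type*) [NormedAddCommGroup F] [NormedSpace ℝ F] :
    C(Icc (0 : ℝ) 1, F) →L[ℝ] C(Icc (0 : ℝ) 1, F) :=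
  LinearMap.mkContinuous
    { toFun := fun γ => ⟨fun t => ∫ s in (0 : ℝ)..t, IccExtend zero_le_one γ s, by
        have : Continuous fun t : ℝ => ∫ s in (0 : ℝ)..t, IccExtend zero_le_one γ s :=
          intervalIntegral.continuous_primitive
            (fun a b => (γ.continuous.Icc_extend').intervalIntegrable a b) 0
        exact this.comp continuous_subtype_val⟩
      map_add' := fun γ γ' => by
        ext t
        exact intervalIntegral.integral_add ((γ.continuous.Icc_extend').intervalIntegrable _ _)
          ((γ'.continuous.Icc_extend').intervalIntegrable _ _)
      map_smul' := fun c γ => by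
        ext t
        exact intervalIntegral.integral_smul c _ } 1 (by
    intro γ
    rw [one_mul, ContinuousMap.norm_le _ (norm_nonneg _)]
    intro t
    have h : ‖∫ s in (0 : ℝ)..t, IccExtend zero_le_one γ s‖ ≤ ‖γ‖ * |(t : ℝ) - 0| :=
      intervalIntegral.norm_integral_le_of_norm_le_const fun s _ => γ.norm_coe_le_norm _
    refine h.trans (mul_le_of_le_one_right (norm_nonneg _) ?_)
    rw [sub_zero, abs_of_nonneg t.2.1]
    exact t.2.2)

theorem antiderivL_apply {F : Type*} [NormedAddCommGroup F] [NormedSpace ℝ F]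
    (γ : C(Icc (0 : ℝ) 1, F)) (t : Icc (0 : ℝ) 1) :
    antiderivL F γ t = ∫ s in (0 : ℝ)..t, IccExtend zero_le_one γ s := rfl

/-- Integrals over `[0, 1]` depend smoothly on parameters, and can be differentiated under the
integral sign. -/
theorem ContDiff.parametric_integral {E F : Type*} [NormedAddCommGroup E]
    [NormedSpace ℝ E] [NormedAddCommGroup F] [NormedSpace ℝ F] [CompleteSpace F] {f : ℝ × E → F}
    (hf : ContDiff ℝ ∞ f) :
    ContDiff ℝ ∞ (fun x => ∫ t in (0 : ℝ)..1, f (t, x)) ∧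
    ∀ x v, fderiv ℝ (fun x => ∫ t in (0 : ℝ)..1, f (t, x)) x v =
      ∫ t in (0 : ℝ)..1, fderiv ℝ f (t, x) (0, v) := by
  let K := Icc (0 : ℝ) 1
  let one : K := ⟨1, right_mem_Icc.2 zero_le_one⟩
  -- the curve `t ↦ (t, x)` is an affine function of `x`
  let c : C(K, ℝ × E) := ⟨fun t => ((t : ℝ), 0), by fun_prop⟩
  let L : E →L[ℝ] C(K, ℝ × E) := ContinuousMap.familyL
    (ContinuousMap.const K (ContinuousLinearMap.inr ℝ ℝ E))
  have hcurve : ∀ x t, (c + L x) t = ((t : ℝ), x) := by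
    intro x t
    simp [c, L]
  let J : C(K, F) →L[ℝ] F := (ContinuousMap.evalCLM ℝ one).comp (antiderivL F)
  have hJ : ∀ γ : C(K, F), J γ = ∫ s in (0 : ℝ)..1, IccExtend zero_le_one γ s := fun γ => rfl
  have hE : ∀ (g : ℝ → F) (γ : C(K, F)), (∀ t : K, γ t = g t) →
      J γ = ∫ s in (0 : ℝ)..1, g s := by
    intro g γ h
    rw [hJ]
    refine intervalIntegral.integral_congr fun s hs => ?_
    rw [uIcc_of_le zero_le_one] at hs
    simp only [IccExtend_of_mem _ _ hs, h]
  have hform : (fun x => ∫ t in (0 : ℝ)..1, f (t, x)) =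
      fun x => J ((⟨f, hf.continuous⟩ : C(ℝ × E, F)).comp (c + L x)) := by
    funext x
    refine (hE (fun t => f (t, x)) _ fun t => ?_).symm
    simp only [ContinuousMap.comp_apply, hcurve]
    rfl
  have haff : ∀ x, HasFDerivAt (fun x => c + L x) L x := fun x => L.hasFDerivAt.const_add c
  constructor
  · rw [hform]
    exact J.contDiff.comp (hf.postcomp.comp (contDiff_const.add L.contDiff))
  · intro x v
    have hd := J.hasFDerivAt.comp x
      (((hf.of_le (by simp)).hasFDerivAt_postcomp (c + L x)).comp x (haff x))
    have hd' : fderiv ℝ (fun x => J ((⟨f, hf.continuous⟩ : C(ℝ × E, F)).comp (c + L x))) x = _ :=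
      hd.fderiv
    rw [hform, hd']
    refine hE (fun t => fderiv ℝ f (t, x) (0, v)) (ContinuousMap.pointwiseApplyL K (ℝ × E) F
      ((⟨fderiv ℝ f, hf.continuous_fderiv (by simp)⟩ : C(ℝ × E, ℝ × E →L[ℝ] F)).comp (c + L x))
      (L v)) fun t => ?_
    simp only [ContinuousMap.pointwiseApplyL_apply, ContinuousMap.comp_apply, hcurve]
    rfl

/-- Inverse function theorem for globally defined smooth maps; the local inverse is extended to a
globally defined smooth map. -/
theorem ContDiff.exists_local_inverse {E F : Type*} [NormedAddCommGroup E] [NormedSpace ℝ E]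
    [FiniteDimensional ℝ E] [NormedAddCommGroup F] [NormedSpace ℝ F] [FiniteDimensional ℝ F]
    {f : E → F} (hf : ContDiff ℝ ∞ f) {x₀ : E} (hinj : Function.Injective (fderiv ℝ f x₀))
    (hdim : finrank ℝ E = finrank ℝ F) :
    ∃ g : F → E, ContDiff ℝ ∞ g ∧ g (f x₀) = x₀ ∧ (∀ᶠ x in 𝓝 x₀, g (f x) = x) ∧
      ∀ᶠ y in 𝓝 (f x₀), f (g y) = y := by
  have := FiniteDimensional.complete ℝ E
  let e : E ≃L[ℝ] F := ContinuousLinearEquiv.ofBijective (fderiv ℝ f x₀)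
    (LinearMap.ker_eq_bot.2 hinj) (LinearMap.range_eq_top.2
      ((LinearMap.injective_iff_surjective_of_finrank_eq_finrank hdim).1 hinj))
  have he : HasFDerivAt f (e : E →L[ℝ] F) x₀ := (hf.differentiable (by simp) x₀).hasFDerivAt
  let φ := hf.contDiffAt.toOpenPartialHomeomorph f he (by simp)
  have hx₀ : x₀ ∈ φ.source := hf.contDiffAt.mem_toOpenPartialHomeomorph_source he (by simp)
  have hφ : ∀ x, φ x = f x := fun x => rfl
  have hfx₀ : f x₀ ∈ φ.target := φ.map_source hx₀
  have hsymm₀ : φ.symm (f x₀) = x₀ := φ.left_inv hx₀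
  -- the derivative of `f` stays invertible near `x₀`
  have hiso : ∀ᶠ x in 𝓝 x₀, fderiv ℝ f x ∈ range ((↑) : (E ≃L[ℝ] F) → E →L[ℝ] F) := by
    refine (hf.continuous_fderiv (by simp)).continuousAt.eventually_mem ?_
    rw [← he.fderiv.symm]
    exact ContinuousLinearEquiv.nhds e
  have hsmooth : ∀ᶠ y in 𝓝 (f x₀), ContDiffAt ℝ ∞ φ.symm y := by
    have hc : Tendsto φ.symm (𝓝 (f x₀)) (𝓝 x₀) := by
      simpa [hsymm₀] using (φ.continuousAt_symm hfx₀).tendsto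
    filter_upwards [hc.eventually hiso, φ.open_target.mem_nhds hfx₀] with y ⟨e', he'⟩ hy
    refine φ.contDiffAt_symm hy (f₀' := e') ?_ hf.contDiffAt
    rw [he']
    exact (hf.differentiable (by simp) _).hasFDerivAt
  obtain ⟨g, hg, hge⟩ := exists_contDiff_eventuallyEq hsmooth
  refine ⟨g, hg, hge.self_of_nhds.trans hsymm₀, ?_, ?_⟩
  · filter_upwards [hf.continuous.continuousAt.eventually hge, φ.open_source.mem_nhds hx₀]
      with x hx hxs
    rw [hx]
    exact φ.left_inv hxs
  · filter_upwards [hge, φ.open_target.mem_nhds hfx₀] with y hy hyt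
    rw [hy]
    exact φ.right_inv hyt

/-- A smooth family of endomorphisms which is the identity at a point has a smooth family of
inverses near this point. -/
theorem ContDiff.exists_inverse_family {E F : Type*} [NormedAddCommGroup E] [NormedSpace ℝ E]
    [FiniteDimensional ℝ E] [NormedAddCommGroup F] [NormedSpace ℝ F] [FiniteDimensional ℝ F]
    {A : E → F →L[ℝ] F} (hA : ContDiff ℝ ∞ A) {x₀ : E} (h₀ : A x₀ = .id ℝ F) :
    ∃ C : E → F →L[ℝ] F, ContDiff ℝ ∞ C ∧
      ∀ᶠ x in 𝓝 x₀, (∀ v, C x (A x v) = v) ∧ ∀ v, A x (C x v) = v := by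
  have := FiniteDimensional.complete ℝ F
  have hunit : ∀ᶠ x in 𝓝 x₀, IsUnit (A x) := by
    refine hA.continuous.continuousAt.eventually (Units.isOpen.mem_nhds ?_)
    rw [h₀]
    exact isUnit_one
  have hs : ∀ᶠ x in 𝓝 x₀, ContDiffAt ℝ ∞ (fun x => Ring.inverse (A x)) x := by
    filter_upwards [hunit] with x ⟨u, hu⟩
    have := contDiffAt_ringInverse ℝ (n := ∞) u
    rw [hu] at this
    exact this.comp x hA.contDiffAt
  obtain ⟨C, hC, hCe⟩ := exists_contDiff_eventuallyEq hs
  refine ⟨C, hC, ?_⟩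
  filter_upwards [hCe, hunit] with x hx hu
  constructor
  · intro v
    rw [hx]
    exact DFunLike.congr_fun (Ring.inverse_mul_cancel _ hu) v
  · intro v
    rw [hx]
    exact DFunLike.congr_fun (Ring.mul_inverse_cancel _ hu) v

end Calculus

/-! ### Frobenius' theorem -/

section Frobenius

/-- Implicit function theorem for a smooth map, with smoothness of the solution at all points near
the base point. -/
theorem ContDiff.exists_implicit {E F G : Type*} [NormedAddCommGroup E] [NormedSpace ℝ E]
    [CompleteSpace E] [NormedAddCommGroup F] [NormedSpace ℝ F] [CompleteSpace F]
    [NormedAddCommGroup G] [NormedSpace ℝ G] [CompleteSpace G] {f : E × F → G}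
    (hf : ContDiff ℝ ∞ f) {u : E × F}
    (hu : (fderiv ℝ f u ∘L ContinuousLinearMap.inr ℝ E F).IsInvertible) :
    ∃ ψ : E → F, ψ u.1 = u.2 ∧ ∀ᶠ x in 𝓝 u.1, ContDiffAt ℝ ∞ ψ x ∧ f (x, ψ x) = f u := by
  have hn : (∞ : WithTop ℕ∞) ≠ 0 := by simp
  have hc : ∀ v, ContDiffAt ℝ ∞ f v := fun v => hf.contDiffAt
  let ψ := (hc u).implicitFunction hn hu
  have hψu : ψ u.1 = u.2 := (hc u).implicitFunction_apply_self hn hu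
  have hψc : ContinuousAt ψ u.1 := ((hc u).contDiffAt_implicitFunction hn hu).continuousAt
  have hpair : Tendsto (fun x => (x, ψ x)) (𝓝 u.1) (𝓝 u) := by
    have h : ContinuousAt (fun x => (x, ψ x)) u.1 := continuousAt_id.prodMk hψc
    simpa [ContinuousAt, hψu] using h
  have hinv : ∀ᶠ v in 𝓝 u, (fderiv ℝ f v ∘L ContinuousLinearMap.inr ℝ E F).IsInvertible := by
    obtain ⟨e, he⟩ := hu
    have hcont : Continuous fun v => fderiv ℝ f v ∘L ContinuousLinearMap.inr ℝ E F :=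
      (hf.continuous_fderiv hn).clm_comp continuous_const
    have := hcont.continuousAt (x := u) |>.eventually_mem
      (he ▸ ContinuousLinearEquiv.nhds e)
    exact this
  have huniq := (hc u).eventually_apply_eq_iff_implicitFunction hn hu
  refine ⟨ψ, hψu, ?_⟩
  filter_upwards [hpair.eventually hinv, hpair.eventually huniq.eventually_nhds,
    (hc u).eventually_apply_implicitFunction hn hu] with x hx hux hfx
  refine ⟨?_, hfx⟩
  -- near `x`, the solution coincides with the one provided by the theorem at the point `(x, ψ x)`
  have hs := (hc (x, ψ x)).contDiffAt_implicitFunction hn hx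
  refine hs.congr_of_eventuallyEq ?_
  have hself := (hc (x, ψ x)).implicitFunction_apply_self hn hx
  have hpair' : Tendsto (fun y => (y, (hc (x, ψ x)).implicitFunction hn hx y)) (𝓝 x)
      (𝓝 (x, ψ x)) := by
    have h : ContinuousAt (fun y => (y, (hc (x, ψ x)).implicitFunction hn hx y)) x :=
      continuousAt_id.prodMk hs.continuousAt
    have hself' : (hc (x, ψ x)).implicitFunction hn hx x = ψ x := hself
    simpa only [ContinuousAt, hself'] using h
  filter_upwards [hpair'.eventually hux,
    (hc (x, ψ x)).eventually_apply_implicitFunction hn hx] with y hy hy'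
  exact hy.1 (hy'.trans hfx)

theorem antiderivL_apply_of_eqOn {F : Type*} [NormedAddCommGroup F] [NormedSpace ℝ F]
    {γ : C(Icc (0 : ℝ) 1, F)} {f : ℝ → F} (h : ∀ s : Icc (0 : ℝ) 1, γ s = f s)
    (t : Icc (0 : ℝ) 1) : antiderivL F γ t = ∫ s in (0 : ℝ)..t, f s := by
  rw [antiderivL_apply]
  refine intervalIntegral.integral_congr fun s hs => ?_
  rw [uIcc_of_le t.2.1] at hs
  have hs' : s ∈ Icc (0 : ℝ) 1 := ⟨hs.1, hs.2.trans t.2.2⟩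
  simp only [IccExtend_of_mem _ _ hs', h]

/-- The linear algebra of radial integration: the derivative `h` of the solution of
`W' = A (t u, W) u` in a direction `v` of the parameter `u` equals `t A (t u, W) v`, because the
difference solves a homogeneous linear equation thanks to the integrability condition. -/
theorem radial_variation_eq {P Q : Type*} [NormedAddCommGroup P] [NormedSpace ℝ P]
    [NormedAddCommGroup Q] [NormedSpace ℝ Q] [CompleteSpace Q]
    {A : P × Q → P →L[ℝ] Q} (hA : ContDiff ℝ ∞ A) {u v : P} {q : Q} {γ h : ℝ → Q}
    (hγ : Continuous γ) (hh : Continuous h)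
    (hint : ∀ t ∈ Icc (0 : ℝ) 1, fderiv ℝ A (t • u, γ t) (u, A (t • u, γ t) u) v =
      fderiv ℝ A (t • u, γ t) (v, A (t • u, γ t) v) u)
    (hγi : ∀ t ∈ Icc (0 : ℝ) 1, γ t = q + ∫ s in (0 : ℝ)..t, A (s • u, γ s) u)
    (hhi : ∀ t ∈ Icc (0 : ℝ) 1, h t = ∫ s in (0 : ℝ)..t,
      (fderiv ℝ A (s • u, γ s) (s • v, h s) u + A (s • u, γ s) v)) :
    h 1 = A (u, γ 1) v := by
  have hA' : Continuous (fderiv ℝ A) := hA.continuous_fderiv (by simp)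
  have hAc : Continuous A := hA.continuous
  let γ₁ : ℝ → Q := fun t => q + ∫ s in (0 : ℝ)..t, A (s • u, γ s) u
  let h₁ : ℝ → Q := fun t => ∫ s in (0 : ℝ)..t,
      (fderiv ℝ A (s • u, γ s) (s • v, h s) u + A (s • u, γ s) v)
  have hγ₁ : ∀ t, HasDerivAt γ₁ (A (t • u, γ t) u) t := fun t =>
    (intervalIntegral.integral_hasDerivAt_right
      (Continuous.intervalIntegrable (by fun_prop) _ _)
      (Continuous.stronglyMeasurableAtFilter (by fun_prop) _ _)
      (Continuous.continuousAt (by fun_prop))).const_add q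
  have hh₁ : ∀ t, HasDerivAt h₁
      (fderiv ℝ A (t • u, γ t) (t • v, h t) u + A (t • u, γ t) v) t := fun t =>
    intervalIntegral.integral_hasDerivAt_right
      (Continuous.intervalIntegrable (by fun_prop) _ _)
      (Continuous.stronglyMeasurableAtFilter (by fun_prop) _ _)
      (Continuous.continuousAt (by fun_prop))
  let k : ℝ → Q := fun t => h₁ t - t • A (t • u, γ₁ t) v
  have hk : ∀ t ∈ Icc (0 : ℝ) 1,
      HasDerivAt k (fderiv ℝ A (t • u, γ t) (0, k t) u) t := by
    intro t ht
    have e1 : γ₁ t = γ t := (hγi t ht).symm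
    have e2 : h₁ t = h t := (hhi t ht).symm
    have hpt : HasDerivAt (fun t : ℝ => (t • u, γ₁ t)) (u, A (t • u, γ t) u) t := by
      have h1 : HasDerivAt (fun t : ℝ => t • u) u t := by
        simpa using (hasDerivAt_id t).smul_const u
      exact h1.prodMk (hγ₁ t)
    have hd : HasDerivAt (fun t : ℝ => A (t • u, γ₁ t))
        (fderiv ℝ A (t • u, γ₁ t) (u, A (t • u, γ t) u)) t :=
      ((hA.differentiable (by simp) _).hasFDerivAt.comp_hasDerivAt t hpt)
    have hd2 : HasDerivAt (fun t : ℝ => A (t • u, γ₁ t) v)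
        (fderiv ℝ A (t • u, γ₁ t) (u, A (t • u, γ t) u) v) t := by
      simpa using hd.clm_apply (hasDerivAt_const t v)
    have hd3 := (hh₁ t).sub ((hasDerivAt_id t).smul hd2)
    refine hd3.congr_deriv ?_
    have hk0 : k t = h t - t • A (t • u, γ t) v := by simp only [k, e1, e2]
    have hsplit : ((0 : P), k t) = (t • v, h t) - t • (v, A (t • u, γ t) v) := by
      rw [hk0]
      ext <;> simp
    rw [hsplit, map_sub, map_smul, sub_apply, smul_apply,
      ← hint t ht, e1]
    simp only [id, one_smul]
    abel
  obtain ⟨C, hC⟩ := (isCompact_Icc (a := (0 : ℝ)) (b := 1)).exists_bound_of_continuousOn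
    (f := fun t => fderiv ℝ A (t • u, γ t)) (hA'.comp (by fun_prop)).continuousOn
  have hzero := eq_zero_of_abs_deriv_le_mul_abs_self_of_eq_zero_right (f := k) (K := C * ‖u‖)
    (fun t ht => (hk t ht).continuousAt.continuousWithinAt)
    (fun t ht => (hk t (Ico_subset_Icc_self ht)).hasDerivWithinAt) (by simp [k, h₁])
    (fun t ht => by
      have hb := hC t (Ico_subset_Icc_self ht)
      have h1 := (fderiv ℝ A (t • u, γ t)).le_of_opNorm_le hb ((0 : P), k t)
      have h2 := (fderiv ℝ A (t • u, γ t) (0, k t)).le_opNorm u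
      have h3 : ‖((0 : P), k t)‖ = ‖k t‖ := by simp [Prod.norm_def]
      rw [h3] at h1
      calc _ ≤ _ := h2
        _ ≤ C * ‖k t‖ * ‖u‖ := by gcongr
        _ = _ := by ring)
  have h1 := hzero 1 (right_mem_Icc.2 zero_le_one)
  have e1 : γ₁ 1 = γ 1 := (hγi 1 (right_mem_Icc.2 zero_le_one)).symm
  have e2 : h₁ 1 = h 1 := (hhi 1 (right_mem_Icc.2 zero_le_one)).symm
  simp only [k, e1, e2, one_smul] at h1
  exact sub_eq_zero.1 h1

/-- Frobenius' theorem for the total differential equation `dF = A(u, F) du`: under the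
integrability condition it has a solution with prescribed initial values, depending smoothly on
them. The solution is found by integrating along the rays through the origin. -/
theorem exists_totalDifferential_solution {P Q : Type*} [NormedAddCommGroup P] [NormedSpace ℝ P]
    [FiniteDimensional ℝ P] [NormedAddCommGroup Q] [NormedSpace ℝ Q] [FiniteDimensional ℝ Q]
    {A : P × Q → P →L[ℝ] Q} (hA : ContDiff ℝ ∞ A)
    (hint : ∀ᶠ x in 𝓝 (0 : P × Q), ∀ v w,
      fderiv ℝ A x (v, A x v) w = fderiv ℝ A x (w, A x w) v) :
    ∃ F : P × Q → Q, ContDiff ℝ ∞ F ∧ (∀ᶠ q in 𝓝 (0 : Q), F (0, q) = q) ∧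
      ∀ᶠ x in 𝓝 (0 : P × Q), ∀ v, fderiv ℝ F x (v, 0) = A (x.1, F x) v := by
  have := FiniteDimensional.complete ℝ P
  have := FiniteDimensional.complete ℝ Q
  let K := Icc (0 : ℝ) 1
  let g : (P × Q) × P → Q := fun y => A y.1 y.2
  have hg : ContDiff ℝ ∞ g := (hA.comp contDiff_fst).clm_apply contDiff_snd
  have hgd : ∀ y dy, fderiv ℝ g y dy = fderiv ℝ A y.1 dy.1 y.2 + A y.1 dy.2 := by
    intro y dy
    have h1 : HasFDerivAt (fun y : (P × Q) × P => A y.1) _ y :=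
      (hA.differentiable (by simp) y.1).hasFDerivAt.comp y hasFDerivAt_fst
    have h2 := h1.clm_apply (hasFDerivAt_snd (p := y))
    rw [show g = fun y => A y.1 y.2 from rfl, h2.fderiv]
    simp [add_comm]
  -- `L (u, γ)` is the curve `s ↦ ((s u, γ s), u)`
  let L : P × C(K, Q) →L[ℝ] C(K, (P × Q) × P) :=
    (ContinuousMap.familyL (⟨fun s : K =>
      (ContinuousLinearMap.inl ℝ (P × Q) P ∘L ContinuousLinearMap.inl ℝ P Q ∘L
        ((s : ℝ) • ContinuousLinearMap.id ℝ P)) + ContinuousLinearMap.inr ℝ (P × Q) P,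
          by fun_prop⟩ : C(K, P →L[ℝ] (P × Q) × P))) ∘L ContinuousLinearMap.fst ℝ P C(K, Q) +
    ((ContinuousLinearMap.inl ℝ (P × Q) P ∘L ContinuousLinearMap.inr ℝ P Q).compLeftContinuous ℝ K)
      ∘L ContinuousLinearMap.snd ℝ P C(K, Q)
  have hL : ∀ u γ s, L (u, γ) s = (((s : ℝ) • u, γ s), u) := by
    intro u γ s
    simp [L]
  let cst : Q →L[ℝ] C(K, Q) := ContinuousMap.familyL
    (ContinuousMap.const K (ContinuousLinearMap.id ℝ Q))
  have hcst : ∀ q s, cst q s = q := fun q s => rfl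
  let ev : C(K, Q) →L[ℝ] Q := ContinuousMap.evalCLM ℝ (⟨1, right_mem_Icc.2 zero_le_one⟩ : K)
  have hev : ∀ γ : C(K, Q), ev γ = γ ⟨1, right_mem_Icc.2 zero_le_one⟩ := fun γ => rfl
  let gc : C((P × Q) × P, Q) := ⟨g, hg.continuous⟩
  let Φ : (P × Q) × C(K, Q) → C(K, Q) := fun x =>
    x.2 - cst x.1.2 - antiderivL Q (gc.comp (L (x.1.1, x.2)))
  have hΦ : ContDiff ℝ ∞ Φ := by
    have h1 : ContDiff ℝ ∞ fun x : (P × Q) × C(K, Q) => L (x.1.1, x.2) :=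
      L.contDiff.comp ((contDiff_fst.comp contDiff_fst).prodMk contDiff_snd)
    have h2 : ContDiff ℝ ∞ fun x : (P × Q) × C(K, Q) =>
        antiderivL Q (gc.comp (L (x.1.1, x.2))) :=
      (antiderivL Q).contDiff.comp (hg.postcomp.comp h1)
    exact (contDiff_snd.sub (cst.contDiff.comp (contDiff_snd.comp contDiff_fst))).sub h2
  -- at `u = 0` the equation reads `γ = q`, so its derivative in `γ` is the identity
  have hΦ0 : ∀ q γ, Φ ((0, q), γ) = γ - cst q := by
    intro q γ
    have h0 : gc.comp (L (0, γ)) = 0 := by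
      ext s
      simp [gc, g, hL]
    simp [Φ, h0]
  have hinv : (fderiv ℝ Φ (0, 0) ∘L ContinuousLinearMap.inr ℝ (P × Q) C(K, Q)).IsInvertible := by
    have h1 : HasFDerivAt (fun γ : C(K, Q) => Φ (0, γ))
        (fderiv ℝ Φ (0, 0) ∘L ContinuousLinearMap.inr ℝ (P × Q) C(K, Q)) 0 :=
      HasFDerivAt.comp (f := fun γ : C(K, Q) => ((0 : P × Q), γ)) 0
        (hΦ.differentiable (by simp) _).hasFDerivAt (hasFDerivAt_prodMk_right _ _)
    have h2 : (fun γ : C(K, Q) => Φ (0, γ)) = id := by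
      funext γ
      exact (hΦ0 0 γ).trans (by simp)
    rw [h2] at h1
    rw [h1.unique (hasFDerivAt_id _)]
    exact ⟨.refl ℝ _, rfl⟩
  obtain ⟨Γ₀, hΓ₀0, hΓ₀⟩ := hΦ.exists_implicit hinv
  obtain ⟨Γ, hΓ, hΓe⟩ := exists_contDiff_eventuallyEq (hΓ₀.mono fun _ h => h.1)
  have hΓ0 : Γ 0 = 0 := hΓe.self_of_nhds.trans hΓ₀0
  have hΓeq : ∀ᶠ x in 𝓝 (0 : P × Q),
      Γ x = cst x.2 + antiderivL Q (gc.comp (L (x.1, Γ x))) := by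
    filter_upwards [hΓe, hΓ₀] with x hx hx'
    have h := hx'.2
    rw [← hx] at h
    have h00 : Φ (0, 0) = 0 := (hΦ0 0 0).trans (by simp)
    rw [h00] at h
    rw [← sub_eq_zero, ← sub_sub]
    exact h
  refine ⟨fun x => ev (Γ x), ev.contDiff.comp hΓ, ?_, ?_⟩
  · have hc : Tendsto (fun q : Q => ((0 : P), q)) (𝓝 0) (𝓝 0) := by
      have : Continuous fun q : Q => ((0 : P), q) := by fun_prop
      exact this.tendsto' 0 0 rfl
    filter_upwards [hc.eventually hΓeq] with q hq
    have h0 : gc.comp (L (0, Γ (0, q))) = 0 := by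
      ext s
      simp [gc, g, hL]
    simp only [h0, map_zero, add_zero] at hq
    rw [hq]
    rfl
  · obtain ⟨ε, hε, hball⟩ := Metric.eventually_nhds_iff_ball.1 hint
    have hsmall : ∀ᶠ x in 𝓝 (0 : P × Q), ‖Γ x‖ < ε := by
      have : ContinuousAt (fun x => ‖Γ x‖) 0 := hΓ.continuous.norm.continuousAt
      refine this.eventually_lt_const ?_
      change ‖Γ 0‖ < ε
      rwa [hΓ0, norm_zero]
    have hsmall' : ∀ᶠ x in 𝓝 (0 : P × Q), ‖x.1‖ < ε := by
      have : ContinuousAt (fun x : P × Q => ‖x.1‖) 0 := by fun_prop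
      refine this.eventually_lt_const ?_
      simpa using hε
    filter_upwards [hΓeq.eventually_nhds, hsmall, hsmall'] with x hx hx1 hx2 v
    obtain ⟨u, q⟩ := x
    have hxs := hx.self_of_nhds
    let h : C(K, Q) := fderiv ℝ Γ (u, q) (v, 0)
    have hd : HasFDerivAt Γ (fderiv ℝ Γ (u, q)) (u, q) :=
      (hΓ.differentiable (by simp) _).hasFDerivAt
    have hh : h = antiderivL Q (ContinuousMap.pointwiseApplyL K ((P × Q) × P) Q
        ((⟨fderiv ℝ g, hg.continuous_fderiv (by simp)⟩ :
          C((P × Q) × P, (P × Q) × P →L[ℝ] Q)).comp (L (u, Γ (u, q)))) (L (v, h))) := by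
      have hLd : HasFDerivAt (fun x : P × Q => L (x.1, Γ x)) _ (u, q) :=
        L.hasFDerivAt.comp (u, q) (hasFDerivAt_fst.prodMk hd)
      have h1 := ((hg.of_le (by simp)).hasFDerivAt_postcomp (L (u, Γ (u, q)))).comp (u, q) hLd
      have h2 := (cst.hasFDerivAt.comp (u, q) hasFDerivAt_snd).add
        ((antiderivL Q).hasFDerivAt.comp (u, q) h1)
      have h3 := hd.unique (h2.congr_of_eventuallyEq hx)
      have h4 := DFunLike.congr_fun h3 (v, 0)
      refine h4.trans ?_
      simp only [add_apply, ContinuousLinearMap.comp_apply,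
        ContinuousLinearMap.coe_snd', map_zero, zero_add]
      rfl
    have main := radial_variation_eq (u := u) (v := v) (q := q)
      (γ := IccExtend zero_le_one (Γ (u, q))) (h := IccExtend zero_le_one h) hA
      (Γ (u, q)).continuous.Icc_extend' h.continuous.Icc_extend' ?_ ?_ ?_
    · have e1 : ∀ γ : C(K, Q), IccExtend zero_le_one γ 1 = ev γ := fun γ => by
        rw [IccExtend_of_mem _ _ (right_mem_Icc.2 zero_le_one), hev]
      rw [e1, e1] at main
      rw [← main]
      have := (ev.hasFDerivAt.comp (u, q) hd).fderiv
      exact DFunLike.congr_fun this (v, 0)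
    · intro t ht
      refine hball _ ?_ _ _
      rw [mem_ball_zero_iff, Prod.norm_def, max_lt_iff]
      refine ⟨?_, ((Γ (u, q)).norm_coe_le_norm _).trans_lt hx1⟩
      rw [norm_smul, Real.norm_of_nonneg ht.1]
      exact (mul_le_of_le_one_left (norm_nonneg _) ht.2).trans_lt hx2
    · intro t ht
      rw [IccExtend_of_mem _ _ ht]
      have h1 := DFunLike.congr_fun hxs ⟨t, ht⟩
      refine h1.trans ?_
      rw [ContinuousMap.add_apply, hcst, antiderivL_apply_of_eqOn]
      intro s
      rw [IccExtend_of_mem _ _ s.2]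
      simp [gc, g, hL]
    · intro t ht
      rw [IccExtend_of_mem _ _ ht]
      have h1 := DFunLike.congr_fun hh ⟨t, ht⟩
      refine h1.trans ?_
      rw [antiderivL_apply_of_eqOn]
      intro s
      rw [IccExtend_of_mem _ _ s.2, IccExtend_of_mem _ _ s.2]
      change fderiv ℝ g (L (u, Γ (u, q)) s) (L (v, h) s) = _
      rw [hgd, hL, hL]

/-- Frobenius' theorem in a product `R × Q`, for a frame projecting to the standard one of `R` at
the origin: near the origin there is a `Q`-valued first integral with surjective differential. -/
theorem exists_first_integral_of_fst_eq_id {R Q : Type*} [NormedAddCommGroup R] [NormedSpace ℝ R]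
    [FiniteDimensional ℝ R] [NormedAddCommGroup Q] [NormedSpace ℝ Q] [FiniteDimensional ℝ Q]
    {X : R × Q → R →L[ℝ] R × Q} (hX : ContDiff ℝ ∞ X)
    (hX0 : ContinuousLinearMap.fst ℝ R Q ∘L X 0 = .id ℝ R)
    (hinv : ∀ᶠ x in 𝓝 (0 : R × Q), ∀ a b,
      fderiv ℝ X x (X x a) b - fderiv ℝ X x (X x b) a ∈ range (X x)) :
    ∃ w : R × Q → Q, ContDiff ℝ ∞ w ∧ w 0 = 0 ∧
      (∀ v, fderiv ℝ w 0 v = 0 → v ∈ range (X 0)) ∧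
      ∀ᶠ x in 𝓝 (0 : R × Q), ∀ a, fderiv ℝ w x (X x a) = 0 := by
  obtain ⟨C, hC, hCi⟩ := ((contDiff_const (c := ContinuousLinearMap.fst ℝ R Q)).clm_comp
    hX).exists_inverse_family hX0
  -- the distribution spanned by `X` is the graph of `A`
  let A : R × Q → R →L[ℝ] Q := fun x => ContinuousLinearMap.snd ℝ R Q ∘L X x ∘L C x
  have hA : ContDiff ℝ ∞ A := contDiff_const.clm_comp (hX.clm_comp hC)
  have hXC : ∀ᶠ x in 𝓝 (0 : R × Q), ∀ v, X x (C x v) = (v, A x v) := by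
    filter_upwards [hCi] with x hx v
    exact Prod.ext (hx.2 v) rfl
  have hXA : ∀ᶠ x in 𝓝 (0 : R × Q), ∀ a, X x a = ((X x a).1, A x (X x a).1) := by
    filter_upwards [hCi, hXC] with x hx hx' a
    rw [← hx']
    congr 1
    exact (hx.1 a).symm
  have hint : ∀ᶠ x in 𝓝 (0 : R × Q), ∀ v w,
      fderiv ℝ A x (v, A x v) w = fderiv ℝ A x (w, A x w) v := by
    filter_upwards [hinv, hXC.eventually_nhds, hXA] with x h1 h2 h3 v w
    have hxs := h2.self_of_nhds
    have hdX : HasFDerivAt X (fderiv ℝ X x) x := (hX.differentiable (by simp) x).hasFDerivAt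
    have hdC : HasFDerivAt C (fderiv ℝ C x) x := (hC.differentiable (by simp) x).hasFDerivAt
    have hdA : HasFDerivAt A (fderiv ℝ A x) x := (hA.differentiable (by simp) x).hasFDerivAt
    have key : ∀ v t, ((0 : R), fderiv ℝ A x t v) =
        fderiv ℝ X x t (C x v) + X x (fderiv ℝ C x t v) := by
      intro v t
      have e1 : HasFDerivAt (fun y => X y (C y v)) _ x :=
        hdX.clm_apply (hdC.clm_apply (hasFDerivAt_const v x))
      have e2 : HasFDerivAt (fun y => (v, A y v)) _ x :=
        (hasFDerivAt_const v x).prodMk (hdA.clm_apply (hasFDerivAt_const v x))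
      have e3 := (e2.congr_of_eventuallyEq (h2.mono fun y hy => hy v)).unique e1
      have e4 := DFunLike.congr_fun e3 t
      simpa [add_comm] using e4
    have hmem : ((0 : R), fderiv ℝ A x (v, A x v) w - fderiv ℝ A x (w, A x w) v) ∈
        range (X x) := by
      have e : ((0 : R), fderiv ℝ A x (v, A x v) w - fderiv ℝ A x (w, A x w) v) =
          (fderiv ℝ X x (X x (C x v)) (C x w) - fderiv ℝ X x (X x (C x w)) (C x v)) +
          X x (fderiv ℝ C x (X x (C x v)) w - fderiv ℝ C x (X x (C x w)) v) := by
        have k1 := key w (v, A x v)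
        have k2 := key v (w, A x w)
        rw [hxs, hxs, map_sub]
        have : ((0 : R), fderiv ℝ A x (v, A x v) w - fderiv ℝ A x (w, A x w) v) =
          ((0 : R), fderiv ℝ A x (v, A x v) w) - (0, fderiv ℝ A x (w, A x w) v) := by simp
        rw [this, k1, k2]
        abel
      obtain ⟨c, hc⟩ := h1 (C x v) (C x w)
      rw [e, ← hc, ← map_add]
      exact ⟨_, rfl⟩
    obtain ⟨c, hc⟩ := hmem
    have h4 := h3 c
    have h5 : (X x c).1 = 0 := by rw [hc]
    rw [h5, map_zero, hc] at h4
    exact sub_eq_zero.1 (congrArg Prod.snd h4)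
  obtain ⟨F, hF, hF0, hFA⟩ := exists_totalDifferential_solution hA hint
  have hF00 : F 0 = 0 := hF0.self_of_nhds
  let Φ : R × Q → R × Q := fun x => (x.1, F x)
  have hΦ : ContDiff ℝ ∞ Φ := contDiff_fst.prodMk hF
  have hΦd : ∀ x v, fderiv ℝ Φ x v = (v.1, fderiv ℝ F x v) := by
    intro x v
    have : HasFDerivAt Φ _ x := hasFDerivAt_fst.prodMk (hF.differentiable (by simp) x).hasFDerivAt
    rw [this.fderiv]
    rfl
  have hF0d : ∀ b, fderiv ℝ F 0 (0, b) = b := by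
    intro b
    have e1 : HasFDerivAt (fun q : Q => F (0, q)) _ 0 :=
      HasFDerivAt.comp (f := fun q : Q => ((0 : R), q)) 0
        (hF.differentiable (by simp) _).hasFDerivAt (hasFDerivAt_prodMk_right _ _)
    have e2 := ((hasFDerivAt_id (𝕜 := ℝ) (0 : Q)).congr_of_eventuallyEq hF0).unique e1
    exact (DFunLike.congr_fun e2 b).symm
  have hΦd0 : ∀ a b, fderiv ℝ Φ 0 (a, b) = (a, A 0 a + b) := by
    intro a b
    have : ((a, b) : R × Q) = (a, 0) + (0, b) := by simp
    rw [hΦd, this, map_add, hF0d, hFA.self_of_nhds a, hF00]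
    simp [← Prod.zero_eq_mk]
  have hΦ0 : Φ 0 = 0 := Prod.ext rfl hF00
  obtain ⟨Ψ, hΨ, hΨ0, hΨΦ, hΦΨ⟩ := hΦ.exists_local_inverse (x₀ := 0) (by
    rw [injective_iff_map_eq_zero]
    rintro ⟨a, b⟩ h
    rw [hΦd0] at h
    obtain ⟨h1, h2⟩ := Prod.mk_eq_zero.1 h
    rw [h1, map_zero, zero_add] at h2
    rw [h1, h2]
    rfl) rfl
  rw [hΦ0] at hΨ0 hΦΨ
  let w : R × Q → Q := fun y => (Ψ y).2
  have hw : ContDiff ℝ ∞ w := contDiff_snd.comp hΨ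
  have hwΦ : ∀ᶠ x in 𝓝 (0 : R × Q), ∀ v, fderiv ℝ w (Φ x) (fderiv ℝ Φ x v) = v.2 := by
    filter_upwards [hΨΦ.eventually_nhds] with x hx v
    have e1 : HasFDerivAt (fun x => w (Φ x)) _ x :=
      (hw.differentiable (by simp) _).hasFDerivAt.comp x
        (hΦ.differentiable (by simp) x).hasFDerivAt
    have e2 : (fun x => w (Φ x)) =ᶠ[𝓝 x] Prod.snd := hx.mono fun y hy => congrArg Prod.snd hy
    have e3 := e1.unique (hasFDerivAt_snd.congr_of_eventuallyEq e2)
    exact DFunLike.congr_fun e3 v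
  refine ⟨w, hw, by simp [w, hΨ0], ?_, ?_⟩
  · intro v hv
    have h1 := hwΦ.self_of_nhds (v.1, v.2 - A 0 v.1)
    rw [hΦ0, hΦd0] at h1
    simp only [add_sub_cancel] at h1
    have h2 : v = (v.1, A 0 v.1) := Prod.ext rfl (sub_eq_zero.1 (h1.symm.trans hv))
    rw [h2, ← hXC.self_of_nhds]
    exact ⟨_, rfl⟩
  · have hΨc : Tendsto Ψ (𝓝 0) (𝓝 0) := hΨ.continuous.tendsto' _ _ hΨ0
    filter_upwards [hΨc.eventually hwΦ, hΨc.eventually hFA, hΦΨ, hXA] with y h1 h2 h3 h4 a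
    have e := h1 ((X y a).1, 0)
    have h5 : F (Ψ y) = y.2 := congrArg Prod.snd h3
    have h6 : (Ψ y).1 = y.1 := (congrArg Prod.fst h3 : (Φ (Ψ y)).1 = y.1)
    rw [hΦd, h2, h3, h5, h6] at e
    rw [h4]
    exact e

/-- An injective linear map is the inclusion of the first factor of a product, up to a linear
isomorphism of the target. -/
theorem exists_continuousLinearEquiv_prod {E R Q : Type*} [NormedAddCommGroup E] [NormedSpace ℝ E]
    [FiniteDimensional ℝ E] [NormedAddCommGroup R] [NormedSpace ℝ R]
    [FiniteDimensional ℝ R] [NormedAddCommGroup Q] [NormedSpace ℝ Q] [FiniteDimensional ℝ Q]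
    (f : R →L[ℝ] E) (hf : Function.Injective f) (hdim : finrank ℝ R + finrank ℝ Q = finrank ℝ E) :
    ∃ e : E ≃L[ℝ] R × Q, ∀ a, e (f a) = (a, 0) := by
  obtain ⟨C, hC⟩ := Submodule.exists_isCompl (LinearMap.range (f : R →ₗ[ℝ] E))
  let e₁ : R ≃ₗ[ℝ] LinearMap.range (f : R →ₗ[ℝ] E) := LinearEquiv.ofInjective _ hf
  have h1 := e₁.finrank_eq
  have h2 := Submodule.finrank_add_eq_of_isCompl hC
  let e₂ : Q ≃ₗ[ℝ] C := LinearEquiv.ofFinrankEq _ _ (by omega)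
  let e : (R × Q) ≃ₗ[ℝ] E := (e₁.prodCongr e₂).trans (Submodule.prodEquivOfIsCompl _ _ hC)
  refine ⟨e.symm.toContinuousLinearEquiv, fun a => ?_⟩
  change e.symm (f a) = (a, 0)
  rw [LinearEquiv.symm_apply_eq]
  simp [e, e₁]

/-- Frobenius' theorem: near a point, an involutive distribution spanned by a smooth frame
`X · a`, `a ∈ R`, is annihilated by the differential of a submersion. -/
theorem exists_first_integral {E R Q : Type*} [NormedAddCommGroup E] [NormedSpace ℝ E]
    [FiniteDimensional ℝ E] [NormedAddCommGroup R] [NormedSpace ℝ R]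
    [FiniteDimensional ℝ R] [NormedAddCommGroup Q] [NormedSpace ℝ Q] [FiniteDimensional ℝ Q]
    (hdim : finrank ℝ R + finrank ℝ Q = finrank ℝ E)
    {X : E → R →L[ℝ] E} (hX : ContDiff ℝ ∞ X) {x₀ : E} (hX0 : Function.Injective (X x₀))
    (hinv : ∀ᶠ x in 𝓝 x₀, ∀ a b,
      fderiv ℝ X x (X x a) b - fderiv ℝ X x (X x b) a ∈ range (X x)) :
    ∃ w : E → Q, ContDiff ℝ ∞ w ∧ w x₀ = 0 ∧
      (∀ v, fderiv ℝ w x₀ v = 0 → v ∈ range (X x₀)) ∧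
      ∀ᶠ x in 𝓝 x₀, ∀ a, fderiv ℝ w x (X x a) = 0 := by
  obtain ⟨e, he⟩ := exists_continuousLinearEquiv_prod (X x₀) hX0 hdim
  let τ : R × Q → E := fun y => x₀ + e.symm y
  have hτ : ContDiff ℝ ∞ τ := contDiff_const.add e.symm.contDiff
  have hτ0 : τ 0 = x₀ := by simp [τ]
  have hτd : ∀ y, HasFDerivAt τ (e.symm : R × Q →L[ℝ] E) y := fun y =>
    e.symm.hasFDerivAt.const_add x₀
  let X' : R × Q → R →L[ℝ] R × Q := fun y => (e : E →L[ℝ] R × Q) ∘L X (τ y)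
  have hX' : ContDiff ℝ ∞ X' := contDiff_const.clm_comp (hX.comp hτ)
  have hX'd : ∀ y t a, fderiv ℝ X' y t a = e (fderiv ℝ X (τ y) (e.symm t) a) := by
    intro y t a
    have h1 : HasFDerivAt (fun y => X (τ y)) _ y :=
      (hX.differentiable (by simp) _).hasFDerivAt.comp y (hτd y)
    have h2 : HasFDerivAt X' _ y := (hasFDerivAt_const (e : E →L[ℝ] R × Q) y).clm_comp h1
    rw [h2.fderiv]
    simp
  have hτc : Tendsto τ (𝓝 0) (𝓝 x₀) := hτ.continuous.tendsto' _ _ hτ0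
  obtain ⟨w, hw, hw0, hwk, hwX⟩ := exists_first_integral_of_fst_eq_id hX' (by
    ext a
    simp [X', hτ0, he]) (by
    filter_upwards [hτc.eventually hinv] with y hy a b
    obtain ⟨c, hc⟩ := hy a b
    refine ⟨c, ?_⟩
    rw [hX'd, hX'd]
    simp [X', hc])
  let σ : E → R × Q := fun x => e (x - x₀)
  have hσ : ContDiff ℝ ∞ σ := e.contDiff.comp (contDiff_id.sub contDiff_const)
  have hσ0 : σ x₀ = 0 := by simp [σ]
  have hσd : ∀ x, HasFDerivAt σ (e : E →L[ℝ] R × Q) x := fun x =>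
    (e : E →L[ℝ] R × Q).hasFDerivAt.comp x ((hasFDerivAt_id x).sub_const x₀)
  have hwσ : ∀ x v, fderiv ℝ (fun x => w (σ x)) x v = fderiv ℝ w (σ x) (e v) := by
    intro x v
    have h : HasFDerivAt (fun x => w (σ x)) _ x :=
      (hw.differentiable (by simp) _).hasFDerivAt.comp x (hσd x)
    rw [h.fderiv]
    rfl
  have hτσ : ∀ x, τ (σ x) = x := by simp [τ, σ]
  refine ⟨fun x => w (σ x), hw.comp hσ, (congrArg w hσ0).trans hw0, ?_, ?_⟩
  · intro v hv
    rw [hwσ, hσ0] at hv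
    obtain ⟨c, hc⟩ := hwk _ hv
    refine ⟨c, e.injective ?_⟩
    rw [← hc]
    simp [X', hτ0]
  · have hσc : Tendsto σ (𝓝 x₀) (𝓝 0) := hσ.continuous.tendsto' _ _ hσ0
    filter_upwards [hσc.eventually hwX] with x hx a
    rw [hwσ]
    have := hx a
    simpa [X', hτσ] using this

end Frobenius

/-! ### Closed two-forms on vector spaces -/

section TwoForms

/-- A field `B` of bilinear forms on a vector space is skew at `x`. -/
def IsSkewAt {E : Type*} [NormedAddCommGroup E] [NormedSpace ℝ E]
    (B : E → E →L[ℝ] E →L[ℝ] ℝ) (x : E) : Prop :=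
  ∀ u v, B x u v = -B x v u

/-- The condition `dB = 0` at `x`, for a field `B` of skew bilinear forms on a vector space. -/
def IsClosedAt {E : Type*} [NormedAddCommGroup E] [NormedSpace ℝ E]
    (B : E → E →L[ℝ] E →L[ℝ] ℝ) (x : E) : Prop :=
  ∀ u v w, fderiv ℝ B x u v w + fderiv ℝ B x v w u + fderiv ℝ B x w u v = 0

/-- The pullback of a field of bilinear forms by a map. -/
def pullbackForm {E F : Type*} [NormedAddCommGroup E] [NormedSpace ℝ E] [NormedAddCommGroup F]
    [NormedSpace ℝ F] (f : F → E) (B : E → E →L[ℝ] E →L[ℝ] ℝ) (x : F) : F →L[ℝ] F →L[ℝ] ℝ :=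
  (ContinuousLinearMap.compL ℝ F E ℝ).flip (fderiv ℝ f x) ∘L (B (f x) ∘L fderiv ℝ f x)

section

variable {E F : Type*} [NormedAddCommGroup E] [NormedSpace ℝ E] [NormedAddCommGroup F]
    [NormedSpace ℝ F]

@[simp]
theorem pullbackForm_apply (f : F → E) (B : E → E →L[ℝ] E →L[ℝ] ℝ) (x u v : F) :
    pullbackForm f B x u v = B (f x) (fderiv ℝ f x u) (fderiv ℝ f x v) := rfl

theorem ContDiff.pullbackForm {f : F → E} (hf : ContDiff ℝ ∞ f) {B : E → E →L[ℝ] E →L[ℝ] ℝ}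
    (hB : ContDiff ℝ ∞ B) : ContDiff ℝ ∞ (pullbackForm f B) := by
  have hf' : ContDiff ℝ ∞ (fderiv ℝ f) := hf.fderiv_right (by simp)
  exact ((ContinuousLinearMap.compL ℝ F E ℝ).flip.contDiff.comp hf').clm_comp
    ((hB.comp hf).clm_comp hf')

theorem IsSkewAt.fderiv_apply {B : E → E →L[ℝ] E →L[ℝ] ℝ} (hB : ContDiff ℝ ∞ B) {x : E}
    (h : ∀ᶠ y in 𝓝 x, IsSkewAt B y) (t u v : E) : fderiv ℝ B x t u v = -fderiv ℝ B x t v u := by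
  have hd : HasFDerivAt B (fderiv ℝ B x) x := (hB.differentiable (by simp) x).hasFDerivAt
  have h1 : ∀ u v, HasFDerivAt (fun y => B y u v) _ x := fun u v =>
    (hd.clm_apply (hasFDerivAt_const u x)).clm_apply (hasFDerivAt_const v x)
  have h2 := ((h1 u v).congr_of_eventuallyEq (f₁ := fun y => -B y v u)
    (h.mono fun y hy => (hy u v).symm)).unique (h1 v u).neg
  simpa using DFunLike.congr_fun h2 t

theorem ContDiff.fderiv_fderiv_symm {G : Type*} [NormedAddCommGroup G] [NormedSpace ℝ G]
    {f : F → G} (hf : ContDiff ℝ ∞ f) (x u v : F) :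
    fderiv ℝ (fderiv ℝ f) x u v = fderiv ℝ (fderiv ℝ f) x v u :=
  (hf.contDiffAt.isSymmSndFDerivAt (by simp [ENat.LEInfty.out])) u v

theorem fderiv_pullbackForm_apply {f : F → E} (hf : ContDiff ℝ ∞ f)
    {B : E → E →L[ℝ] E →L[ℝ] ℝ} (hB : ContDiff ℝ ∞ B) (x t u v : F) :
    fderiv ℝ (_root_.pullbackForm f B) x t u v =
      fderiv ℝ B (f x) (fderiv ℝ f x t) (fderiv ℝ f x u) (fderiv ℝ f x v) +
      B (f x) (fderiv ℝ (fderiv ℝ f) x t u) (fderiv ℝ f x v) +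
      B (f x) (fderiv ℝ f x u) (fderiv ℝ (fderiv ℝ f) x t v) := by
  have hf' : ContDiff ℝ ∞ (fderiv ℝ f) := hf.fderiv_right (by simp)
  have h1 : HasFDerivAt (_root_.pullbackForm f B) (fderiv ℝ (_root_.pullbackForm f B) x) x :=
    ((hf.pullbackForm hB).differentiable (by simp) x).hasFDerivAt
  have h2 : HasFDerivAt (fun y => _root_.pullbackForm f B y u v) _ x :=
    (h1.clm_apply (hasFDerivAt_const u x)).clm_apply (hasFDerivAt_const v x)
  have hBf : HasFDerivAt (fun y => B (f y)) _ x :=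
    (hB.differentiable (by simp) (f x)).hasFDerivAt.comp x
      (hf.differentiable (by simp) x).hasFDerivAt
  have hdf : HasFDerivAt (fderiv ℝ f) (fderiv ℝ (fderiv ℝ f) x) x :=
    (hf'.differentiable (by simp) x).hasFDerivAt
  have h3 : HasFDerivAt (fun y => B (f y) (fderiv ℝ f y u) (fderiv ℝ f y v)) _ x :=
    (hBf.clm_apply (hdf.clm_apply (hasFDerivAt_const u x))).clm_apply
      (hdf.clm_apply (hasFDerivAt_const v x))
  have h4 := DFunLike.congr_fun (h2.unique h3) t
  simp only [add_apply, ContinuousLinearMap.comp_apply, ContinuousLinearMap.flip_apply, zero_apply,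
    map_zero, zero_add] at h4
  rw [h4]
  ring

/-- Pullbacks of closed forms are closed. -/
theorem IsClosedAt.pullbackForm {f : F → E} (hf : ContDiff ℝ ∞ f)
    {B : E → E →L[ℝ] E →L[ℝ] ℝ} (hB : ContDiff ℝ ∞ B) {x : F} (hs : IsSkewAt B (f x))
    (hc : IsClosedAt B (f x)) : IsClosedAt (pullbackForm f B) x := by
  intro u v w
  have h1 := hc (fderiv ℝ f x u) (fderiv ℝ f x v) (fderiv ℝ f x w)
  simp only [fderiv_pullbackForm_apply hf hB]
  rw [hs (fderiv ℝ f x u), hs (fderiv ℝ f x v), hs (fderiv ℝ f x w), hf.fderiv_fderiv_symm x w u,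
    hf.fderiv_fderiv_symm x w v, hf.fderiv_fderiv_symm x v u]
  linarith

end

/-- Poincaré lemma with parameters for one-forms on the fibres `P × {q}`. -/
theorem exists_fiberwise_primitive {P Q : Type*} [NormedAddCommGroup P] [NormedSpace ℝ P]
    [NormedAddCommGroup Q] [NormedSpace ℝ Q] {θ : P × Q → P →L[ℝ] ℝ} (hθ : ContDiff ℝ ∞ θ)
    (hsymm : ∀ᶠ z in 𝓝 (0 : P × Q), ∀ a b, fderiv ℝ θ z (a, 0) b = fderiv ℝ θ z (b, 0) a) :
    ∃ g : P × Q → ℝ, ContDiff ℝ ∞ g ∧ ∀ᶠ z in 𝓝 (0 : P × Q), ∀ a, fderiv ℝ g z (a, 0) = θ z a := by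
  let f : ℝ × (P × Q) → ℝ := fun y => θ (y.1 • y.2.1, y.2.2) y.2.1
  have hf : ContDiff ℝ ∞ f := by fun_prop
  refine ⟨_, hf.parametric_integral.1, ?_⟩
  obtain ⟨ε, hε, hball⟩ := Metric.eventually_nhds_iff_ball.1 hsymm
  filter_upwards [Metric.ball_mem_nhds (0 : P × Q) hε] with z hz a
  rw [hf.parametric_integral.2]
  obtain ⟨p, q⟩ := z
  let c : ℝ → P × Q := fun t => (t • p, q)
  have hc : ∀ t, HasDerivAt c (p, 0) t := by
    intro t
    have h1 : HasDerivAt (fun t : ℝ => t • p) p t := by simpa using (hasDerivAt_id t).smul_const p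
    exact h1.prodMk (hasDerivAt_const t q)
  have hθd : ∀ z, HasFDerivAt θ (fderiv ℝ θ z) z := fun z =>
    (hθ.differentiable (by simp) z).hasFDerivAt
  have hprim : ∀ t, HasDerivAt (fun t => t * θ (c t) a)
      (θ (c t) a + t * fderiv ℝ θ (c t) (p, 0) a) t := by
    intro t
    have h1 : HasDerivAt (fun t => θ (c t)) (fderiv ℝ θ (c t) (p, 0)) t :=
      (hθd (c t)).comp_hasDerivAt t (hc t)
    have h2 := (hasDerivAt_id t).mul (h1.clm_apply (hasDerivAt_const t a))
    refine h2.congr_deriv ?_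
    simp
  have hfd : ∀ t ∈ Icc (0 : ℝ) 1, fderiv ℝ f (t, (p, q)) (0, (a, 0)) =
      θ (c t) a + t * fderiv ℝ θ (c t) (p, 0) a := by
    intro t ht
    have hid := hasFDerivAt_id (𝕜 := ℝ) ((t, (p, q)) : ℝ × (P × Q))
    have h1 : HasFDerivAt (fun y : ℝ × (P × Q) => (y.1 • y.2.1, y.2.2)) _ (t, (p, q)) :=
      (hid.fst.smul hid.snd.fst).prodMk hid.snd.snd
    have h2 : HasFDerivAt f _ (t, (p, q)) :=
      ((hθd (c t)).comp (t, (p, q)) h1).clm_apply hid.snd.fst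
    rw [h2.fderiv]
    have hmem : c t ∈ Metric.ball (0 : P × Q) ε := by
      rw [mem_ball_zero_iff, Prod.norm_def, max_lt_iff] at hz ⊢
      refine ⟨?_, hz.2⟩
      change ‖t • p‖ < ε
      rw [norm_smul, Real.norm_of_nonneg ht.1]
      exact (mul_le_of_le_one_left (norm_nonneg _) ht.2).trans_lt hz.1
    have h3 := hball _ hmem a p
    have h4 : ((t • a, 0) : P × Q) = t • (a, 0) := by simp
    simp [c] at h3 ⊢
    rw [h4, map_smul, smul_apply, h3, smul_eq_mul]
  have hint : ∫ t in (0 : ℝ)..1, fderiv ℝ f (t, (p, q)) (0, (a, 0)) =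
      ∫ t in (0 : ℝ)..1, (θ (c t) a + t * fderiv ℝ θ (c t) (p, 0) a) := by
    refine intervalIntegral.integral_congr fun t ht => hfd t ?_
    rwa [uIcc_of_le zero_le_one] at ht
  have hcc : Continuous c := by fun_prop
  have hθc := hθ.continuous
  have hθ'c : Continuous (fderiv ℝ θ) := hθ.continuous_fderiv (by simp)
  rw [hint, intervalIntegral.integral_eq_sub_of_hasDerivAt (fun t _ => hprim t)
    (Continuous.intervalIntegrable (by fun_prop) _ _)]
  simp [c]

/-- Poincaré lemma for two-forms near the origin of a vector space. -/
theorem exists_primitive_of_isClosedAt {E : Type*} [NormedAddCommGroup E] [NormedSpace ℝ E]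
    {B : E → E →L[ℝ] E →L[ℝ] ℝ} (hB : ContDiff ℝ ∞ B)
    (hs : ∀ᶠ x in 𝓝 (0 : E), IsSkewAt B x) (hc : ∀ᶠ x in 𝓝 (0 : E), IsClosedAt B x) :
    ∃ θ : E → E →L[ℝ] ℝ, ContDiff ℝ ∞ θ ∧
      ∀ᶠ x in 𝓝 (0 : E), ∀ u v, fderiv ℝ θ x u v - fderiv ℝ θ x v u = B x u v := by
  let f : ℝ × E → E →L[ℝ] ℝ := fun y => y.1 • B (y.1 • y.2) y.2
  have hf : ContDiff ℝ ∞ f := by fun_prop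
  refine ⟨_, hf.parametric_integral.1, ?_⟩
  obtain ⟨ε, hε, hball⟩ := Metric.eventually_nhds_iff_ball.1 (hs.eventually_nhds.and hc)
  filter_upwards [Metric.ball_mem_nhds (0 : E) hε] with x hx u v
  have hBd : ∀ x, HasFDerivAt B (fderiv ℝ B x) x := fun x =>
    (hB.differentiable (by simp) x).hasFDerivAt
  have hBc := hB.continuous
  have hB'c := hB.continuous_fderiv (by simp)
  have hfd : ∀ t u v, fderiv ℝ f (t, x) (0, u) v =
      t * (t * fderiv ℝ B (t • x) u x v + B (t • x) u v) := by
    intro t u v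
    have hid := hasFDerivAt_id (𝕜 := ℝ) ((t, x) : ℝ × E)
    have h1 : HasFDerivAt (fun y : ℝ × E => y.1 • y.2) _ (t, x) := hid.fst.smul hid.snd
    have h2 : HasFDerivAt f _ (t, x) :=
      hid.fst.smul (((hBd (t • x)).comp (t, x) h1).clm_apply hid.snd)
    rw [h2.fderiv]
    simp
    ring
  have hfc : Continuous (fderiv ℝ f) := hf.continuous_fderiv (by simp)
  have happ : ∀ u v, (∫ t in (0 : ℝ)..1, fderiv ℝ f (t, x) (0, u)) v =
      ∫ t in (0 : ℝ)..1, t * (t * fderiv ℝ B (t • x) u x v + B (t • x) u v) := by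
    intro u v
    rw [ContinuousLinearMap.intervalIntegral_apply
      (Continuous.intervalIntegrable (by fun_prop) _ _)]
    exact intervalIntegral.integral_congr fun t _ => hfd t u v
  rw [hf.parametric_integral.2, hf.parametric_integral.2, happ, happ,
    ← intervalIntegral.integral_sub (Continuous.intervalIntegrable (by fun_prop) _ _)
      (Continuous.intervalIntegrable (by fun_prop) _ _)]
  have hprim : ∀ t, HasDerivAt (fun t : ℝ => t * (t * B (t • x) u v))
      (t * (t * fderiv ℝ B (t • x) x u v) + 2 * t * B (t • x) u v) t := by
    intro t
    have h0 : HasDerivAt (fun t : ℝ => t • x) x t := by simpa using (hasDerivAt_id t).smul_const x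
    have h1 : HasDerivAt (fun t => B (t • x)) (fderiv ℝ B (t • x) x) t :=
      HasFDerivAt.comp_hasDerivAt (l := B) (f := fun t : ℝ => t • x) t (hBd (t • x)) h0
    have h2 := (hasDerivAt_id t).mul ((hasDerivAt_id t).mul
      ((h1.clm_apply (hasDerivAt_const t u)).clm_apply (hasDerivAt_const t v)))
    refine h2.congr_deriv ?_
    simp
    ring
  have hint : ∀ t ∈ uIcc (0 : ℝ) 1, t * (t * fderiv ℝ B (t • x) u x v + B (t • x) u v) -
      t * (t * fderiv ℝ B (t • x) v x u + B (t • x) v u) =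
      t * (t * fderiv ℝ B (t • x) x u v) + 2 * t * B (t • x) u v := by
    intro t ht
    rw [uIcc_of_le zero_le_one] at ht
    have hmem : t • x ∈ Metric.ball (0 : E) ε := by
      rw [mem_ball_zero_iff] at hx ⊢
      rw [norm_smul, Real.norm_of_nonneg ht.1]
      exact (mul_le_of_le_one_left (norm_nonneg _) ht.2).trans_lt hx
    obtain ⟨h1, h2⟩ := hball _ hmem
    have h3 := h2 u x v
    have h4 := IsSkewAt.fderiv_apply hB h1
    have h5 := h1.self_of_nhds v u
    rw [h4 v x u, h5]
    rw [h4 x v u] at h3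
    linear_combination t ^ 2 * h3
  rw [intervalIntegral.integral_congr hint,
    intervalIntegral.integral_eq_sub_of_hasDerivAt (fun t _ => hprim t)
    (Continuous.intervalIntegrable (by fun_prop) _ _)]
  simp

/-- Relative Poincaré lemma: a closed two-form which vanishes on the fibres `P × {q}` has a
primitive of the form `f_j dq^j`. -/
theorem exists_relative_primitive {P Q : Type*} [NormedAddCommGroup P] [NormedSpace ℝ P]
    [NormedAddCommGroup Q] [NormedSpace ℝ Q] {B : P × Q → P × Q →L[ℝ] P × Q →L[ℝ] ℝ}
    (hB : ContDiff ℝ ∞ B) (hs : ∀ᶠ z in 𝓝 (0 : P × Q), IsSkewAt B z)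
    (hc : ∀ᶠ z in 𝓝 (0 : P × Q), IsClosedAt B z)
    (h0 : ∀ᶠ z in 𝓝 (0 : P × Q), ∀ a b, B z (a, 0) (b, 0) = 0) :
    ∃ f : P × Q → Q →L[ℝ] ℝ, ContDiff ℝ ∞ f ∧ ∀ᶠ z in 𝓝 (0 : P × Q), ∀ u v,
      fderiv ℝ f z u v.2 - fderiv ℝ f z v u.2 = B z u v := by
  obtain ⟨θ, hθ, hθB⟩ := exists_primitive_of_isClosedAt hB hs hc
  have hθd : ∀ z, HasFDerivAt θ (fderiv ℝ θ z) z := fun z =>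
    (hθ.differentiable (by simp) z).hasFDerivAt
  let θP : P × Q → P →L[ℝ] ℝ := fun z => θ z ∘L ContinuousLinearMap.inl ℝ P Q
  have hθP : ContDiff ℝ ∞ θP := hθ.clm_comp contDiff_const
  have hθPd : ∀ z u a, fderiv ℝ θP z u a = fderiv ℝ θ z u (a, 0) := by
    intro z u a
    have : HasFDerivAt θP _ z := (hθd z).clm_comp (hasFDerivAt_const _ z)
    rw [this.fderiv]
    simp
  obtain ⟨g, hg, hgθ⟩ := exists_fiberwise_primitive hθP (by
    filter_upwards [hθB, h0] with z h1 h2 a b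
    rw [hθPd, hθPd, ← sub_eq_zero, h1, h2])
  -- `θ - dg` is a primitive of `B` vanishing on the fibres
  let θ' : P × Q → P × Q →L[ℝ] ℝ := fun z => θ z - fderiv ℝ g z
  have hg' : ContDiff ℝ ∞ (fderiv ℝ g) := hg.fderiv_right (by simp)
  have hθ' : ContDiff ℝ ∞ θ' := hθ.sub hg'
  have hθ'd : ∀ z, HasFDerivAt θ' (fderiv ℝ θ z - fderiv ℝ (fderiv ℝ g) z) z := fun z =>
    (hθd z).sub (hg'.differentiable (by simp) z).hasFDerivAt
  refine ⟨fun z => θ' z ∘L ContinuousLinearMap.inr ℝ P Q, hθ'.clm_comp contDiff_const, ?_⟩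
  have hfd : ∀ z u q, fderiv ℝ (fun z => θ' z ∘L ContinuousLinearMap.inr ℝ P Q) z u q =
      fderiv ℝ θ' z u (0, q) := by
    intro z u q
    have := (hθ'd z).clm_comp (hasFDerivAt_const (ContinuousLinearMap.inr ℝ P Q) z)
    rw [this.fderiv, (hθ'd z).fderiv]
    simp
  have hvan : ∀ᶠ z in 𝓝 (0 : P × Q), ∀ a, θ' z (a, 0) = 0 := by
    filter_upwards [hgθ] with z hz a
    have := hz a
    simp only [θ', sub_apply, this]
    simp [θP]
  filter_upwards [hθB, hvan.eventually_nhds] with z h1 h2 u v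
  have h3 : ∀ u (v : P × Q), fderiv ℝ θ' z u (0, v.2) = fderiv ℝ θ' z u v := by
    intro u v
    have e1 : HasFDerivAt (fun z => θ' z (v.1, 0)) _ z :=
      (hθ'd z).clm_apply (hasFDerivAt_const _ z)
    have e2 := e1.unique ((hasFDerivAt_const (0 : ℝ) z).congr_of_eventuallyEq
      (h2.mono fun y hy => hy v.1))
    have e3 := DFunLike.congr_fun e2 u
    rw [(hθ'd z).fderiv]
    have e4 : v = (v.1, 0) + (0, v.2) := by simp
    conv_rhs => rw [e4, map_add]
    simpa using e3
  rw [hfd, hfd, h3, h3, (hθ'd z).fderiv, ← h1]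
  simp only [sub_apply, hg.fderiv_fderiv_symm z u v]
  ring

end TwoForms

/-! ### Darboux coordinates for polarized families of closed two-forms -/

section KSymplectic

/-- If `g` is a local inverse of `f`, then the derivatives are inverse to each other. -/
theorem ContDiff.fderiv_comp_of_eventually_eq_id {E F : Type*} [NormedAddCommGroup E]
    [NormedSpace ℝ E] [NormedAddCommGroup F] [NormedSpace ℝ F] {f : E → F} {g : F → E}
    (hf : ContDiff ℝ ∞ f) (hg : ContDiff ℝ ∞ g) {x : E} (h : ∀ᶠ y in 𝓝 x, g (f y) = y) (v : E) :
    fderiv ℝ g (f x) (fderiv ℝ f x v) = v := by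
  have e1 : HasFDerivAt (fun y => g (f y)) _ x :=
    (hg.differentiable (by simp) _).hasFDerivAt.comp x (hf.differentiable (by simp) x).hasFDerivAt
  exact DFunLike.congr_fun (e1.unique ((hasFDerivAt_id x).congr_of_eventuallyEq h)) v

theorem fderiv_pi_apply {E ι : Type*} [NormedAddCommGroup E] [NormedSpace ℝ E] [Fintype ι]
    {f : E → ι → ℝ} {x : E} (h : DifferentiableAt ℝ f x) (i : ι) (v : E) :
    fderiv ℝ (fun y => f y i) x v = fderiv ℝ f x v i := by
  have := (hasFDerivAt_pi'.1 h.hasFDerivAt i).fderiv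
  rw [this]
  rfl

/-- Darboux' theorem for closed two-forms with a common isotropic foliation: the forms have the
shape `∑ i, dy^i ∧ dp^α_i`, where the functions `y^i` define the foliation. -/
theorem exists_darboux_functions_of_isotropic_frame {Z R : Type*} [NormedAddCommGroup Z]
    [NormedSpace ℝ Z] [FiniteDimensional ℝ Z] [NormedAddCommGroup R] [NormedSpace ℝ R]
    [FiniteDimensional ℝ R] {n k : ℕ} (hdim : finrank ℝ R + n = finrank ℝ Z)
    {B : Fin k → Z → Z →L[ℝ] Z →L[ℝ] ℝ} (hB : ∀ α, ContDiff ℝ ∞ (B α))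
    (hs : ∀ α, ∀ᶠ z in 𝓝 (0 : Z), IsSkewAt (B α) z)
    (hc : ∀ α, ∀ᶠ z in 𝓝 (0 : Z), IsClosedAt (B α) z)
    {X : Z → R →L[ℝ] Z} (hX : ContDiff ℝ ∞ X) (hX0 : Function.Injective (X 0))
    (hiso : ∀ α, ∀ᶠ z in 𝓝 (0 : Z), ∀ a b, B α z (X z a) (X z b) = 0)
    (hinv : ∀ᶠ z in 𝓝 (0 : Z), ∀ a b,
      fderiv ℝ X z (X z a) b - fderiv ℝ X z (X z b) a ∈ range (X z)) :
    ∃ (y : Fin n → Z → ℝ) (p : Fin k → Fin n → Z → ℝ),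
      (∀ i, ContDiff ℝ ∞ (y i)) ∧ (∀ α i, ContDiff ℝ ∞ (p α i)) ∧
      (∀ i, ∀ᶠ z in 𝓝 (0 : Z), ∀ a, fderiv ℝ (y i) z (X z a) = 0) ∧
      ∀ α, ∀ᶠ z in 𝓝 (0 : Z), ∀ u v, B α z u v =
        ∑ i, (fderiv ℝ (y i) z u * fderiv ℝ (p α i) z v -
          fderiv ℝ (y i) z v * fderiv ℝ (p α i) z u) := by
  let Q := Fin n → ℝ
  have hdim' : finrank ℝ R + finrank ℝ Q = finrank ℝ Z := by rw [finrank_fin_fun, hdim]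
  obtain ⟨w, hw, hw0, hwk, hwX⟩ := exists_first_integral (Q := Q) hdim' hX hX0 hinv
  obtain ⟨e, he⟩ := exists_continuousLinearEquiv_prod (Q := Q) (X 0) hX0 hdim'
  let π : Z →L[ℝ] R := ContinuousLinearMap.fst ℝ R Q ∘L (e : Z →L[ℝ] R × Q)
  have hπ0 : π ∘L X 0 = .id ℝ R := by
    ext a
    simp [π, he]
  obtain ⟨C, -, hCi⟩ := ((contDiff_const (c := π)).clm_comp hX).exists_inverse_family hπ0
  -- straightening of the foliation
  let Φ : Z → R × Q := fun z => (π z, w z)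
  have hΦ : ContDiff ℝ ∞ Φ := π.contDiff.prodMk hw
  have hwd : ∀ z, HasFDerivAt w (fderiv ℝ w z) z := fun z =>
    (hw.differentiable (by simp) z).hasFDerivAt
  have hΦd : ∀ z v, fderiv ℝ Φ z v = (π v, fderiv ℝ w z v) := by
    intro z v
    have h : HasFDerivAt Φ _ z := π.hasFDerivAt.prodMk (hwd z)
    rw [h.fderiv]
    rfl
  have hΦ0 : Φ 0 = 0 := Prod.ext (map_zero π) hw0
  obtain ⟨Θ, hΘ, hΘ0, hΘΦ, hΦΘ⟩ := hΦ.exists_local_inverse (x₀ := 0) (by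
    rw [injective_iff_map_eq_zero]
    intro v hv
    rw [hΦd] at hv
    obtain ⟨h1, h2⟩ := Prod.mk_eq_zero.1 hv
    obtain ⟨a, rfl⟩ := hwk v h2
    have h3 := DFunLike.congr_fun hπ0 a
    rw [ContinuousLinearMap.comp_apply, h1] at h3
    rw [show a = 0 from h3.symm, map_zero]) (by rw [finrank_prod, hdim'])
  rw [hΦ0] at hΘ0 hΦΘ
  have hΘc : Tendsto Θ (𝓝 0) (𝓝 0) := hΘ.continuous.tendsto' _ _ hΘ0
  have hΦc : Tendsto Φ (𝓝 0) (𝓝 0) := hΦ.continuous.tendsto' _ _ hΦ0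
  have hfib : ∀ᶠ x in 𝓝 (0 : R × Q), ∀ a, ∃ c, fderiv ℝ Θ x (a, 0) = X (Θ x) c := by
    filter_upwards [hΘc.eventually hwX, hΘc.eventually hCi, hΦΘ,
      hΘc.eventually hΘΦ.eventually_nhds] with x h1 h2 h3 h4 a
    refine ⟨C (Θ x) a, ?_⟩
    have h5 := hΦ.fderiv_comp_of_eventually_eq_id hΘ h4 (X (Θ x) (C (Θ x) a))
    have h6 : π (X (Θ x) (C (Θ x) a)) = a := h2.2 a
    rwa [h3, hΦd, h1, h6] at h5
  have hrel : ∀ α, ∃ f : R × Q → Q →L[ℝ] ℝ, ContDiff ℝ ∞ f ∧ ∀ᶠ z in 𝓝 (0 : R × Q), ∀ u v,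
      fderiv ℝ f z u v.2 - fderiv ℝ f z v u.2 = pullbackForm Θ (B α) z u v := by
    intro α
    refine exists_relative_primitive (hΘ.pullbackForm (hB α)) ?_ ?_ ?_
    · filter_upwards [hΘc.eventually (hs α)] with x h u v
      exact h _ _
    · filter_upwards [hΘc.eventually (hs α), hΘc.eventually (hc α)] with x h1 h2
      exact IsClosedAt.pullbackForm hΘ (hB α) h1 h2
    · filter_upwards [hΘc.eventually (hiso α), hfib] with x h1 h2 a b
      obtain ⟨c, hc⟩ := h2 a
      obtain ⟨d, hd⟩ := h2 b
      rw [pullbackForm_apply, hc, hd, h1]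
  choose f hf hfB using hrel
  refine ⟨fun i z => w z i, fun α i z => -f α (Φ z) (Pi.single i 1), ?_, ?_, ?_, ?_⟩
  · exact fun i => contDiff_pi.1 hw i
  · exact fun α i => (((hf α).comp hΦ).clm_apply contDiff_const).neg
  · intro i
    filter_upwards [hwX] with z hz a
    rw [fderiv_pi_apply (hwd z).differentiableAt, hz]
    rfl
  · intro α
    filter_upwards [hΘΦ.eventually_nhds, hΦc.eventually (hfB α)] with z h1 h2 u v
    have hpd : ∀ i v, fderiv ℝ (fun z => -f α (Φ z) (Pi.single i 1)) z v =
        -fderiv ℝ (f α) (Φ z) (fderiv ℝ Φ z v) (Pi.single i 1) := by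
      intro i v
      have e1 : HasFDerivAt (fun z => f α (Φ z)) _ z :=
        ((hf α).differentiable (by simp) _).hasFDerivAt.comp z
          (hΦ.differentiable (by simp) z).hasFDerivAt
      have e2 : HasFDerivAt (fun z => -f α (Φ z) (Pi.single i 1)) _ z :=
        (e1.clm_apply (hasFDerivAt_const (Pi.single i 1 : Q) z)).neg
      rw [e2.fderiv]
      simp
    have hsum : ∀ (l : Q →L[ℝ] ℝ) (q : Q), l q = ∑ i, q i * l (Pi.single i 1) := by
      intro l q
      conv_lhs => rw [pi_eq_sum_univ' q, map_sum]
      refine Finset.sum_congr rfl fun i _ => ?_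
      rw [map_smul, smul_eq_mul]
    have h3 := h2 (fderiv ℝ Φ z u) (fderiv ℝ Φ z v)
    rw [pullbackForm_apply, hΦ.fderiv_comp_of_eventually_eq_id hΘ h1,
      hΦ.fderiv_comp_of_eventually_eq_id hΘ h1, h1.self_of_nhds] at h3
    rw [← h3, hsum, hsum, ← Finset.sum_sub_distrib]
    refine Finset.sum_congr rfl fun i _ => ?_
    rw [hpd, hpd, fderiv_pi_apply (hwd z).differentiableAt,
      fderiv_pi_apply (hwd z).differentiableAt, hΦd z u, hΦd z v]
    ring

end KSymplectic

/-! ### Brackets, basic forms and invariant distributions -/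

section Brackets

theorem eventually_forall_smul_fst {P Q : Type*} [NormedAddCommGroup P] [NormedSpace ℝ P]
    [NormedAddCommGroup Q] {p : P × Q → Prop} (h : ∀ᶠ y in 𝓝 (0 : P × Q), p y) :
    ∀ᶠ y in 𝓝 (0 : P × Q), ∀ t ∈ Icc (0 : ℝ) 1, p (t • y.1, y.2) := by
  obtain ⟨ε, hε, hball⟩ := Metric.eventually_nhds_iff_ball.1 h
  filter_upwards [Metric.ball_mem_nhds (0 : P × Q) hε] with z hz t ht
  refine hball _ ?_
  rw [mem_ball_zero_iff, Prod.norm_def, max_lt_iff] at hz ⊢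
  refine ⟨?_, hz.2⟩
  rw [norm_smul, Real.norm_of_nonneg ht.1]
  exact (mul_le_of_le_one_left (norm_nonneg _) ht.2).trans_lt hz.1

variable {E F : Type*} [NormedAddCommGroup E] [NormedSpace ℝ E] [NormedAddCommGroup F]
  [NormedSpace ℝ F]

/-- A closed one-form taking constant values on two vector fields vanishes on their bracket. -/
theorem oneForm_apply_bracket_eq_zero {a : E → E →L[ℝ] ℝ} {x : E} (ha : DifferentiableAt ℝ a x)
    (hsymm : ∀ u v, fderiv ℝ a x u v = fderiv ℝ a x v u) {V W : E → E}
    (hV : DifferentiableAt ℝ V x) (hW : DifferentiableAt ℝ W x) {r s : ℝ}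
    (hVr : ∀ᶠ y in 𝓝 x, a y (V y) = r) (hWs : ∀ᶠ y in 𝓝 x, a y (W y) = s) :
    a x (fderiv ℝ W x (V x) - fderiv ℝ V x (W x)) = 0 := by
  have key : ∀ {V : E → E} {r : ℝ}, DifferentiableAt ℝ V x → (∀ᶠ y in 𝓝 x, a y (V y) = r) →
      ∀ t, a x (fderiv ℝ V x t) + fderiv ℝ a x t (V x) = 0 := by
    intro V r hV h t
    have e := (ha.hasFDerivAt.clm_apply hV.hasFDerivAt).unique
      ((hasFDerivAt_const r x).congr_of_eventuallyEq h)
    simpa using DFunLike.congr_fun e t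
  have h1 := key hV hVr (W x)
  have h2 := key hW hWs (V x)
  have h3 := hsymm (V x) (W x)
  rw [map_sub]
  linarith

/-- The bracket of two vector fields in the kernel of a closed two-form is in the kernel. -/
theorem twoForm_apply_bracket_eq_zero {B : E → E →L[ℝ] E →L[ℝ] ℝ} {x : E}
    (hB : ContDiff ℝ ∞ B) (hs : ∀ᶠ y in 𝓝 x, IsSkewAt B y) (hc : IsClosedAt B x) {V W : E → E}
    (hV : DifferentiableAt ℝ V x) (hW : DifferentiableAt ℝ W x)
    (hV0 : ∀ᶠ y in 𝓝 x, ∀ u, B y (V y) u = 0) (hW0 : ∀ᶠ y in 𝓝 x, ∀ u, B y (W y) u = 0) (u : E) :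
    B x (fderiv ℝ W x (V x) - fderiv ℝ V x (W x)) u = 0 := by
  have hd : HasFDerivAt B (fderiv ℝ B x) x := (hB.differentiable (by simp) x).hasFDerivAt
  have key : ∀ {V : E → E}, DifferentiableAt ℝ V x → (∀ᶠ y in 𝓝 x, ∀ u, B y (V y) u = 0) →
      ∀ t u, B x (fderiv ℝ V x t) u + fderiv ℝ B x t (V x) u = 0 := by
    intro V hV h t u
    have e := ((hd.clm_apply hV.hasFDerivAt).clm_apply (hasFDerivAt_const u x)).unique
      ((hasFDerivAt_const (0 : ℝ) x).congr_of_eventuallyEq (h.mono fun y hy => hy u))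
    simpa using DFunLike.congr_fun e t
  have h1 := key hV hV0 (W x) u
  have h2 := key hW hW0 (V x) u
  have h3 := hc (V x) (W x) u
  have h4 := key hV hV0 u (W x)
  have h5 := hs.self_of_nhds (fderiv ℝ V x u) (W x)
  rw [hW0.self_of_nhds, neg_zero] at h5
  have h6 := IsSkewAt.fderiv_apply hB hs (W x) u (V x)
  rw [map_sub, sub_apply]
  linarith

/-- Brackets of related vector fields are related. -/
theorem fderiv_apply_bracket_of_related {f : F → E} (hf : ContDiff ℝ ∞ f) {V' W' : F → F}
    {V W : E → E} {y : F} (hV' : DifferentiableAt ℝ V' y) (hW' : DifferentiableAt ℝ W' y)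
    (hV : DifferentiableAt ℝ V (f y)) (hW : DifferentiableAt ℝ W (f y))
    (hVV : ∀ᶠ q in 𝓝 y, fderiv ℝ f q (V' q) = V (f q))
    (hWW : ∀ᶠ q in 𝓝 y, fderiv ℝ f q (W' q) = W (f q)) :
    fderiv ℝ f y (fderiv ℝ W' y (V' y) - fderiv ℝ V' y (W' y)) =
      fderiv ℝ W (f y) (V (f y)) - fderiv ℝ V (f y) (W (f y)) := by
  have hf' : ContDiff ℝ ∞ (fderiv ℝ f) := hf.fderiv_right (by simp)
  have hdf : HasFDerivAt (fderiv ℝ f) (fderiv ℝ (fderiv ℝ f) y) y :=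
    (hf'.differentiable (by simp) y).hasFDerivAt
  have key : ∀ {V' : F → F} {V : E → E}, DifferentiableAt ℝ V' y → DifferentiableAt ℝ V (f y) →
      (∀ᶠ q in 𝓝 y, fderiv ℝ f q (V' q) = V (f q)) → ∀ t,
      fderiv ℝ f y (fderiv ℝ V' y t) + fderiv ℝ (fderiv ℝ f) y t (V' y) =
        fderiv ℝ V (f y) (fderiv ℝ f y t) := by
    intro V' V hV' hV h t
    have e := (hdf.clm_apply hV'.hasFDerivAt).unique ((hV.hasFDerivAt.comp y
      (hf.differentiable (by simp) y).hasFDerivAt).congr_of_eventuallyEq h)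
    simpa using DFunLike.congr_fun e t
  have h1 := key hV' hV hVV (W' y)
  have h2 := key hW' hW hWW (V' y)
  rw [hVV.self_of_nhds] at h2
  rw [hWW.self_of_nhds, hf.fderiv_fderiv_symm] at h1
  rw [map_sub, ← h1, ← h2]
  abel

/-- A closed two-form on a product `P × Q` whose kernel contains the directions of `P` is the
pullback of a two-form on `Q`. -/
theorem eventually_twoForm_eq_of_basic {P Q : Type*} [NormedAddCommGroup P] [NormedSpace ℝ P]
    [NormedAddCommGroup Q] [NormedSpace ℝ Q] {B : P × Q → P × Q →L[ℝ] P × Q →L[ℝ] ℝ}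
    (hB : ContDiff ℝ ∞ B) (hs : ∀ᶠ y in 𝓝 (0 : P × Q), IsSkewAt B y)
    (hc : ∀ᶠ y in 𝓝 (0 : P × Q), IsClosedAt B y)
    (h0 : ∀ᶠ y in 𝓝 (0 : P × Q), ∀ e u, B y (e, 0) u = 0) :
    ∀ᶠ y in 𝓝 (0 : P × Q), ∀ u v, B y u v = B (0, y.2) (0, u.2) (0, v.2) := by
  have hBd : ∀ y, HasFDerivAt B (fderiv ℝ B y) y := fun y =>
    (hB.differentiable (by simp) y).hasFDerivAt
  have hder : ∀ᶠ y in 𝓝 (0 : P × Q), ∀ e u v, fderiv ℝ B y (e, 0) u v = 0 := by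
    filter_upwards [hs.eventually_nhds, hc, h0.eventually_nhds] with y h1 h2 h3 e u v
    have key : ∀ t u, fderiv ℝ B y t (e, 0) u = 0 := by
      intro t u
      have h := (((hBd y).clm_apply (hasFDerivAt_const _ y)).clm_apply
        (hasFDerivAt_const u y)).unique
        ((hasFDerivAt_const (0 : ℝ) y).congr_of_eventuallyEq (h3.mono fun q hq => hq e u))
      simpa using DFunLike.congr_fun h t
    have h4 := h2 (e, 0) u v
    have h5 := IsSkewAt.fderiv_apply hB h1 u v (e, 0)
    rw [key] at h5 h4
    linarith
  filter_upwards [eventually_forall_smul_fst hder, hs, h0] with y h1 h2 h3 u v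
  have hconst : ∀ u v, ∀ t ∈ Icc (0 : ℝ) 1,
      B (t • y.1, y.2) u v = B ((0 : ℝ) • y.1, y.2) u v := by
    intro u v
    have hd : ∀ t : ℝ, HasDerivAt (fun t : ℝ => B (t • y.1, y.2) u v)
        (fderiv ℝ B (t • y.1, y.2) (y.1, 0) u v) t := by
      intro t
      have e1 : HasDerivAt (fun t : ℝ => t • y.1) y.1 t := by
        simpa using (hasDerivAt_id t).smul_const y.1
      have e2 : HasDerivAt (fun t : ℝ => (t • y.1, y.2)) (y.1, 0) t :=
        e1.prodMk (hasDerivAt_const t y.2)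
      have e3 : HasDerivAt (fun t : ℝ => B (t • y.1, y.2)) _ t :=
        HasFDerivAt.comp_hasDerivAt (l := B) (f := fun t : ℝ => (t • y.1, y.2)) t (hBd _) e2
      simpa using (e3.clm_apply (hasDerivAt_const t u)).clm_apply (hasDerivAt_const t v)
    refine constant_of_has_deriv_right_zero
      (fun t _ => (hd t).continuousAt.continuousWithinAt) fun t ht => ?_
    have := (hd t).hasDerivWithinAt (s := Ici t)
    rwa [h1 t (Ico_subset_Icc_self ht)] at this
  have e : ∀ u : P × Q, u = (u.1, 0) + (0, u.2) := fun u => by simp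
  have h5 : ∀ u v, B y u v = B y (0, u.2) (0, v.2) := by
    intro u v
    conv_lhs => rw [e u, e v]
    rw [map_add, map_add (B y), add_apply, add_apply, h3, h3, h2 (0, u.2) (v.1, 0), h3]
    simp
  have h6 : ∀ u v, B (0, y.2) u v = B y u v := by
    intro u v
    have h4 := hconst u v 1 (right_mem_Icc.2 zero_le_one)
    rw [one_smul, zero_smul] at h4
    exact h4.symm
  rw [h5, h6]

/-- Propagation of the vanishing of covectors on a distribution along directions preserving the
distribution. -/
theorem eventually_apply_snd_eq_zero_of_invariant {P Q R : Type*} [NormedAddCommGroup P]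
    [NormedSpace ℝ P] [FiniteDimensional ℝ P] [NormedAddCommGroup Q] [NormedSpace ℝ Q]
    [FiniteDimensional ℝ Q] [NormedAddCommGroup R] [NormedSpace ℝ R] [FiniteDimensional ℝ R]
    {X : P × Q → R →L[ℝ] P × Q} (hX : ContDiff ℝ ∞ X) (hX0 : Function.Injective (X 0))
    (hinv : ∀ᶠ y in 𝓝 (0 : P × Q), ∀ e c, fderiv ℝ X y (e, 0) c ∈ range (X y))
    {l : Q → Q →L[ℝ] ℝ} (hl : ∀ᶠ q in 𝓝 (0 : Q), ∀ c, l q (X (0, q) c).2 = 0) :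
    ∀ᶠ y in 𝓝 (0 : P × Q), ∀ c, l y.2 (X y c).2 = 0 := by
  obtain ⟨π₀, hπ₀⟩ := LinearMap.exists_leftInverse_of_injective (X 0 : R →ₗ[ℝ] P × Q)
    (LinearMap.ker_eq_bot.2 hX0)
  let π : P × Q →L[ℝ] R := LinearMap.toContinuousLinearMap π₀
  obtain ⟨C, hC, hCi⟩ := ((contDiff_const (c := π)).clm_comp hX).exists_inverse_family (x₀ := 0)
    (by ext a; exact DFunLike.congr_fun hπ₀ a)
  have hX' : Continuous (fderiv ℝ X) := hX.continuous_fderiv (by simp)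
  have hCc := hC.continuous
  have hlim : Tendsto (fun y : P × Q => y.2) (𝓝 0) (𝓝 0) := continuous_snd.tendsto' _ _ rfl
  filter_upwards [eventually_forall_smul_fst hinv, eventually_forall_smul_fst hCi,
    hlim.eventually hl] with y h1 h2 h3 c
  let γ : ℝ → P × Q := fun t => (t • y.1, y.2)
  have hγ : Continuous γ := by fun_prop
  -- `M t` expresses the derivative of the frame along `P` in terms of the frame
  let M : ℝ → R →L[ℝ] R := fun t => C (γ t) ∘L π ∘L fderiv ℝ X (γ t) (y.1, 0)
  have hM : Continuous M := by
    have e1 : Continuous fun t => C (γ t) := hCc.comp hγ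
    have e2 : Continuous fun t => fderiv ℝ X (γ t) := hX'.comp hγ
    fun_prop
  have hXM : ∀ t ∈ Icc (0 : ℝ) 1, ∀ c, fderiv ℝ X (γ t) (y.1, 0) c = X (γ t) (M t c) := by
    intro t ht c
    obtain ⟨d, hd⟩ := h1 t ht y.1 c
    have h4 := (h2 t ht).1 d
    have h5 : M t c = d := by
      rw [← h4]
      change C (γ t) (π (fderiv ℝ X (γ t) (y.1, 0) c)) = _
      rw [← hd]
      rfl
    rw [h5, ← hd]
  let ev : (P × Q) →L[ℝ] ℝ := l y.2 ∘L ContinuousLinearMap.snd ℝ P Q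
  let g : ℝ → R →L[ℝ] ℝ := fun t => ev ∘L X (γ t)
  have hg : ∀ t ∈ Icc (0 : ℝ) 1, HasDerivAt g (g t ∘L M t) t := by
    intro t ht
    have e1 : HasDerivAt (fun t : ℝ => t • y.1) y.1 t := by
      simpa using (hasDerivAt_id t).smul_const y.1
    have e2 : HasDerivAt γ (y.1, 0) t := e1.prodMk (hasDerivAt_const t y.2)
    have e3 : HasDerivAt (fun t => X (γ t)) (fderiv ℝ X (γ t) (y.1, 0)) t :=
      HasFDerivAt.comp_hasDerivAt (l := X) (f := γ) t
        (hX.differentiable (by simp) _).hasFDerivAt e2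
    have e4 := (hasDerivAt_const t ev).clm_comp e3
    refine e4.congr_deriv ?_
    ext c
    have := hXM t ht c
    simp [g, this]
  obtain ⟨K, hK⟩ := (isCompact_Icc (a := (0 : ℝ)) (b := 1)).exists_bound_of_continuousOn
    (f := M) hM.continuousOn
  have hzero := eq_zero_of_abs_deriv_le_mul_abs_self_of_eq_zero_right (f := g) (K := K)
    (fun t ht => (hg t ht).continuousAt.continuousWithinAt)
    (fun t ht => (hg t (Ico_subset_Icc_self ht)).hasDerivWithinAt)
    (by
      ext c
      simpa [g, γ, ev] using h3 c)
    (fun t ht => by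
      have hb := hK t (Ico_subset_Icc_self ht)
      calc ‖g t ∘L M t‖ ≤ ‖g t‖ * ‖M t‖ := ContinuousLinearMap.opNorm_comp_le _ _
        _ ≤ ‖g t‖ * K := by gcongr
        _ = K * ‖g t‖ := mul_comm _ _)
  have h4 := DFunLike.congr_fun (hzero 1 (right_mem_Icc.2 zero_le_one)) c
  simpa [g, γ, ev] using h4

end Brackets

/-! ### Darboux coordinates on vector spaces -/

section LocalDarboux

/-- A closed one-form has a smooth primitive near each point. -/
theorem exists_primitive_of_fderiv_symm {E : Type*} [NormedAddCommGroup E] [NormedSpace ℝ E]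
    [FiniteDimensional ℝ E] {a : E → E →L[ℝ] ℝ} (ha : ContDiff ℝ ∞ a) {x₀ : E}
    (hsymm : ∀ᶠ x in 𝓝 x₀, ∀ u v, fderiv ℝ a x u v = fderiv ℝ a x v u) :
    ∃ f : E → ℝ, ContDiff ℝ ∞ f ∧ f x₀ = 0 ∧ ∀ᶠ x in 𝓝 x₀, fderiv ℝ f x = a x := by
  obtain ⟨ε, hε, hball⟩ := Metric.eventually_nhds_iff_ball.1 hsymm
  obtain ⟨f, hf⟩ := (convex_ball x₀ ε).exists_forall_hasFDerivAt_of_fderiv_symmetric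
    Metric.isOpen_ball (ha.differentiable (by simp)).differentiableOn
    (fun x hx u v => hball x hx u v)
  have hsm : ContDiffOn ℝ ∞ f (Metric.ball x₀ ε) := by
    rw [contDiffOn_infty_iff_fderiv_of_isOpen Metric.isOpen_ball]
    exact ⟨fun x hx => (hf x hx).differentiableAt.differentiableWithinAt,
      ha.contDiffOn.congr fun x hx => (hf x hx).fderiv⟩
  have hnear : ∀ᶠ x in 𝓝 x₀, x ∈ Metric.ball x₀ ε := Metric.ball_mem_nhds _ hε
  obtain ⟨g, hg, hge⟩ := exists_contDiff_eventuallyEq (f := fun x => f x - f x₀) (x₀ := x₀) (by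
    filter_upwards [hnear] with x hx
    exact (hsm.contDiffAt (Metric.isOpen_ball.mem_nhds hx)).sub contDiffAt_const)
  refine ⟨g, hg, by simpa using hge.self_of_nhds, ?_⟩
  filter_upwards [hge.eventually_nhds, hnear] with x hx hx'
  rw [Filter.EventuallyEq.fderiv_eq hx]
  exact ((hf x hx').sub_const _).fderiv

/-- The Reeb vector fields, when they exist pointwise and are unique at the base point, form a
smooth frame near the base point. -/
theorem exists_smooth_reeb_frame {E : Type*} [NormedAddCommGroup E] [NormedSpace ℝ E]
    [FiniteDimensional ℝ E] {k : ℕ} {a : Fin k → E → E →L[ℝ] ℝ} (ha : ∀ α, ContDiff ℝ ∞ (a α))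
    {B : Fin k → E → E →L[ℝ] E →L[ℝ] ℝ} (hB : ∀ α, ContDiff ℝ ∞ (B α)) {x₀ : E}
    (hnd : ∀ v, (∀ α, a α x₀ v = 0) → (∀ α u, B α x₀ v u = 0) → v = 0)
    (hreeb : ∀ᶠ x in 𝓝 x₀, ∀ c : Fin k → ℝ, ∃ v, (∀ α, a α x v = c α) ∧ ∀ α u, B α x v u = 0) :
    ∃ Y : E → (Fin k → ℝ) →L[ℝ] E, ContDiff ℝ ∞ Y ∧ ∀ᶠ x in 𝓝 x₀, ∀ c,
      (∀ α, a α x (Y x c) = c α) ∧ (∀ α u, B α x (Y x c) u = 0) := by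
  let T : E → E →L[ℝ] (Fin k → ℝ) × (Fin k → E →L[ℝ] ℝ) := fun x =>
    (ContinuousLinearMap.pi fun α => a α x).prod (ContinuousLinearMap.pi fun α => B α x)
  have hT : ContDiff ℝ ∞ T := by
    rw [contDiff_clm_apply_iff]
    intro v
    exact (contDiff_pi.2 fun α => (ha α).clm_apply contDiff_const).prodMk
      (contDiff_pi.2 fun α => (hB α).clm_apply contDiff_const)
  have hinj : LinearMap.ker (T x₀ : E →ₗ[ℝ] (Fin k → ℝ) × (Fin k → E →L[ℝ] ℝ)) = ⊥ := by
    rw [LinearMap.ker_eq_bot']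
    intro v hv
    obtain ⟨h1, h2⟩ := Prod.mk_eq_zero.1 hv
    exact hnd v (fun α => congrFun h1 α) fun α u => DFunLike.congr_fun (congrFun h2 α) u
  obtain ⟨L₀, hL₀⟩ := LinearMap.exists_leftInverse_of_injective _ hinj
  let L : (Fin k → ℝ) × (Fin k → E →L[ℝ] ℝ) →L[ℝ] E := LinearMap.toContinuousLinearMap L₀
  obtain ⟨C, hC, hCi⟩ := ((contDiff_const (c := L)).clm_comp hT).exists_inverse_family (x₀ := x₀)
    (by ext v; exact DFunLike.congr_fun hL₀ v)
  refine ⟨fun x => C x ∘L L ∘L ContinuousLinearMap.inl ℝ _ _, hC.clm_comp contDiff_const, ?_⟩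
  filter_upwards [hreeb, hCi] with x h1 h2 c
  obtain ⟨v, hv1, hv2⟩ := h1 c
  have hTv : T x v = (c, 0) := Prod.ext (funext hv1) (funext fun α => by ext u; exact hv2 α u)
  have h3 := h2.1 v
  rw [ContinuousLinearMap.comp_apply, hTv] at h3
  have h4 : (C x ∘L L ∘L ContinuousLinearMap.inl ℝ (Fin k → ℝ) (Fin k → E →L[ℝ] ℝ)) c = v := h3
  rw [h4]
  exact ⟨hv1, hv2⟩

/-- The local form of the Darboux theorem on a vector space, for closed one-forms `a α`, closed
two-forms `B α` and a common isotropic distribution spanned by the frame `X`. -/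
theorem exists_darboux_functions {E R : Type*} [NormedAddCommGroup E] [NormedSpace ℝ E]
    [FiniteDimensional ℝ E] [NormedAddCommGroup R] [NormedSpace ℝ R] [FiniteDimensional ℝ R]
    {n k : ℕ} (hE : finrank ℝ E = n * (k + 1) + k) (hR : finrank ℝ R = n * k) {x₀ : E}
    {a : Fin k → E → E →L[ℝ] ℝ} (ha : ∀ α, ContDiff ℝ ∞ (a α))
    (hac : ∀ α, ∀ᶠ x in 𝓝 x₀, ∀ u v, fderiv ℝ (a α) x u v = fderiv ℝ (a α) x v u)
    {B : Fin k → E → E →L[ℝ] E →L[ℝ] ℝ} (hB : ∀ α, ContDiff ℝ ∞ (B α))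
    (hs : ∀ α, ∀ᶠ x in 𝓝 x₀, IsSkewAt (B α) x) (hc : ∀ α, ∀ᶠ x in 𝓝 x₀, IsClosedAt (B α) x)
    {X : E → R →L[ℝ] E} (hX : ContDiff ℝ ∞ X) (hX0 : Function.Injective (X x₀))
    (haX : ∀ α, ∀ᶠ x in 𝓝 x₀, ∀ c, a α x (X x c) = 0)
    (hiso : ∀ α, ∀ᶠ x in 𝓝 x₀, ∀ c d, B α x (X x c) (X x d) = 0)
    (hinv : ∀ᶠ x in 𝓝 x₀, ∀ c d,
      fderiv ℝ X x (X x c) d - fderiv ℝ X x (X x d) c ∈ range (X x))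
    (hnd : ∀ᶠ x in 𝓝 x₀, ∀ v, (∀ α, a α x v = 0) → (∀ α u, B α x v u = 0) → v = 0)
    (hreeb : ∀ᶠ x in 𝓝 x₀, ∀ c : Fin k → ℝ, ∃ v, (∀ α, a α x v = c α) ∧ ∀ α u, B α x v u = 0) :
    ∃ (ξ : Fin k → E → ℝ) (y : Fin n → E → ℝ) (p : Fin k → Fin n → E → ℝ),
      (∀ α, ContDiff ℝ ∞ (ξ α)) ∧ (∀ i, ContDiff ℝ ∞ (y i)) ∧ (∀ α i, ContDiff ℝ ∞ (p α i)) ∧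
      (∀ α, ∀ᶠ x in 𝓝 x₀, fderiv ℝ (ξ α) x = a α x) ∧
      (∀ α, ∀ᶠ x in 𝓝 x₀, ∀ u v, B α x u v =
        ∑ i, (fderiv ℝ (y i) x u * fderiv ℝ (p α i) x v -
          fderiv ℝ (y i) x v * fderiv ℝ (p α i) x u)) ∧
      ((∀ Y : E → E, ContDiff ℝ ∞ Y → (∀ᶠ x in 𝓝 x₀, ∀ α u, B α x (Y x) u = 0) →
        ∀ᶠ x in 𝓝 x₀, ∀ c, ∃ r d, (∀ α u, B α x r u = 0) ∧
          fderiv ℝ X x (Y x) c - fderiv ℝ Y x (X x c) = r + X x d) →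
        ∀ i, ∀ᶠ x in 𝓝 x₀, ∀ c, fderiv ℝ (y i) x (X x c) = 0) := by
  let P := Fin k → ℝ
  let Z := Fin (n * (k + 1)) → ℝ
  have hXd : ∀ x, DifferentiableAt ℝ X x := hX.differentiable (by simp)
  obtain ⟨Y, hY, hYr⟩ := exists_smooth_reeb_frame ha hB hnd.self_of_nhds hreeb
  have hYd : ∀ x, DifferentiableAt ℝ Y x := hY.differentiable (by simp)
  have hXc : ∀ c x t, fderiv ℝ (fun x => X x c) x t = fderiv ℝ X x t c := by
    intro c x t
    rw [((hXd x).hasFDerivAt.clm_apply (hasFDerivAt_const c x)).fderiv]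
    simp
  have hYc : ∀ c x t, fderiv ℝ (fun x => Y x c) x t = fderiv ℝ Y x t c := by
    intro c x t
    rw [((hYd x).hasFDerivAt.clm_apply (hasFDerivAt_const c x)).fderiv]
    simp
  have hXcd : ∀ c x, DifferentiableAt ℝ (fun x => X x c) x := fun c x =>
    (hXd x).clm_apply (differentiableAt_const c)
  have hYcd : ∀ c x, DifferentiableAt ℝ (fun x => Y x c) x := fun c x =>
    (hYd x).clm_apply (differentiableAt_const c)
  -- primitives of the one-forms, and first integrals of the Reeb fields
  choose ξ hξ hξ0 hξa using fun α => exists_primitive_of_fderiv_symm (ha α) (hac α)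
  obtain ⟨z, hz, hz0, hzk, hzY⟩ := exists_first_integral (Q := Z)
    (by rw [finrank_fin_fun, finrank_fin_fun, hE, add_comm]) hY
    (by
      rw [injective_iff_map_eq_zero]
      intro c h
      funext α
      have := (hYr.self_of_nhds c).1 α
      rw [← this, h, map_zero]
      rfl)
    (by
      filter_upwards [hYr.eventually_nhds, hnd, eventually_all.2 hac, eventually_all.2 hc,
        (eventually_all.2 hs).eventually_nhds] with x h1 h2 h3 h4 h5 c d
      refine ⟨0, ?_⟩
      rw [map_zero]
      refine (h2 _ (fun α => ?_) fun α u => ?_).symm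
      · have := oneForm_apply_bracket_eq_zero ((ha α).differentiable (by simp) x) (h3 α) (hYcd c x)
          (hYcd d x) (h1.mono fun y hy => (hy c).1 α) (h1.mono fun y hy => (hy d).1 α)
        rwa [hYc, hYc] at this
      · have := twoForm_apply_bracket_eq_zero (hB α) (h5.mono fun y hy => hy α) (h4 α) (hYcd c x)
          (hYcd d x) (h1.mono fun y hy => (hy c).2 α) (h1.mono fun y hy => (hy d).2 α) u
        rwa [hYc, hYc] at this)
  have hzd : ∀ x, HasFDerivAt z (fderiv ℝ z x) x := fun x =>
    (hz.differentiable (by simp) x).hasFDerivAt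
  -- coordinates straightening the Reeb fields
  let Φ : E → P × Z := fun x => (fun α => ξ α x, z x)
  have hΦ : ContDiff ℝ ∞ Φ := (contDiff_pi.2 hξ).prodMk hz
  have hΦd : ∀ x v, fderiv ℝ Φ x v = (fun α => fderiv ℝ (ξ α) x v, fderiv ℝ z x v) := by
    intro x v
    have h : HasFDerivAt Φ _ x := (hasFDerivAt_pi.2 fun α =>
      ((hξ α).differentiable (by simp) x).hasFDerivAt).prodMk (hzd x)
    rw [h.fderiv]
    rfl
  have hΦ0 : Φ x₀ = 0 := Prod.ext (funext hξ0) hz0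
  obtain ⟨Ψ, hΨ, hΨ0, hΨΦ, hΦΨ⟩ := hΦ.exists_local_inverse (x₀ := x₀) (by
    rw [injective_iff_map_eq_zero]
    intro v hv
    rw [hΦd] at hv
    obtain ⟨h1, h2⟩ := Prod.mk_eq_zero.1 hv
    obtain ⟨c, rfl⟩ := hzk v h2
    have h3 : c = 0 := by
      funext α
      rw [← (hYr.self_of_nhds c).1 α, ← (hξa α).self_of_nhds]
      exact congrFun h1 α
    rw [h3, map_zero]) (by rw [finrank_prod, finrank_fin_fun, finrank_fin_fun, hE, add_comm])
  rw [hΦ0] at hΨ0 hΦΨ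
  have hΨc : Tendsto Ψ (𝓝 0) (𝓝 x₀) := hΨ.continuous.tendsto' _ _ hΨ0
  have hΦc : Tendsto Φ (𝓝 x₀) (𝓝 0) := hΦ.continuous.tendsto' _ _ hΦ0
  have hΦY : ∀ᶠ x in 𝓝 x₀, ∀ c, fderiv ℝ Φ x (Y x c) = (c, 0) := by
    filter_upwards [hYr, eventually_all.2 hξa, hzY] with x h1 h2 h3 c
    rw [hΦd, h3]
    refine Prod.ext (funext fun α => ?_) rfl
    change fderiv ℝ (ξ α) x (Y x c) = c α
    rw [h2, (h1 c).1]
  have hΦX : ∀ᶠ x in 𝓝 x₀, ∀ c, fderiv ℝ Φ x (X x c) = (0, fderiv ℝ z x (X x c)) := by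
    filter_upwards [eventually_all.2 haX, eventually_all.2 hξa] with x h1 h2 c
    rw [hΦd]
    refine Prod.ext (funext fun α => ?_) rfl
    change fderiv ℝ (ξ α) x (X x c) = 0
    rw [h2, h1]
  have hΨΦd : ∀ᶠ y in 𝓝 (0 : P × Z), ∀ v, fderiv ℝ Ψ y (fderiv ℝ Φ (Ψ y) v) = v := by
    filter_upwards [hΨc.eventually hΨΦ.eventually_nhds, hΦΨ] with y h1 h2 v
    have := hΦ.fderiv_comp_of_eventually_eq_id hΨ h1 v
    rwa [h2] at this
  have hΦΨd : ∀ᶠ y in 𝓝 (0 : P × Z), ∀ v, fderiv ℝ Φ (Ψ y) (fderiv ℝ Ψ y v) = v := by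
    filter_upwards [hΦΨ.eventually_nhds] with y h1 v
    exact hΨ.fderiv_comp_of_eventually_eq_id hΦ h1 v
  have hΨY : ∀ᶠ y in 𝓝 (0 : P × Z), ∀ e, fderiv ℝ Ψ y (e, 0) = Y (Ψ y) e := by
    filter_upwards [hΨΦd, hΨc.eventually hΦY] with y h1 h2 e
    rw [← h2 e, h1]
  -- the two-forms in these coordinates
  have hbasic : ∀ α, ∀ᶠ y in 𝓝 (0 : P × Z), ∀ u v, pullbackForm Ψ (B α) y u v =
      pullbackForm Ψ (B α) (0, y.2) (0, u.2) (0, v.2) := by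
    intro α
    refine eventually_twoForm_eq_of_basic (hΨ.pullbackForm (hB α)) ?_ ?_ ?_
    · filter_upwards [hΨc.eventually (hs α)] with y h u v
      exact h _ _
    · filter_upwards [hΨc.eventually (hs α), hΨc.eventually (hc α)] with y h1 h2
      exact IsClosedAt.pullbackForm hΨ (hB α) h1 h2
    · filter_upwards [hΨY, hΨc.eventually hYr] with y h1 h2 e u
      rw [pullbackForm_apply, h1, (h2 e).2]
  -- the leaf `ξ = 0`
  let ι : Z → P × Z := fun q => (0, q)
  have hι : ContDiff ℝ ∞ ι := contDiff_const.prodMk contDiff_id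
  have hιc : Tendsto ι (𝓝 0) (𝓝 0) := hι.continuous.tendsto' _ _ rfl
  let j : Z → E := fun q => Ψ (ι q)
  have hj : ContDiff ℝ ∞ j := hΨ.comp hι
  have hjc : Tendsto j (𝓝 0) (𝓝 x₀) := hΨc.comp hιc
  have hj0 : j 0 = x₀ := hΨ0
  have hjd : ∀ q v, fderiv ℝ j q v = fderiv ℝ Ψ (0, q) (0, v) := by
    intro q v
    have h : HasFDerivAt j _ q := HasFDerivAt.comp q
      (hΨ.differentiable (by simp) (ι q)).hasFDerivAt (hasFDerivAt_prodMk_right (0 : P) q)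
    rw [h.fderiv]
    rfl
  let X₁ : Z → R →L[ℝ] Z := fun q => fderiv ℝ z (j q) ∘L X (j q)
  have hz' : ContDiff ℝ ∞ (fderiv ℝ z) := hz.fderiv_right (by simp)
  have hX₁ : ContDiff ℝ ∞ X₁ := (hz'.comp hj).clm_comp (hX.comp hj)
  have hX₁c : ∀ c q t, fderiv ℝ (fun x => X₁ x c) q t = fderiv ℝ X₁ q t c := by
    intro c q t
    rw [((hX₁.differentiable (by simp) q).hasFDerivAt.clm_apply (hasFDerivAt_const c q)).fderiv]
    simp
  have hX₁cd : ∀ c q, DifferentiableAt ℝ (fun x => X₁ x c) q := fun c q =>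
    (hX₁.differentiable (by simp) q).clm_apply (differentiableAt_const c)
  have hjX : ∀ᶠ q in 𝓝 (0 : Z), ∀ c, fderiv ℝ j q (X₁ q c) = X (j q) c := by
    filter_upwards [hjc.eventually hΦX, hιc.eventually hΨΦd] with q h1 h2 c
    rw [hjd]
    have := h2 (X (j q) c)
    rwa [h1 c] at this
  have hjinj : ∀ᶠ q in 𝓝 (0 : Z), Function.Injective (fderiv ℝ j q) := by
    filter_upwards [hιc.eventually hΦΨd] with q h1 u v huv
    rw [hjd, hjd] at huv
    have h2 := (h1 (0, u)).symm.trans ((congrArg _ huv).trans (h1 (0, v)))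
    exact congrArg Prod.snd h2
  obtain ⟨y, p, hy, hp, hyX, hyp⟩ := exists_darboux_functions_of_isotropic_frame (Z := Z) (n := n)
    (by rw [hR, finrank_fin_fun]; ring)
    (fun α => hj.pullbackForm (hB α))
    (fun α => by
      filter_upwards [hjc.eventually (hs α)] with q h u v
      exact h _ _)
    (fun α => by
      filter_upwards [hjc.eventually (hs α), hjc.eventually (hc α)] with q h1 h2
      exact IsClosedAt.pullbackForm hj (hB α) h1 h2)
    hX₁
    (by
      have h := hjX.self_of_nhds
      rw [hj0] at h
      intro c d hcd
      exact hX0 (by rw [← h, ← h, hcd]))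
    (fun α => by
      filter_upwards [hjc.eventually (hiso α), hjX] with q h1 h2 c d
      rw [pullbackForm_apply, h2, h2, h1])
    (by
      filter_upwards [hjX.eventually_nhds, hjinj, hjc.eventually hinv] with q h1 h2 h3 c d
      have h4 := fderiv_apply_bracket_of_related hj (hX₁cd c q) (hX₁cd d q) (hXcd c (j q))
        (hXcd d (j q)) (h1.mono fun _ h => h c) (h1.mono fun _ h => h d)
      rw [hXc, hXc, hX₁c, hX₁c] at h4
      obtain ⟨b, hb⟩ := h3 c d
      rw [← hb, ← h1.self_of_nhds] at h4
      exact ⟨b, (h2 h4).symm⟩)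
  have hyz : ∀ (f : Z → ℝ), ContDiff ℝ ∞ f → ∀ x v,
      fderiv ℝ (fun x => f (z x)) x v = fderiv ℝ f (z x) (fderiv ℝ z x v) := by
    intro f hf x v
    have h : HasFDerivAt (fun x => f (z x)) _ x :=
      (hf.differentiable (by simp) (z x)).hasFDerivAt.comp x (hzd x)
    rw [h.fderiv]
    rfl
  have hzc : Tendsto z (𝓝 x₀) (𝓝 0) := hz.continuous.tendsto' _ _ hz0
  refine ⟨ξ, fun i x => y i (z x), fun α i x => p α i (z x), hξ, fun i => (hy i).comp hz,
    fun α i => (hp α i).comp hz, hξa, fun α => ?_, fun hbr i => ?_⟩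
  · filter_upwards [hΦc.eventually (hbasic α), hΨΦ.eventually_nhds, hzc.eventually (hyp α)]
      with x h1 h2 h3 u v
    have h4 := h1 (fderiv ℝ Φ x u) (fderiv ℝ Φ x v)
    rw [pullbackForm_apply, hΦ.fderiv_comp_of_eventually_eq_id hΨ h2,
      hΦ.fderiv_comp_of_eventually_eq_id hΨ h2, h2.self_of_nhds, hΦd x u, hΦd x v] at h4
    rw [h4]
    have h5 := h3 (fderiv ℝ z x u) (fderiv ℝ z x v)
    rw [pullbackForm_apply, hjd, hjd] at h5
    refine h5.trans ?_
    simp only [hyz _ (hy _), hyz _ (hp _ _)]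
  · -- the frame in the straightening coordinates
    let X₂ : P × Z → R →L[ℝ] P × Z := fun q => fderiv ℝ Φ (Ψ q) ∘L X (Ψ q)
    have hΦ' : ContDiff ℝ ∞ (fderiv ℝ Φ) := hΦ.fderiv_right (by simp)
    have hX₂ : ContDiff ℝ ∞ X₂ := (hΦ'.comp hΨ).clm_comp (hX.comp hΨ)
    have hX₂c : ∀ c q t, fderiv ℝ (fun x => X₂ x c) q t = fderiv ℝ X₂ q t c := by
      intro c q t
      rw [((hX₂.differentiable (by simp) q).hasFDerivAt.clm_apply (hasFDerivAt_const c q)).fderiv]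
      simp
    have hΨX : ∀ᶠ q in 𝓝 (0 : P × Z), ∀ c, fderiv ℝ Ψ q (X₂ q c) = X (Ψ q) c := by
      filter_upwards [hΨΦd] with q h c
      exact h _
    have hΨinj : ∀ᶠ q in 𝓝 (0 : P × Z), Function.Injective (fderiv ℝ Ψ q) := by
      filter_upwards [hΦΨd] with q h
      exact Function.LeftInverse.injective h
    have hpres : ∀ e : P, ∀ᶠ x in 𝓝 x₀, ∀ c, ∃ d,
        fderiv ℝ X x (Y x e) c - fderiv ℝ Y x (X x c) e = X x d := by
      intro e
      have h0 := hbr (fun x => Y x e) (hY.clm_apply contDiff_const)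
        (hYr.mono fun x hx => (hx e).2)
      filter_upwards [h0, hnd, (eventually_all.2 haX).eventually_nhds, hYr.eventually_nhds,
        eventually_all.2 hac] with x h1 h2 h3 h4 h5 c
      obtain ⟨r, d, hr, hrd⟩ := h1 c
      rw [hYc] at hrd
      refine ⟨d, ?_⟩
      have hr0 : r = 0 := by
        refine h2 r (fun α => ?_) hr
        have h6 := oneForm_apply_bracket_eq_zero ((ha α).differentiable (by simp) x) (h5 α)
          (hYcd e x) (hXcd c x) (h4.mono fun y hy => (hy e).1 α) (h3.mono fun y hy => hy α c)
        rw [hXc, hYc, hrd, map_add, h3.self_of_nhds, add_zero] at h6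
        exact h6
      rw [hrd, hr0, zero_add]
    have hpres' : ∀ᶠ q in 𝓝 (0 : P × Z), ∀ e c, fderiv ℝ X₂ q (e, 0) c ∈ range (X₂ q) := by
      -- by linearity it suffices to consider the finitely many vectors of a basis
      have hb : ∀ α : Fin k, ∀ᶠ q in 𝓝 (0 : P × Z), ∀ c,
          fderiv ℝ X₂ q (Pi.single α 1, 0) c ∈ range (X₂ q) := by
        intro α
        filter_upwards [hΨc.eventually (hpres (Pi.single α 1)), hΨX.eventually_nhds,
          hΨY.eventually_nhds, hΨinj] with q h1 h2 h3 h4 c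
        have h5 := fderiv_apply_bracket_of_related hΨ
          (V' := fun _ => ((Pi.single α 1 : P), (0 : Z))) (W' := fun x => X₂ x c)
          (V := fun x => Y x (Pi.single α 1)) (W := fun x => X x c) (y := q)
          (differentiableAt_const _)
          ((hX₂.differentiable (by simp) q).clm_apply (differentiableAt_const c))
          (hYcd _ _) (hXcd _ _) (h3.mono fun _ h => h _) (h2.mono fun _ h => h c)
        rw [hXc, hYc, hX₂c] at h5
        obtain ⟨d, hd⟩ := h1 c
        rw [hd, ← h2.self_of_nhds] at h5
        have h6 := h4 h5
        simp at h6
        exact ⟨d, h6.symm⟩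
      filter_upwards [eventually_all.2 hb] with q h e c
      have he : ((e, 0) : P × Z) = ∑ α, e α • ((Pi.single α 1 : P), (0 : Z)) := by
        refine Prod.ext ?_ ?_
        · rw [Prod.fst_sum]
          exact pi_eq_sum_univ' e
        · rw [Prod.snd_sum]
          simp
      rw [he, map_sum, sum_apply]
      refine (LinearMap.range (X₂ q : R →ₗ[ℝ] P × Z)).sum_mem fun α _ => ?_
      rw [map_smul, smul_apply]
      exact (LinearMap.range (X₂ q : R →ₗ[ℝ] P × Z)).smul_mem _ (h α c)
    have hX₂0 : Function.Injective (X₂ 0) := by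
      have h := hΨX.self_of_nhds
      rw [hΨ0] at h
      intro c d hcd
      exact hX0 (by rw [← h, ← h, hcd])
    have hfinal := eventually_apply_snd_eq_zero_of_invariant hX₂ hX₂0 hpres'
      (l := fun q => fderiv ℝ (y i) q) (by
        filter_upwards [hyX i] with q hq c
        have := hq c
        change fderiv ℝ (y i) q (fderiv ℝ Φ (j q) (X (j q) c)).2 = 0
        rw [hΦd]
        exact this)
    filter_upwards [hΦc.eventually hfinal, hΨΦ] with x h1 h2 c
    rw [hyz _ (hy i)]
    have h3 := h1 c
    change fderiv ℝ (y i) (z x) (fderiv ℝ Φ (Ψ (Φ x)) (X (Ψ (Φ x)) c)).2 = 0 at h3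
    rw [h2, hΦd] at h3
    exact h3

end LocalDarboux

/-! ### Linear algebra of the normal form -/

section NormalForm

theorem wedgeForms_two_apply {T : Type*} [AddCommGroup T] [Module ℝ T] (a b : T →ₗ[ℝ] ℝ)
    (u v : T) : wedgeForms ![a, b] ![u, v] = a u * b v - a v * b u := by
  have h : wedgeForms ![a, b] ![u, v] = Matrix.det !![a u, b u; a v, b v] := by
    refine congrArg (Matrix.det (n := Fin 2) (R := ℝ)) ?_
    ext i j
    fin_cases i <;> fin_cases j <;> rfl
  rw [h, Matrix.det_fin_two_of]
  ring

/-- The normal form `∑ i, dy^i ∧ dp^α_i` of the two-forms, in terms of a basis of a vector space. -/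
def darbouxForm {T : Type*} [AddCommGroup T] [Module ℝ T] {n k : ℕ}
    (b : Basis (DarbouxIndex n k) ℝ T) (α : Fin k) (u v : T) : ℝ :=
  ∑ i, (b.coord (.inr (.inl i)) u * b.coord (.inr (.inr (α, i))) v -
    b.coord (.inr (.inl i)) v * b.coord (.inr (.inr (α, i))) u)

variable {T : Type*} [AddCommGroup T] [Module ℝ T] {n k : ℕ} (b : Basis (DarbouxIndex n k) ℝ T)

theorem darbouxForm_apply_p (α : Fin k) (i : Fin n) (u : T) :
    darbouxForm b α u (b (.inr (.inr (α, i)))) = b.coord (.inr (.inl i)) u := by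
  simp [darbouxForm, Finsupp.single_apply]

theorem darbouxForm_apply_y (α : Fin k) (i : Fin n) (u : T) :
    darbouxForm b α u (b (.inr (.inl i))) = -b.coord (.inr (.inr (α, i))) u := by
  simp [darbouxForm, Finsupp.single_apply]

/-- In the normal form, the Reeb vectors are the basis vectors `∂/∂x^α`. -/
theorem eq_basis_inl_of_reeb {α : Fin k} {v : T}
    (h1 : ∀ β, b.coord (.inl β) v = if β = α then 1 else 0)
    (h2 : ∀ β u, darbouxForm b β v u = 0) : v = b (.inl α) := by
  refine b.ext_elem fun j => ?_
  rw [Basis.repr_self]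
  rcases j with β | i | ⟨β, i⟩
  · have := h1 β
    simp only [Basis.coord_apply] at this
    rw [this, Finsupp.single_apply]
    simp [eq_comm]
  · have := h2 α (b (.inr (.inr (α, i))))
    rw [darbouxForm_apply_p] at this
    simpa using this
  · have := h2 β (b (.inr (.inl i)))
    rw [darbouxForm_apply_y] at this
    simpa using this

/-- A subspace of dimension `n k` on which all `dx^α` and `dy^i` vanish is spanned by the
`∂/∂p^α_i`. -/
theorem eq_span_of_coord_eq_zero {V : Submodule ℝ T} (hV : finrank ℝ V = n * k)
    (hx : ∀ α, ∀ v ∈ V, b.coord (.inl α) v = 0) (hy : ∀ i, ∀ v ∈ V, b.coord (.inr (.inl i)) v = 0) :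
    V = Submodule.span ℝ (range fun a : Fin k × Fin n => b (.inr (.inr a))) := by
  have : FiniteDimensional ℝ T := b.finiteDimensional_of_finite
  refine Submodule.eq_of_le_of_finrank_le (fun v hv => ?_) ?_
  · rw [← b.sum_repr v]
    refine Submodule.sum_mem _ fun j _ => ?_
    rcases j with β | i | a
    · have := hx β v hv
      rw [Basis.coord_apply] at this
      rw [this, zero_smul]
      exact Submodule.zero_mem _
    · have := hy i v hv
      rw [Basis.coord_apply] at this
      rw [this, zero_smul]
      exact Submodule.zero_mem _
    · exact Submodule.smul_mem _ _ (Submodule.subset_span ⟨a, rfl⟩)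
  · refine (finrank_range_le_card (R := ℝ) _).trans ?_
    simp [hV, mul_comm]

/-- For `k ≠ 1`, the differentials `dy^i` vanish on a subspace of dimension `n k` of the common
kernel of the `dx^α` which is isotropic for all the two-forms. If `m` is the dimension of the image
of `V` by `dy`, isotropy forces the `dp^α`, restricted to `V ∩ ker dy`, to take values in the
annihilator of this image, so `n k - m ≤ k (n - m)`. -/
theorem coord_y_eq_zero_of_isotropic (hk : k ≠ 1) {V : Submodule ℝ T} (hV : finrank ℝ V = n * k)
    (hx : ∀ α, ∀ v ∈ V, b.coord (.inl α) v = 0)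
    (hiso : ∀ α, ∀ u ∈ V, ∀ v ∈ V, darbouxForm b α u v = 0) :
    ∀ i, ∀ v ∈ V, b.coord (.inr (.inl i)) v = 0 := by
  have : FiniteDimensional ℝ T := b.finiteDimensional_of_finite
  let dy : V →ₗ[ℝ] (Fin n → ℝ) :=
    (LinearMap.pi fun i => b.coord (.inr (.inl i))).comp V.subtype
  let Y := LinearMap.range dy
  let N : LinearMap.ker dy →ₗ[ℝ] (Fin k → Y.dualAnnihilator) :=
    LinearMap.pi fun α => LinearMap.codRestrict _
      ((∑ i, (LinearMap.toSpanSingleton ℝ (Dual ℝ (Fin n → ℝ)) (LinearMap.proj i)).comp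
        ((b.coord (.inr (.inr (α, i)))).comp V.subtype)).comp (LinearMap.ker dy).subtype) (by
      rintro ⟨w, hw⟩
      rw [Submodule.mem_dualAnnihilator]
      rintro _ ⟨v, rfl⟩
      have h1 := hiso α v v.2 w w.2
      have h2 : ∀ i, b.coord (.inr (.inl i)) (w : T) = 0 := fun i => congrFun hw i
      rw [darbouxForm] at h1
      simp only [h2, zero_mul, sub_zero] at h1
      rw [← h1]
      simp [dy, mul_comm])
  have hNapp : ∀ α w i, (N w α : Dual ℝ (Fin n → ℝ)) (Pi.single i 1) =
      b.coord (.inr (.inr (α, i))) (w : T) := by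
    intro α w i
    simp [N, Pi.single_apply]
  have hN : Function.Injective N := by
    rw [injective_iff_map_eq_zero]
    intro w hw
    refine Subtype.ext (Subtype.ext (b.ext_elem fun j => ?_))
    rcases j with β | i | ⟨α, i⟩
    · simpa using hx β _ w.1.2
    · have : b.coord (.inr (.inl i)) (w : T) = 0 := congrFun (LinearMap.mem_ker.1 w.2) i
      simpa using this
    · have := hNapp α w i
      rw [hw] at this
      simpa using this.symm
  have h1 := LinearMap.finrank_le_finrank_of_injective hN
  have h2 := LinearMap.finrank_range_add_finrank_ker dy
  have h3 := Subspace.finrank_add_finrank_dualAnnihilator_eq Y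
  have h4 : finrank ℝ (Fin k → Y.dualAnnihilator) = k * finrank ℝ Y.dualAnnihilator := by
    have hf : Module.Free ℝ Y.dualAnnihilator := Module.Free.of_divisionRing ℝ Y.dualAnnihilator
    rw [finrank_pi_fintype, Finset.sum_const, Finset.card_univ, Fintype.card_fin, smul_eq_mul]
  rw [h4] at h1
  rw [finrank_fin_fun] at h3
  rw [hV] at h2
  have hm : finrank ℝ Y = 0 := by
    change finrank ℝ Y + _ = _ at h2
    generalize finrank ℝ Y = m at *
    generalize finrank ℝ (LinearMap.ker dy) = l at *
    generalize finrank ℝ Y.dualAnnihilator = r at *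
    subst h3
    rcases Nat.lt_or_gt_of_ne hk with hk | hk
    · obtain rfl : k = 0 := by omega
      omega
    · by_contra hm
      have : 1 * m < k * m := Nat.mul_lt_mul_of_pos_right hk (Nat.pos_of_ne_zero hm)
      nlinarith
  intro i v hv
  have h4 : dy ⟨v, hv⟩ ∈ Y := ⟨_, rfl⟩
  rw [Submodule.finrank_eq_zero.1 hm, Submodule.mem_bot] at h4
  exact congrFun h4 i

end NormalForm

/-! ### Alternating forms on a vector space as bilinear forms -/

section BilinearForms

variable {E : Type*} [NormedAddCommGroup E] [NormedSpace ℝ E]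

variable (E) in
/-- The linear form underlying an alternating form of degree one. -/
def linOfOneForm : (E [⋀^Fin 1]→L[ℝ] ℝ) →L[ℝ] E →L[ℝ] ℝ :=
  (ContinuousAlternatingMap.ofSubsingletonLIE (𝕜 := ℝ) (E := E) (F := ℝ)
    (0 : Fin 1)).symm.toContinuousLinearEquiv.toContinuousLinearMap

variable (E) in
/-- The bilinear form underlying an alternating form of degree two. -/
def bilinOfTwoForm : (E [⋀^Fin 2]→L[ℝ] ℝ) →L[ℝ] E →L[ℝ] E →L[ℝ] ℝ :=
  (ContinuousLinearMap.compL ℝ E (E [⋀^Fin 1]→L[ℝ] ℝ) (E →L[ℝ] ℝ) (linOfOneForm E)) ∘L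
    (ContinuousAlternatingMap.curryLeftLI (𝕜 := ℝ) (E := E) (F := ℝ)
      (n := 1)).toContinuousLinearMap

@[simp]
theorem linOfOneForm_apply (w : E [⋀^Fin 1]→L[ℝ] ℝ) (v : E) : linOfOneForm E w v = w ![v] := by
  refine congrArg w ?_
  ext i
  fin_cases i
  rfl

@[simp]
theorem bilinOfTwoForm_apply (w : E [⋀^Fin 2]→L[ℝ] ℝ) (u v : E) :
    bilinOfTwoForm E w u v = w ![u, v] := by
  refine (linOfOneForm_apply (w.curryLeft u) v).trans ?_
  rfl

theorem isSkewAt_bilinOfTwoForm (w : E → E [⋀^Fin 2]→L[ℝ] ℝ) (x : E) :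
    IsSkewAt (fun z => bilinOfTwoForm E (w z)) x := by
  intro u v
  have h : w x (![u, v] ∘ Equiv.swap 0 1) = -w x ![u, v] :=
    (w x).map_swap ![u, v] (show (0 : Fin 2) ≠ 1 by simp)
  have h2 : (![u, v] ∘ Equiv.swap 0 1 : Fin 2 → E) = ![v, u] := by
    ext i
    fin_cases i <;> simp
  rw [h2] at h
  simp [h]

theorem fderiv_linOfOneForm_symm_of_extDeriv_eq_zero {w : E → E [⋀^Fin 1]→L[ℝ] ℝ} {x : E}
    (hw : DifferentiableAt ℝ w x) (hd : extDeriv w x = 0) (u v : E) :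
    fderiv ℝ (fun z => linOfOneForm E (w z)) x u v =
      fderiv ℝ (fun z => linOfOneForm E (w z)) x v u := by
  have h := extDeriv_apply hw ![u, v]
  have h1 : ∀ t : Fin 1 → E, fderiv ℝ (fun z => w z t) x =
      ContinuousAlternatingMap.apply ℝ E ℝ t ∘L fderiv ℝ w x := fun t =>
    ((ContinuousAlternatingMap.apply ℝ E ℝ t).hasFDerivAt.comp x hw.hasFDerivAt).fderiv
  have h2 : fderiv ℝ (fun z => linOfOneForm E (w z)) x = linOfOneForm E ∘L fderiv ℝ w x :=
    ((linOfOneForm E).hasFDerivAt.comp x hw.hasFDerivAt).fderiv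
  have e0 : (0 : Fin 2).removeNth ![u, v] = ![v] := by
    ext i; fin_cases i; rfl
  have e1 : (1 : Fin 2).removeNth ![u, v] = ![u] := by
    ext i; fin_cases i; rfl
  rw [hd, Fin.sum_univ_two, e0, e1] at h
  simp only [h1] at h
  rw [h2]
  simp at h ⊢
  linarith

theorem isClosedAt_bilinOfTwoForm {w : E → E [⋀^Fin 2]→L[ℝ] ℝ} {x : E}
    (hw : DifferentiableAt ℝ w x) (hd : extDeriv w x = 0) :
    IsClosedAt (fun z => bilinOfTwoForm E (w z)) x := by
  intro a b c
  have h := extDeriv_apply hw ![a, b, c]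
  have h1 : ∀ t : Fin 2 → E, fderiv ℝ (fun z => w z t) x =
      ContinuousAlternatingMap.apply ℝ E ℝ t ∘L fderiv ℝ w x := fun t =>
    ((ContinuousAlternatingMap.apply ℝ E ℝ t).hasFDerivAt.comp x hw.hasFDerivAt).fderiv
  have hL : HasFDerivAt (fun q => bilinOfTwoForm E q) (bilinOfTwoForm E) (w x) := by
    apply ContinuousLinearMap.hasFDerivAt
  have h2 : fderiv ℝ (fun z => bilinOfTwoForm E (w z)) x = bilinOfTwoForm E ∘L fderiv ℝ w x :=
    (HasFDerivAt.comp (g := fun q => bilinOfTwoForm E q) (f := w) x hL hw.hasFDerivAt).fderiv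
  have e0 : (0 : Fin 3).removeNth ![a, b, c] = ![b, c] := by
    ext i; fin_cases i <;> rfl
  have e1 : (1 : Fin 3).removeNth ![a, b, c] = ![a, c] := by
    ext i; fin_cases i <;> rfl
  have e2 : (2 : Fin 3).removeNth ![a, b, c] = ![a, b] := by
    ext i; fin_cases i <;> rfl
  rw [hd, Fin.sum_univ_three, e0, e1, e2] at h
  simp only [h1] at h
  have h3 := isSkewAt_bilinOfTwoForm (fun _ : E => fderiv ℝ w x b) x a c
  simp only [bilinOfTwoForm_apply] at h3
  rw [h2]
  simp at h ⊢
  linarith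

end BilinearForms

/-! ### Transfer between a manifold and its charts -/

section Charts

variable {E : Type*} [NormedAddCommGroup E] [NormedSpace ℝ E]
  {M : Type*} [TopologicalSpace M] [ChartedSpace E M]

/-- The vector tangent to `M` with expression `v` in the chart `φ` at `z`. -/
def tangentOfChart (φ : OpenPartialHomeomorph M E) (z : E) :
    E →L[ℝ] TangentSpace 𝓘(ℝ, E) (φ.symm z) :=
  (mfderiv 𝓘(ℝ, E) 𝓘(ℝ, E) φ.symm z).comp
    (NormedSpace.fromTangentSpace (𝕜 := ℝ) z).symm.toContinuousLinearMap

theorem linOfOneForm_formInChart (φ : OpenPartialHomeomorph M E)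
    (θ : ∀ x : M, TangentSpace 𝓘(ℝ, E) x →L[ℝ] ℝ) (z v : E) :
    linOfOneForm E (formInChart φ (oneForm θ) z) v = θ (φ.symm z) (tangentOfChart φ z v) := by
  rw [linOfOneForm_apply]
  rfl

theorem bilinOfTwoForm_formInChart (φ : OpenPartialHomeomorph M E)
    (w : ∀ x : M, TangentSpace 𝓘(ℝ, E) x [⋀^Fin 2]→L[ℝ] ℝ) (z u v : E) :
    bilinOfTwoForm E (formInChart φ w z) u v =
      w (φ.symm z) ![tangentOfChart φ z u, tangentOfChart φ z v] := by
  rw [bilinOfTwoForm_apply]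
  refine congrArg (w (φ.symm z)) ?_
  ext i
  fin_cases i <;> rfl

variable [IsManifold 𝓘(ℝ, E) ∞ M] {φ : OpenPartialHomeomorph M E}

theorem mdifferentiable_of_mem_smooth_atlas (hφ : φ ∈ atlas E M) :
    φ.MDifferentiable 𝓘(ℝ, E) 𝓘(ℝ, E) := by
  have : IsManifold 𝓘(ℝ, E) 1 M := IsManifold.of_le (n := ∞) (by simp)
  exact mdifferentiable_of_mem_atlas hφ

theorem mfderiv_tangentOfChart (hφ : φ ∈ atlas E M) {z : E} (hz : z ∈ φ.target) (v : E) :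
    mfderiv 𝓘(ℝ, E) 𝓘(ℝ, E) φ (φ.symm z) (tangentOfChart φ z v) = v :=
  congrArg (fun L => L v) ((mdifferentiable_of_mem_smooth_atlas hφ).comp_symm_deriv hz)

theorem isInvertible_mfderiv_of_mem_atlas (hφ : φ ∈ atlas E M) {p : M} (hp : p ∈ φ.source) :
    (mfderiv 𝓘(ℝ, E) 𝓘(ℝ, E) φ p).IsInvertible :=
  ⟨(mdifferentiable_of_mem_smooth_atlas hφ).mfderiv hp, rfl⟩

theorem isInvertible_mfderiv_symm_of_mem_atlas (hφ : φ ∈ atlas E M) {z : E} (hz : z ∈ φ.target) :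
    (mfderiv 𝓘(ℝ, E) 𝓘(ℝ, E) φ.symm z).IsInvertible :=
  ⟨(mdifferentiable_of_mem_smooth_atlas hφ).symm.mfderiv hz, rfl⟩

theorem bijective_tangentOfChart (hφ : φ ∈ atlas E M) {z : E} (hz : z ∈ φ.target) :
    Function.Bijective (tangentOfChart φ z) :=
  (mdifferentiable_of_mem_smooth_atlas hφ).symm.mfderiv_bijective hz

theorem mpullback_eq_tangentOfChart (hφ : φ ∈ atlas E M) {z : E} (hz : z ∈ φ.target)
    (Y : E → E) :
    VectorField.mpullback 𝓘(ℝ, E) 𝓘(ℝ, E) φ Y (φ.symm z) = tangentOfChart φ z (Y z) := by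
  have hp : φ.symm z ∈ φ.source := φ.map_target hz
  apply (mdifferentiable_of_mem_smooth_atlas hφ).mfderiv_injective hp
  refine ((isInvertible_mfderiv_of_mem_atlas hφ hp).self_apply_inverse _).trans ?_
  exact (congrArg Y (φ.right_inv hz)).trans (mfderiv_tangentOfChart hφ hz (Y z)).symm

theorem tangentOfChart_mpullback_symm (hφ : φ ∈ atlas E M) {z : E} (hz : z ∈ φ.target)
    (X : ∀ x : M, TangentSpace 𝓘(ℝ, E) x) :
    tangentOfChart φ z (VectorField.mpullback 𝓘(ℝ, E) 𝓘(ℝ, E) φ.symm X z) = X (φ.symm z) :=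
  (isInvertible_mfderiv_symm_of_mem_atlas hφ hz).self_apply_inverse _

/-- A smooth vector field has a smooth expression in a chart. -/
theorem IsSmoothFieldOn.contDiffAt_mpullback_symm [FiniteDimensional ℝ E] (hφ : φ ∈ atlas E M)
    {X : ∀ x : M, TangentSpace 𝓘(ℝ, E) x} {U : Set M} (hU : IsOpen U) (hX : IsSmoothFieldOn X U)
    {z : E} (hz : z ∈ φ.target) (hzU : φ.symm z ∈ U) :
    ContDiffAt ℝ ∞ (F := E) (VectorField.mpullback 𝓘(ℝ, E) 𝓘(ℝ, E) φ.symm X) z := by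
  have := FiniteDimensional.complete ℝ E
  refine contMDiffAt_vectorSpace_iff_contDiffAt.1 ?_
  refine ContMDiffAt.mpullback_vectorField_preimage (n := ∞)
    (hX.contMDiffAt (hU.mem_nhds hzU)) ?_ (isInvertible_mfderiv_symm_of_mem_atlas hφ hz) (by simp)
  exact contMDiffAt_symm_of_mem_maximalAtlas (IsManifold.subset_maximalAtlas hφ) hz

/-- Bracket conditions between distributions hold for fields given by their expressions in a
chart. -/
theorem BracketSubset.tangentOfChart_lieBracket_mem [FiniteDimensional ℝ E] (hφ : φ ∈ atlas E M)
    {D₁ D₂ D₃ : ∀ x : M, Submodule ℝ (TangentSpace 𝓘(ℝ, E) x)} (h : BracketSubset D₁ D₂ D₃)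
    {W : Set E} (hW : IsOpen W) (hWφ : W ⊆ φ.target) {Y₁ Y₂ : E → E} (h₁ : ContDiff ℝ ∞ Y₁)
    (h₂ : ContDiff ℝ ∞ Y₂) (hD₁ : ∀ z ∈ W, tangentOfChart φ z (Y₁ z) ∈ D₁ (φ.symm z))
    (hD₂ : ∀ z ∈ W, tangentOfChart φ z (Y₂ z) ∈ D₂ (φ.symm z)) {z : E} (hz : z ∈ W) :
    tangentOfChart φ z (VectorField.lieBracket ℝ Y₁ Y₂ z) ∈ D₃ (φ.symm z) := by
  have := FiniteDimensional.complete ℝ E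
  have : IsManifold 𝓘(ℝ, E) (minSmoothness ℝ 2) M :=
    IsManifold.of_le (n := ∞) (by simp [ENat.LEInfty.out])
  have hsm : ∀ {Y : E → E}, ContDiff ℝ ∞ Y → ∀ w,
      ContMDiffAt 𝓘(ℝ, E) (𝓘(ℝ, E)).tangent ∞
        (fun x => (⟨x, Y x⟩ : TangentBundle 𝓘(ℝ, E) E)) w := fun hY w =>
    contMDiffAt_vectorSpace_iff_contDiffAt.2 hY.contDiffAt
  have hφs : ∀ p ∈ φ.source, ContMDiffAt 𝓘(ℝ, E) 𝓘(ℝ, E) ∞ φ p := fun p hp =>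
    contMDiffAt_of_mem_maximalAtlas (IsManifold.subset_maximalAtlas hφ) hp
  let U : Set M := φ.source ∩ φ ⁻¹' W
  have hU : IsOpen U := φ.isOpen_inter_preimage hW
  have hsmU : ∀ {Y : E → E}, ContDiff ℝ ∞ Y →
      IsSmoothFieldOn (VectorField.mpullback 𝓘(ℝ, E) 𝓘(ℝ, E) φ Y) U := fun hY p hp =>
    (ContMDiffAt.mpullback_vectorField_preimage (n := ∞) (hsm hY _) (hφs p hp.1)
      (isInvertible_mfderiv_of_mem_atlas hφ hp.1) (by simp)).contMDiffWithinAt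
  have hmem : ∀ {Y : E → E} {D : ∀ x : M, Submodule ℝ (TangentSpace 𝓘(ℝ, E) x)},
      (∀ z ∈ W, tangentOfChart φ z (Y z) ∈ D (φ.symm z)) →
      ∀ p ∈ U, VectorField.mpullback 𝓘(ℝ, E) 𝓘(ℝ, E) φ Y p ∈ D p := by
    intro Y D hD p hp
    have := hD _ hp.2
    rw [← mpullback_eq_tangentOfChart hφ (hWφ hp.2), φ.left_inv hp.1] at this
    exact this
  have hzU : φ.symm z ∈ U := ⟨φ.map_target (hWφ hz), by
    rw [mem_preimage, φ.right_inv (hWφ hz)]; exact hz⟩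
  have key := h U _ _ hU (hsmU h₁) (hsmU h₂) (hmem hD₁) (hmem hD₂) _ hzU
  rw [← VectorField.mpullback_mlieBracket (n := ∞) ((hsm h₁ _).mdifferentiableAt (by simp))
    ((hsm h₂ _).mdifferentiableAt (by simp)) (hφs _ hzU.1) (by simp [ENat.LEInfty.out])] at key
  have e₁ : ∀ V₁ V₂ : (∀ x : E, TangentSpace 𝓘(ℝ, E) x),
      VectorField.mlieBracket 𝓘(ℝ, E) V₁ V₂ = VectorField.lieBracket ℝ V₁ V₂ := by
    intro V₁ V₂
    exact VectorField.mlieBracketWithin_univ.symm.trans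
      (VectorField.mlieBracketWithin_eq_lieBracketWithin.trans VectorField.lieBracketWithin_univ)
  have e₂ : VectorField.mpullback 𝓘(ℝ, E) 𝓘(ℝ, E) φ
      (VectorField.mlieBracket 𝓘(ℝ, E) Y₁ Y₂) (φ.symm z) =
        tangentOfChart φ z (VectorField.lieBracket ℝ Y₁ Y₂ z) :=
    (congrArg (fun V : (∀ x : E, TangentSpace 𝓘(ℝ, E) x) =>
      VectorField.mpullback 𝓘(ℝ, E) 𝓘(ℝ, E) φ V (φ.symm z)) (e₁ Y₁ Y₂)).trans
      (mpullback_eq_tangentOfChart hφ (hWφ hz) _)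
  exact (congrArg (· ∈ D₃ (φ.symm z)) e₂).mp key

end Charts

/-! ### Smooth coordinates -/

section Coordinates

variable {E : Type*} [NormedAddCommGroup E] [NormedSpace ℝ E]
  {M : Type*} [TopologicalSpace M] [ChartedSpace E M] {ι : Type*} [Fintype ι]
  {φ : OpenPartialHomeomorph M (ι → ℝ)}

theorem IsSmoothCoordinates.mdifferentiable (h : IsSmoothCoordinates (E := E) φ) :
    φ.MDifferentiable 𝓘(ℝ, E) 𝓘(ℝ, ι → ℝ) :=
  ⟨h.contMDiffOn.mdifferentiableOn (by simp), h.contMDiffOn_symm.mdifferentiableOn (by simp)⟩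

theorem coordDiff_eq_mfderiv_apply {p : M} (h : MDifferentiableAt 𝓘(ℝ, E) 𝓘(ℝ, ι → ℝ) φ p)
    (j : ι) (v : TangentSpace 𝓘(ℝ, E) p) :
    coordDiff φ j p v =
      NormedSpace.fromTangentSpace (𝕜 := ℝ) (φ p) (mfderiv 𝓘(ℝ, E) 𝓘(ℝ, ι → ℝ) φ p v) j := by
  let π : (ι → ℝ) →L[ℝ] ℝ := ContinuousLinearMap.proj j
  have h1 : HasMFDerivAt 𝓘(ℝ, ι → ℝ) 𝓘(ℝ, ℝ) π (φ p) π := π.hasFDerivAt.hasMFDerivAt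
  have h2 := (h1.comp p h.hasMFDerivAt).mfderiv
  change mfderiv 𝓘(ℝ, E) 𝓘(ℝ, ℝ) (π ∘ φ) p v = _
  rw [h2]
  rfl

/-- At each point, the coordinate vectors form a basis whose dual basis consists of the
differentials of the coordinates. -/
theorem IsSmoothCoordinates.exists_basis [DecidableEq ι] (h : IsSmoothCoordinates (E := E) φ)
    {z : ι → ℝ} (hz : z ∈ φ.target) :
    ∃ b : Basis ι ℝ (TangentSpace 𝓘(ℝ, E) (φ.symm z)), (∀ j, b j = coordVector φ j z) ∧
      ∀ j v, b.coord j v = coordDiff φ j (φ.symm z) v := by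
  have hp : φ.symm z ∈ φ.source := φ.map_target hz
  let e := (NormedSpace.fromTangentSpace (𝕜 := ℝ) z).symm.trans (h.mdifferentiable.symm.mfderiv hz)
  have he : ∀ u, e u = mfderiv 𝓘(ℝ, ι → ℝ) 𝓘(ℝ, E) φ.symm z
      ((NormedSpace.fromTangentSpace (𝕜 := ℝ) z).symm u) := fun u => rfl
  refine ⟨(Pi.basisFun ℝ ι).map e.toLinearEquiv, fun j => ?_, fun j v => ?_⟩
  · rw [Basis.map_apply, Pi.basisFun_apply]
    rfl
  · obtain ⟨u, rfl⟩ := e.surjective v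
    rw [coordDiff_eq_mfderiv_apply (h.mdifferentiable.mdifferentiableAt hp)]
    have h1 := congrArg (fun L => L u) (h.mdifferentiable.comp_symm_deriv hz)
    have h2 : NormedSpace.fromTangentSpace (𝕜 := ℝ) (φ (φ.symm z))
        (mfderiv 𝓘(ℝ, E) 𝓘(ℝ, ι → ℝ) φ (φ.symm z) (e u)) = u := h1
    rw [h2, Basis.coord_apply, Basis.map_repr]
    simp

variable [IsManifold 𝓘(ℝ, E) ∞ M] {φ₀ : OpenPartialHomeomorph M E}

/-- The expression in a chart of the differential of a coordinate. -/
theorem coordDiff_tangentOfChart (hφ₀ : φ₀ ∈ atlas E M) {f : E → ι → ℝ} (hf : ContDiff ℝ ∞ f)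
    (hφ : ∀ p, φ p = f (φ₀ p)) {z : E} (hz : z ∈ φ₀.target) (j : ι) (v : E) :
    coordDiff φ j (φ₀.symm z) (tangentOfChart φ₀ z v) = fderiv ℝ (fun z => f z j) z v := by
  have hp : φ₀.symm z ∈ φ₀.source := φ₀.map_target hz
  have h1 : HasMFDerivAt 𝓘(ℝ, E) 𝓘(ℝ, ℝ) (fun z => f z j) (φ₀ (φ₀.symm z))
      (fderiv ℝ (fun z => f z j) (φ₀ (φ₀.symm z))) :=
    (((contDiff_pi.1 hf j).differentiable (by simp)) _).hasFDerivAt.hasMFDerivAt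
  have h2 := (h1.comp (φ₀.symm z)
    ((mdifferentiable_of_mem_smooth_atlas hφ₀).mdifferentiableAt hp).hasMFDerivAt).mfderiv
  have h3 : (fun q => φ q j) = (fun z => f z j) ∘ φ₀ := funext fun q => congrFun (hφ q) j
  rw [coordDiff, h3]
  change mfderiv 𝓘(ℝ, E) 𝓘(ℝ, ℝ) ((fun z => f z j) ∘ φ₀) (φ₀.symm z) (tangentOfChart φ₀ z v) = _
  rw [h2]
  change fderiv ℝ (fun z => f z j) (φ₀ (φ₀.symm z))
    (mfderiv 𝓘(ℝ, E) 𝓘(ℝ, E) φ₀ (φ₀.symm z) (tangentOfChart φ₀ z v)) = _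
  rw [φ₀.right_inv hz]
  exact congrArg _ (mfderiv_tangentOfChart hφ₀ hz v)

/-- A map which is invertible near a point of the target of a chart gives coordinates, on a
neighbourhood as small as desired. -/
theorem exists_isSmoothCoordinates (hφ₀ : φ₀ ∈ atlas E M) {f : E → ι → ℝ} (hf : ContDiff ℝ ∞ f)
    {g : (ι → ℝ) → E} (hg : ContDiff ℝ ∞ g) {x : M} (hx : x ∈ φ₀.source)
    (hgf : ∀ᶠ z in 𝓝 (φ₀ x), g (f z) = z) (hfg : ∀ᶠ w in 𝓝 (f (φ₀ x)), f (g w) = w)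
    {P : E → Prop} (hP : ∀ᶠ z in 𝓝 (φ₀ x), P z) :
    ∃ φ : OpenPartialHomeomorph M (ι → ℝ), x ∈ φ.source ∧ IsSmoothCoordinates (E := E) φ ∧
      (∀ p ∈ φ.source, p ∈ φ₀.source ∧ P (φ₀ p)) ∧ ∀ p, φ p = f (φ₀ p) := by
  obtain ⟨U, hU, hUo, hxU⟩ := eventually_nhds_iff.1 (hgf.and hP)
  obtain ⟨W, hW, hWo, hxW⟩ := eventually_nhds_iff.1 hfg
  let Ψ : OpenPartialHomeomorph E (ι → ℝ) :=
    { toFun := f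
      invFun := g
      source := U ∩ f ⁻¹' W
      target := W ∩ g ⁻¹' U
      map_source' := fun z hz => ⟨hz.2, by rw [mem_preimage, (hU z hz.1).1]; exact hz.1⟩
      map_target' := fun w hw => ⟨hw.2, by rw [mem_preimage, hW w hw.1]; exact hw.1⟩
      left_inv' := fun z hz => (hU z hz.1).1
      right_inv' := fun w hw => hW w hw.1
      open_source := hUo.inter (hWo.preimage hf.continuous)
      open_target := hWo.inter (hUo.preimage hg.continuous)
      continuousOn_toFun := hf.continuous.continuousOn
      continuousOn_invFun := hg.continuous.continuousOn }
  refine ⟨φ₀.trans Ψ, ⟨hx, hxU, hxW⟩, ⟨?_, ?_⟩, fun p hp => ⟨hp.1, (hU _ hp.2.1).2⟩, fun p => rfl⟩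
  · exact hf.contMDiff.comp_contMDiffOn
      ((contMDiffOn_of_mem_maximalAtlas (IsManifold.subset_maximalAtlas hφ₀)).mono fun p hp => hp.1)
  · exact (contMDiffOn_symm_of_mem_maximalAtlas (IsManifold.subset_maximalAtlas hφ₀)).comp
      hg.contMDiff.contMDiffOn fun w hw => hw.2

end Coordinates

/-! ### Expressions in a chart of forms and distributions -/

section LocalExpressions

variable {E : Type*} [NormedAddCommGroup E] [NormedSpace ℝ E] [FiniteDimensional ℝ E]
  {M : Type*} [TopologicalSpace M] [ChartedSpace E M] {φ : OpenPartialHomeomorph M E}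

theorem mem_kerTwoForm {T : Type*} [AddCommGroup T] [Module ℝ T] [TopologicalSpace T]
    {w : T [⋀^Fin 2]→L[ℝ] ℝ} {v : T} :
    v ∈ kerTwoForm w.toAlternatingMap ↔ ∀ u, w ![v, u] = 0 := by
  rw [kerTwoForm, LinearMap.mem_ker]
  refine ⟨fun h u => ?_, fun h => ?_⟩
  · exact congrArg (fun L => L ![u]) h
  · ext t
    have : t = ![t 0] := by
      ext i; fin_cases i; rfl
    rw [this]
    exact h (t 0)

/-- The expression of a closed one-form in a chart, cut off so as to be smooth on the whole model
space; it is the expression of the form, and closed, near the base point only. -/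
theorem exists_oneForm_in_chart (hφ : φ ∈ atlas E M)
    {θ : ∀ x : M, TangentSpace 𝓘(ℝ, E) x →L[ℝ] ℝ} (hs : IsSmoothForm (oneForm θ))
    (hc : IsClosedForm (oneForm θ)) {z₀ : E} (hz₀ : z₀ ∈ φ.target) :
    ∃ a : E → E →L[ℝ] ℝ, ContDiff ℝ ∞ a ∧
      (∀ᶠ z in 𝓝 z₀, ∀ v, a z v = θ (φ.symm z) (tangentOfChart φ z v)) ∧
      ∀ᶠ z in 𝓝 z₀, ∀ u v, fderiv ℝ a z u v = fderiv ℝ a z v u := by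
  have hd : ∀ z ∈ φ.target, ContDiffAt ℝ ∞ (formInChart φ (oneForm θ)) z := fun z hz =>
    (hs φ hφ).contDiffAt (φ.open_target.mem_nhds hz)
  obtain ⟨a, ha, haf⟩ := exists_contDiff_eventuallyEq (x₀ := z₀)
    (f := fun z => linOfOneForm E (formInChart φ (oneForm θ) z)) (by
      filter_upwards [φ.open_target.mem_nhds hz₀] with z hz
      exact (linOfOneForm E).contDiff.contDiffAt.comp z (hd z hz))
  refine ⟨a, ha, ?_, ?_⟩
  · filter_upwards [haf] with z hz v
    rw [hz, linOfOneForm_formInChart]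
  · filter_upwards [haf.eventuallyEq_nhds, φ.open_target.mem_nhds hz₀] with z hz hzt u v
    rw [hz.fderiv_eq]
    exact fderiv_linOfOneForm_symm_of_extDeriv_eq_zero ((hd z hzt).differentiableAt (by simp))
      (hc φ hφ z hzt) u v

/-- The expression of a closed two-form in a chart, cut off away from the base point. -/
theorem exists_twoForm_in_chart (hφ : φ ∈ atlas E M)
    {w : ∀ x : M, TangentSpace 𝓘(ℝ, E) x [⋀^Fin 2]→L[ℝ] ℝ} (hs : IsSmoothForm w)
    (hc : IsClosedForm w) {z₀ : E} (hz₀ : z₀ ∈ φ.target) :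
    ∃ B : E → E →L[ℝ] E →L[ℝ] ℝ, ContDiff ℝ ∞ B ∧
      (∀ᶠ z in 𝓝 z₀, ∀ u v, B z u v =
        w (φ.symm z) ![tangentOfChart φ z u, tangentOfChart φ z v]) ∧
      (∀ᶠ z in 𝓝 z₀, IsSkewAt B z) ∧ ∀ᶠ z in 𝓝 z₀, IsClosedAt B z := by
  have hd : ∀ z ∈ φ.target, ContDiffAt ℝ ∞ (formInChart φ w) z := fun z hz =>
    (hs φ hφ).contDiffAt (φ.open_target.mem_nhds hz)
  have hL : ContDiff ℝ ∞ (fun q => bilinOfTwoForm E q) := by fun_prop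
  obtain ⟨B, hB, hBf⟩ := exists_contDiff_eventuallyEq (x₀ := z₀)
    (f := fun z => bilinOfTwoForm E (formInChart φ w z)) (by
      filter_upwards [φ.open_target.mem_nhds hz₀] with z hz
      exact hL.contDiffAt.comp z (hd z hz))
  refine ⟨B, hB, ?_, ?_, ?_⟩
  · filter_upwards [hBf] with z hz u v
    rw [hz, bilinOfTwoForm_formInChart]
  · filter_upwards [hBf] with z hz u v
    rw [hz]
    exact isSkewAt_bilinOfTwoForm (formInChart φ w) z u v
  · filter_upwards [hBf.eventuallyEq_nhds, φ.open_target.mem_nhds hz₀] with z hz hzt u v t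
    rw [hz.fderiv_eq]
    exact isClosedAt_bilinOfTwoForm ((hd z hzt).differentiableAt (by simp)) (hc φ hφ z hzt) u v t

variable [IsManifold 𝓘(ℝ, E) ∞ M]

/-- A smooth distribution is given in a chart, near the base point, by the range of a smooth
injective family of linear maps. -/
theorem exists_frame_in_chart (hφ : φ ∈ atlas E M) {r : ℕ}
    {D : ∀ x : M, Submodule ℝ (TangentSpace 𝓘(ℝ, E) x)} (hD : IsSmoothDistribution r D) {z₀ : E}
    (hz₀ : z₀ ∈ φ.target) :
    ∃ X : E → (Fin r → ℝ) →L[ℝ] E, ContDiff ℝ ∞ X ∧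
      ∀ᶠ z in 𝓝 z₀, Function.Injective (X z) ∧
        ∀ v, tangentOfChart φ z v ∈ D (φ.symm z) ↔ v ∈ range (X z) := by
  obtain ⟨U, hU, hzU, F, hF, hFD⟩ := hD (φ.symm z₀)
  have hnear : ∀ᶠ z in 𝓝 z₀, z ∈ φ.target ∧ φ.symm z ∈ U :=
    (φ.open_target.eventually_mem hz₀).and ((φ.continuousAt_symm hz₀).eventually (hU.mem_nhds hzU))
  choose X hX hXF using fun i => exists_contDiff_eventuallyEq (x₀ := z₀) (F := E)
    (f := VectorField.mpullback 𝓘(ℝ, E) 𝓘(ℝ, E) φ.symm (F i)) (by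
      filter_upwards [hnear] with z hz
      exact (hF i).contDiffAt_mpullback_symm hφ hU hz.1 hz.2)
  refine ⟨fun z => ∑ i, (ContinuousLinearMap.proj i : (Fin r → ℝ) →L[ℝ] ℝ).smulRight (X i z),
    ?_, ?_⟩
  · exact ContDiff.sum fun i _ => contDiff_const.smulRight (hX i)
  · filter_upwards [hnear, eventually_all.2 hXF] with z ⟨hzt, hzU⟩ hz
    obtain ⟨hli, hspan⟩ := hFD _ hzU
    have key : ∀ c : Fin r → ℝ, tangentOfChart φ z
        ((∑ i, (ContinuousLinearMap.proj i : (Fin r → ℝ) →L[ℝ] ℝ).smulRight (X i z)) c) =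
          ∑ i, c i • F i (φ.symm z) := by
      intro c
      rw [sum_apply, map_sum]
      refine Finset.sum_congr rfl fun i _ => ?_
      rw [ContinuousLinearMap.smulRight_apply, map_smul, hz i, tangentOfChart_mpullback_symm hφ hzt]
      rfl
    have hT := bijective_tangentOfChart hφ hzt
    refine ⟨?_, fun v => ?_⟩
    · rw [injective_iff_map_eq_zero]
      intro c hc
      have := key c
      rw [hc, map_zero] at this
      exact funext (Fintype.linearIndependent_iff.1 hli c this.symm)
    · rw [← hspan, Submodule.mem_span_range_iff_exists_fun]
      constructor
      · rintro ⟨c, hc⟩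
        exact ⟨c, hT.1 ((key c).trans hc)⟩
      · rintro ⟨c, rfl⟩
        exact ⟨c, (key c).symm⟩

end LocalExpressions

/-! ### Darboux coordinates -/

section Darboux

variable {E : Type*} [NormedAddCommGroup E] [NormedSpace ℝ E] [FiniteDimensional ℝ E]
  {M : Type*} [TopologicalSpace M] [ChartedSpace E M] [IsManifold 𝓘(ℝ, E) ∞ M] {n k : ℕ}

/-- Coordinates in which the forms of a `k`-cosymplectic structure take the normal form. If the
bracket of a field in the common kernel of the two-forms and of a field in `V` belongs to the sum of
these distributions, the differentials `dy^i` vanish on `V`. -/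
theorem KCosymplecticStructure.exists_darboux_coordinates (S : KCosymplecticStructure E M n k)
    (x : M) :
    ∃ φ : OpenPartialHomeomorph M (DarbouxIndex n k → ℝ),
      x ∈ φ.source ∧ IsSmoothCoordinates (E := E) φ ∧
      (∀ p ∈ φ.source, ∀ α v, S.η α p v = coordDiff φ (.inl α) p v) ∧
      (∀ p ∈ φ.source, ∀ α u v, S.Ω α p ![u, v] =
        ∑ i, (coordDiff φ (.inr (.inl i)) p u * coordDiff φ (.inr (.inr (α, i))) p v -
          coordDiff φ (.inr (.inl i)) p v * coordDiff φ (.inr (.inr (α, i))) p u)) ∧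
      (BracketSubset (fun p => ⨅ α, kerTwoForm (S.Ω α p).toAlternatingMap) S.V
          (fun p => (⨅ α, kerTwoForm (S.Ω α p).toAlternatingMap) ⊔ S.V p) →
        ∀ p ∈ φ.source, ∀ i, ∀ v ∈ S.V p, coordDiff φ (.inr (.inl i)) p v = 0) := by
  let φ₀ := chartAt E x
  have hφ₀ : φ₀ ∈ atlas E M := chart_mem_atlas E x
  have hx : x ∈ φ₀.source := mem_chart_source E x
  have hz₀ : φ₀ x ∈ φ₀.target := φ₀.map_source hx
  have htarget : ∀ᶠ z in 𝓝 (φ₀ x), z ∈ φ₀.target := φ₀.open_target.eventually_mem hz₀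
  -- the structure in the chart
  choose a ha haη hac using fun α => exists_oneForm_in_chart hφ₀ (S.smooth_η α) (S.closed_η α) hz₀
  choose B hB hBΩ hBs hBc using fun α =>
    exists_twoForm_in_chart hφ₀ (S.smooth_Ω α) (S.closed_Ω α) hz₀
  obtain ⟨X, hX, hXV⟩ := exists_frame_in_chart hφ₀ S.distribution_V hz₀
  have hXd : ∀ z, DifferentiableAt ℝ X z := fun z => hX.differentiable (by simp) z
  have hXc : ∀ c z t, fderiv ℝ (fun z => X z c) z t = fderiv ℝ X z t c := by
    intro c z t
    rw [((hXd z).hasFDerivAt.clm_apply (hasFDerivAt_const c z)).fderiv]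
    simp
  have hXs : ∀ c, ContDiff ℝ ∞ (fun z => X z c) := fun c => hX.clm_apply contDiff_const
  have haη' := eventually_all.2 haη
  have hBΩ' := eventually_all.2 hBΩ
  -- the kernel of the two-forms, in the chart
  have hker : ∀ᶠ z in 𝓝 (φ₀ x), ∀ v, (∀ α u, B α z v u = 0) ↔
      tangentOfChart φ₀ z v ∈ ⨅ α, kerTwoForm (S.Ω α (φ₀.symm z)).toAlternatingMap := by
    filter_upwards [hBΩ', htarget] with z hz hzt v
    simp only [Submodule.mem_iInf, mem_kerTwoForm, hz]
    refine forall_congr' fun α => ⟨fun h u => ?_, fun h u => h _⟩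
    obtain ⟨u, rfl⟩ := (bijective_tangentOfChart hφ₀ hzt).2 u
    exact h u
  have hnd : ∀ᶠ z in 𝓝 (φ₀ x), ∀ v, (∀ α, a α z v = 0) → (∀ α u, B α z v u = 0) → v = 0 := by
    filter_upwards [haη', hker, htarget] with z hz hk hzt v hv hv'
    have h1 := (hk v).1 hv'
    rw [Submodule.mem_iInf] at h1
    have h2 : tangentOfChart φ₀ z v ∈ ⨅ α, LinearMap.ker (S.η α (φ₀.symm z)).toLinearMap ⊓
        kerTwoForm (S.Ω α (φ₀.symm z)).toAlternatingMap :=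
      (Submodule.mem_iInf _).2 fun α => ⟨(hz α v).symm.trans (hv α), h1 α⟩
    rw [S.iInf_ker_eq_bot, Submodule.mem_bot] at h2
    exact (bijective_tangentOfChart hφ₀ hzt).1 (h2.trans (map_zero _).symm)
  have hreeb : ∀ᶠ z in 𝓝 (φ₀ x), ∀ c : Fin k → ℝ, ∃ v, (∀ α, a α z v = c α) ∧
      ∀ α u, B α z v u = 0 := by
    filter_upwards [haη', hker, htarget] with z hz hk hzt c
    obtain ⟨v, hv⟩ := (bijective_tangentOfChart hφ₀ hzt).2 (∑ β, c β • S.reeb β (φ₀.symm z))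
    refine ⟨v, fun α => ?_, (hk v).2 ?_⟩
    · rw [hz, hv, map_sum]
      simp [(S.reeb_spec _ _).1]
    · rw [hv]
      exact Submodule.sum_mem _ fun β _ => Submodule.smul_mem _ _
        ((Submodule.mem_iInf _).2 (S.reeb_spec β _).2)
  have hVmem : ∀ᶠ z in 𝓝 (φ₀ x), ∀ c, tangentOfChart φ₀ z (X z c) ∈ S.V (φ₀.symm z) := by
    filter_upwards [hXV] with z hz c
    exact (hz.2 _).2 ⟨c, rfl⟩
  have haX : ∀ α, ∀ᶠ z in 𝓝 (φ₀ x), ∀ c, a α z (X z c) = 0 := by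
    intro α
    filter_upwards [haη α, hVmem] with z hz hV c
    rw [hz]
    exact S.η_V α _ _ (hV c)
  have hiso : ∀ α, ∀ᶠ z in 𝓝 (φ₀ x), ∀ c d, B α z (X z c) (X z d) = 0 := by
    intro α
    filter_upwards [hBΩ α, hVmem] with z hz hV c d
    rw [hz]
    exact S.Ω_V α _ _ (hV c) _ (hV d)
  have hinv : ∀ᶠ z in 𝓝 (φ₀ x), ∀ c d,
      fderiv ℝ X z (X z c) d - fderiv ℝ X z (X z d) c ∈ range (X z) := by
    obtain ⟨W, hW, hWo, hxW⟩ := eventually_nhds_iff.1 (htarget.and (hVmem.and hXV))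
    filter_upwards [hWo.mem_nhds hxW] with z hz c d
    have := S.integrable_V.tangentOfChart_lieBracket_mem hφ₀ hWo (fun z hz => (hW z hz).1) (hXs c)
      (hXs d) (fun z hz => (hW z hz).2.1 c) (fun z hz => (hW z hz).2.1 d) hz
    rwa [VectorField.lieBracket, hXc, hXc, (hW z hz).2.2.2] at this
  obtain ⟨ξ, y, p, hξ, hy, hp, hξa, hBp, hyV⟩ := exists_darboux_functions S.dim_eq
    (finrank_fin_fun ℝ) ha hac hB hBs hBc hX hXV.self_of_nhds.1 haX hiso hinv hnd hreeb
  -- under the bracket condition, the functions `y` are constant along `V`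
  have hyV' : BracketSubset (fun p => ⨅ α, kerTwoForm (S.Ω α p).toAlternatingMap) S.V
      (fun p => (⨅ α, kerTwoForm (S.Ω α p).toAlternatingMap) ⊔ S.V p) →
      ∀ᶠ z in 𝓝 (φ₀ x), ∀ i c, fderiv ℝ (y i) z (X z c) = 0 := by
    intro hbr
    refine eventually_all.2 (hyV fun Y hY hYB => ?_)
    have hYker : ∀ᶠ z in 𝓝 (φ₀ x), tangentOfChart φ₀ z (Y z) ∈
        ⨅ α, kerTwoForm (S.Ω α (φ₀.symm z)).toAlternatingMap := by
      filter_upwards [hYB, hker] with z hz hk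
      exact (hk _).1 hz
    obtain ⟨W, hW, hWo, hxW⟩ :=
      eventually_nhds_iff.1 (htarget.and (hVmem.and (hYker.and (hXV.and hker))))
    filter_upwards [hWo.mem_nhds hxW] with z hz c
    obtain ⟨hzt, -, -, hzX, hzk⟩ := hW z hz
    have := hbr.tangentOfChart_lieBracket_mem hφ₀ hWo (fun z hz => (hW z hz).1) hY
      (hXs c) (fun z hz => (hW z hz).2.2.1) (fun z hz => (hW z hz).2.1 c) hz
    rw [VectorField.lieBracket, hXc] at this
    obtain ⟨r, hr, v, hv, hrv⟩ := Submodule.mem_sup.1 this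
    have hT := bijective_tangentOfChart hφ₀ hzt
    obtain ⟨r, rfl⟩ := hT.2 r
    obtain ⟨v, rfl⟩ := hT.2 v
    obtain ⟨d, rfl⟩ := (hzX.2 v).1 hv
    exact ⟨r, d, (hzk r).2 hr, hT.1 (hrv.symm.trans (map_add _ _ _).symm)⟩
  -- the functions form a local diffeomorphism
  let f : E → DarbouxIndex n k → ℝ := fun z =>
    Sum.elim (fun α => ξ α z) (Sum.elim (fun i => y i z) fun b => p b.1 b.2 z)
  have hf : ContDiff ℝ ∞ f := by
    refine contDiff_pi.2 fun j => ?_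
    rcases j with α | i | ⟨α, i⟩
    exacts [hξ α, hy i, hp α i]
  have hfd : ∀ z, DifferentiableAt ℝ f z := fun z => hf.differentiable (by simp) z
  have hinj : Function.Injective (fderiv ℝ f (φ₀ x)) := by
    rw [injective_iff_map_eq_zero]
    intro v hv
    have h0 : ∀ j, fderiv ℝ (fun z => f z j) (φ₀ x) v = 0 := by
      intro j
      rw [fderiv_pi_apply (hfd _), hv]
      rfl
    have h1 : ∀ i, fderiv ℝ (y i) (φ₀ x) v = 0 := fun i => h0 (.inr (.inl i))
    have h2 : ∀ α i, fderiv ℝ (p α i) (φ₀ x) v = 0 := fun α i => h0 (.inr (.inr (α, i)))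
    refine hnd.self_of_nhds v (fun α => ?_) fun α u => ?_
    · rw [← (hξa α).self_of_nhds]
      exact h0 (.inl α)
    · rw [(hBp α).self_of_nhds]
      simp [h1, h2]
  obtain ⟨g, hg, -, hgf, hfg⟩ := hf.exists_local_inverse hinj (by
    rw [S.dim_eq, finrank_fintype_fun_eq_card]
    simp
    ring)
  obtain ⟨φ, hxφ, hφ, hφP, hφf⟩ := exists_isSmoothCoordinates hφ₀ hf hg hx hgf hfg
    ((haη'.and hBΩ').and ((eventually_all.2 hξa).and ((eventually_all.2 hBp).and
      (hXV.and (eventually_imp_distrib_left.2 hyV')))))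
  refine ⟨φ, hxφ, hφ, ?_⟩
  -- points of `M` near `x` are written `φ₀.symm z`
  have htrans : ∀ Q : M → Prop, (∀ z ∈ φ₀.target, φ₀.symm z ∈ φ.source → Q (φ₀.symm z)) →
      ∀ q ∈ φ.source, Q q := by
    intro Q hQ q hq
    have h1 := (hφP q hq).1
    have h2 := hQ (φ₀ q) (φ₀.map_source h1)
    rw [φ₀.left_inv h1] at h2
    exact h2 hq
  have hcoord : ∀ z ∈ φ₀.target, ∀ j v, coordDiff φ j (φ₀.symm z) (tangentOfChart φ₀ z v) =
      fderiv ℝ (fun z => f z j) z v := fun z hz j v => coordDiff_tangentOfChart hφ₀ hf hφf hz j v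
  refine ⟨htrans _ fun z hz hzφ α v => ?_, htrans _ fun z hz hzφ α u v => ?_,
    fun hbr => htrans _ fun z hz hzφ i v hv => ?_⟩
  all_goals
    have hall := (hφP _ hzφ).2
    rw [φ₀.right_inv hz] at hall
    obtain ⟨⟨h1, h2⟩, h3, h4, h5, h6⟩ := hall
    obtain ⟨v, rfl⟩ := (bijective_tangentOfChart hφ₀ hz).2 v
  · rw [hcoord z hz, ← h1]
    exact congrArg (fun L => L v) (h3 α).symm
  · obtain ⟨u, rfl⟩ := (bijective_tangentOfChart hφ₀ hz).2 u
    simp only [hcoord z hz]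
    rw [← h2]
    exact h4 α u v
  · rw [hcoord z hz]
    obtain ⟨c, rfl⟩ := (h5.2 v).1 hv
    exact h6 hbr i c

end Darboux

end

theorem mainTheorem3 {E : Type*} [NormedAddCommGroup E] [NormedSpace ℝ E] [FiniteDimensional ℝ E]
    {M : Type*} [TopologicalSpace M] [ChartedSpace E M] [IsManifold 𝓘(ℝ, E) ∞ M]
    {n k : ℕ} (S : KCosymplecticStructure E M n k) (x : M) :
    ∃ φ : OpenPartialHomeomorph M (DarbouxIndex n k → ℝ),
      x ∈ φ.source ∧ IsSmoothCoordinates (E := E) φ ∧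
      (∀ p ∈ φ.source, ∀ α, S.η α p = coordDiff φ (.inl α) p) ∧
      (∀ p ∈ φ.source, ∀ α, (S.Ω α p).toAlternatingMap =
        ∑ i : Fin n, wedgeForms ![(coordDiff φ (.inr (.inl i)) p).toLinearMap,
          (coordDiff φ (.inr (.inr (α, i))) p).toLinearMap]) ∧
      (∀ z ∈ φ.target, ∀ α, S.reeb α (φ.symm z) = coordVector φ (.inl α) z) ∧
      (k ≠ 1 → ∀ z ∈ φ.target, S.V (φ.symm z) =
        Submodule.span ℝ (range fun a : Fin k × Fin n => coordVector φ (.inr (.inr a)) z)) ∧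
      (k = 1 →
        (∀ α, BracketSubset (fun p => kerTwoForm (S.Ω α p).toAlternatingMap) S.V
          (fun p => kerTwoForm (S.Ω α p).toAlternatingMap ⊔ S.V p)) →
        ∀ z ∈ φ.target, S.V (φ.symm z) =
          Submodule.span ℝ
            (range fun a : Fin k × Fin n => coordVector φ (.inr (.inr a)) z)) := by
  obtain ⟨φ, hx, hφ, hη, hΩ, hV⟩ := S.exists_darboux_coordinates x
  have hrank : ∀ p, finrank ℝ (S.V p) = n * k := by
    intro p
    obtain ⟨U, -, hp, X, -, hX⟩ := S.distribution_V p
    rw [← (hX p hp).2, finrank_span_eq_card (hX p hp).1, Fintype.card_fin]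
  have hspan : ∀ z ∈ φ.target,
      (∀ i, ∀ v ∈ S.V (φ.symm z), coordDiff φ (.inr (.inl i)) (φ.symm z) v = 0) →
      S.V (φ.symm z) =
        Submodule.span ℝ (range fun a : Fin k × Fin n => coordVector φ (.inr (.inr a)) z) := by
    intro z hz hy
    obtain ⟨b, hb, hbc⟩ := hφ.exists_basis hz
    simp only [← hb]
    refine eq_span_of_coord_eq_zero b (hrank _) (fun α v hv => ?_) fun i v hv => ?_
    · rw [hbc, ← hη _ (φ.map_target hz)]
      exact S.η_V α _ v hv
    · rw [hbc]
      exact hy i v hv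
  refine ⟨φ, hx, hφ, fun p hp α => ContinuousLinearMap.ext (hη p hp α), fun p hp α => ?_,
    fun z hz α => ?_, fun hk z hz => hspan z hz ?_, fun hk hbr z hz => hspan z hz ?_⟩
  · ext v
    have hv : v = ![v 0, v 1] := by
      ext i; fin_cases i <;> rfl
    let ev : (TangentSpace 𝓘(ℝ, E) p [⋀^Fin 2]→ₗ[ℝ] ℝ) →+ ℝ :=
      { toFun := fun w => w ![v 0, v 1], map_zero' := rfl, map_add' := fun _ _ => rfl }
    rw [hv]
    refine (hΩ p hp α _ _).trans (Eq.trans ?_ (map_sum ev _ _).symm)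
    refine Finset.sum_congr rfl fun i _ => ?_
    change _ = wedgeForms _ ![v 0, v 1]
    rw [wedgeForms_two_apply]
    rfl
  · obtain ⟨b, hb, hbc⟩ := hφ.exists_basis hz
    rw [← hb]
    refine eq_basis_inl_of_reeb b (fun β => ?_) fun β u => ?_
    · rw [hbc, ← hη _ (φ.map_target hz)]
      exact (S.reeb_spec α _).1 β
    · rw [← mem_kerTwoForm.1 ((S.reeb_spec α (φ.symm z)).2 β) u, hΩ _ (φ.map_target hz)]
      simp only [darbouxForm, hbc]
  · obtain ⟨b, hb, hbc⟩ := hφ.exists_basis hz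
    simp only [← hbc]
    refine coord_y_eq_zero_of_isotropic b hk (hrank _) (fun α v hv => ?_) fun α u hu v hv => ?_
    · rw [hbc, ← hη _ (φ.map_target hz)]
      exact S.η_V α _ v hv
    · rw [← S.Ω_V α _ u hu v hv, hΩ _ (φ.map_target hz)]
      simp only [darbouxForm, hbc]
  · subst hk
    refine hV ?_ _ (φ.map_target hz)
    -- the infimum over `Fin 1` is the kernel of the only two-form
    simp only [iInf_unique]
    exact hbr default
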